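/- Let $\Gamma$ be a finite group, $R(\Gamma)$ the space of complex class functions on $\Gamma$, $\Gamma_*$ its set of conjugacy classes, $\zeta_c$ the order of the centralizer of an element of $c\in\Gamma_*$, and let $\xi\in R(\Gamma)$ be self-dual, $\xi(x)=\xi(x^{-1})$. Put $\langle f,g\rangle_\xi=|\Gamma|^{-1}\sum_{x\in\Gamma}\xi(x)f(x)g(x^{-1})$ on $R(\Gamma)$. *Groups.* $\tilde S_n$ is the group generated by $z$ and $t_1,\dots,t_{n-1}$ with $z$ central, $z^2=1$, $t_i^2=z$, $(t_it_{i+1})^3=z$, $t_it_j=zt_jt_i$ for $|i-j|>1$; $\theta_n:\tilde S_n\to S_n$, $t_i\mapsto(i,i+1)$, $z\mapsto1$; the parity $d$ has $d(t_i)=1$, $d(z)=0$ in $\mathbb Z/2$. $\tilde\Gamma_n=\Gamma^n\rtimes\tilde S_n$, where $\tilde S_n$ permutes the factors through $\theta_n$, with the parity of the second component. For $m+n=N$, $\tilde\Gamma_n\hat\times\tilde\Gamma_m\subset\tilde\Gamma_N$ is the subgroup of products $xy$ with $x\in\tilde\Gamma_n$ on the first $n$ letters and $y\in\tilde\Gamma_m$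 on the last $m$ letters (here $xy=z^{d(x)d(y)}yx$). For a group $G$ of this kind, $R^-(G)$ is the space of complex class functions $f$ on $G$ with $f(zx)=-f(x)$ that vanish on odd elements; on $R^-(\tilde\Gamma_n)$ the standard form is $\langle f,g\rangle=|\tilde\Gamma_n|^{-1}\sum_{x\ \mathrm{even}}f(x)g(x^{-1})$. Let $R^-_\Gamma=\bigoplus_{n\ge0}R^-(\tilde\Gamma_n)$. *Characters.* $\eta_n(\gamma)$ is the function on $\tilde\Gamma_n$ whose value at $(g,t)$ is the product of $\gamma(g_{i_k}\cdots g_{i_1})$ over the cycles $(i_1\dots i_k)$ of $\theta_n(t)$. Let $\chi_n$ be the character of the basic spin supermodule $(\mathbb C^{1|1})^{\otimes\lfloor n/2\rfloor}$ of $\tilde S_n$, on which $z=-1$ and $t_j=\sqrt{\tfrac{j+1}{2j}}\,e_j-\sqrt{\tfrac{j-1}{2j}}\,e_{j-1}$ with anticommuting odd Clifford generators $e_1,e_2,\dots$, $e_j^2=-1$. For $\gamma\in R(\Gamma)$ put $\chi_n(\gamma)(g,t)=\eta_n(\gamma)(g,t)\,\chi_n(t)$. Let $\bar n\in\{0,1\}$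 be the parity of $n$. *Operators.* For $\gamma\in R(\Gamma)$ and $n\ge0$ define operators on $R^-_\Gamma$: $H_{-n}(\gamma)$ maps $f\in R^-(\tilde\Gamma_m)$ to the function on $\tilde\Gamma_{n+m}$ induced from $xy\mapsto2^{\bar n/2}\chi_n(\gamma)(x)f(y)$ on $\tilde\Gamma_n\hat\times\tilde\Gamma_m$; $H_n(\gamma)$ restricts $f\in R^-(\tilde\Gamma_m)$ to $\tilde\Gamma_n\hat\times\tilde\Gamma_{m-n}$ and then pairs the first factor with $\eta_n(\xi)\cdot2^{\bar n/2}\chi_n(\gamma)$ by the standard form, that is $$(H_n(\gamma)f)(y)=|\tilde\Gamma_n|^{-1}\sum_{x\in\tilde\Gamma_n\ \mathrm{even}}\eta_n(\xi)(x)\,2^{\bar n/2}\chi_n(\gamma)(x)\,f(x^{-1}y),$$ and $H_n(\gamma)f=0$ for $n>m$. Put $H_+(\gamma,z)=\sum_{n\ge0}H_{-n}(\gamma)z^n$ and $H_-(\gamma,z)=\sum_{n\ge0}H_n(\gamma)z^{-n}$. *Fock space and characteristic map.* $S^-_\Gamma$ is the polynomial algebra in $a_{-n}(c)$, $n\ge1$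 odd, $c\in\Gamma_*$. For $\gamma\in R(\Gamma)$ let $a_{-n}(\gamma)$ be multiplication by $\sum_c\zeta_c^{-1}\gamma(c)a_{-n}(c)$, and let $a_n(\gamma)$ be the derivation of $S^-_\Gamma$ with $a_n(\gamma)\cdot a_{-m}(\beta)=\frac n2\delta_{n,m}\langle\gamma,\beta\rangle_\xi$. For a family $\rho=(\rho(c))_{c\in\Gamma_*}$ of partitions with odd parts and total size $n$, let $l(\rho)$ be the number of parts, $m_k(c)$ the multiplicity of $k$ in $\rho(c)$, $Z_\rho=\prod_{c,k}k^{m_k(c)}m_k(c)!\,\zeta_c^{m_k(c)}$, $a'_{-\rho}=\prod_{c,k}a_{-k}(c)^{m_k(c)}$, and let $D_\rho^+\subset\tilde\Gamma_n$ be the conjugacy class of the elements $(g,t^\rho)$, where $t^\rho$ is a product of lifts $z^{j-1}t_it_{i+1}\cdots t_{i+j-2}$ of consecutive disjoint cycles whose lengths $j$ are the parts of $\rho$, and $g$ has cycle product in $c$ on each cycle that belongs to a part of $\rho(c)$. Let $\mathrm{ch}:R^-_\Gamma\to S^-_\Gamma$ be the linear map with $$\mathrm{ch}(f)=\sum_\rho\frac{2^{l(\rho)/2}}{Z_\rho}f(D_\rho^+)\,a'_{-\rho},\qquad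 f\in R^-(\tilde\Gamma_n).$$ **Theorem.** (a) If $\gamma$ is the character of a finite-dimensional $\Gamma$-module $V$, then $\chi_n(\gamma)$ is the character of the $\tilde\Gamma_n$-module $V^{\otimes n}\otimes(\mathbb C^{1|1})^{\otimes\lfloor n/2\rfloor}$. The map $\mathrm{ch}$ is a linear isomorphism; for an operator $T$ on $R^-_\Gamma$ put $\mathrm{ch}(T)=\mathrm{ch}\circ T\circ\mathrm{ch}^{-1}$, and apply this coefficientwise to series. For every $\gamma\in R(\Gamma)$, $$\mathrm{ch}(H_+(\gamma,z))=\exp\Big(\sum_{n\ge1,\ \mathrm{odd}}\frac2n\,a_{-n}(\gamma)z^n\Big),\qquad \mathrm{ch}(H_-(\gamma,z))=\exp\Big(\sum_{n\ge1,\ \mathrm{odd}}\frac2n\,a_n(\gamma)z^{-n}\Big),$$ and every vector of $R^-_\Gamma$ is annihilated by $H_n(\gamma)$ for all but finitely many $n$. (b) Assume moreover that $\xi$ is a virtual character, i.e. lies in the lattice $R_{\mathbb Z}(\Gamma)$ spanned by the irreducible characters. Let $c_1(\alpha,\beta)=\langle\alpha,\beta\rangle_\xi+\langle\alpha,\alpha\rangle_\xi\langle\beta,\beta\rangle_\xi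 \bmod 2$ on $R_{\mathbb Z}(\Gamma)$; let $\Phi\supseteq2R_{\mathbb Z}(\Gamma)$ be a subgroup of $R_{\mathbb Z}(\Gamma)$ maximal such that $c_1$ vanishes on $\Phi$; take a central extension of $R_{\mathbb Z}(\Gamma)/2R_{\mathbb Z}(\Gamma)$ by $\{\pm1\}$ with commutator map $(-1)^{c_1}$, elements $e_{\bar\alpha}$ of it over the $\bar\alpha=\alpha+2R_{\mathbb Z}(\Gamma)$, and an irreducible representation of it on $\mathbb C[R_{\mathbb Z}(\Gamma)/\Phi]$ in which the central element $-1$ acts by $-1$ and $e_{\bar\alpha}e^{[\beta]}=\epsilon(\alpha,\beta)e^{[\alpha+\beta]}$ with $\epsilon(\alpha,\beta)\in\{\pm1\}$. For $\gamma\in R_{\mathbb Z}(\Gamma)$ define operators $X_n(\gamma)$, $n\in\mathbb Z$, on $R^-_\Gamma\otimes\mathbb C[R_{\mathbb Z}(\Gamma)/\Phi]$ by $X(\gamma,z)=\sum_nX_n(\gamma)z^{-n}=H_+(\gamma,z)H_-(\gamma,-z)e_{\bar\gamma}$. Then, with $\mathrm{ch}$ extended by the identity of $\mathbb C[R_{\mathbb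 Z}(\Gamma)/\Phi]$, $$\mathrm{ch}(X(\gamma,z))=\exp\Big(\sum_{n\ge1,\ \mathrm{odd}}\frac2n\,a_{-n}(\gamma)z^n\Big)\exp\Big(-\sum_{n\ge1,\ \mathrm{odd}}\frac2n\,a_n(\gamma)z^{-n}\Big)e_{\bar\gamma},$$ that is, the operators $X(\gamma,z)$ defined through the groups $\tilde\Gamma_n$ become the usual twisted vertex operators. -/

import Mathlib

noncomputable section

namespace SpinWr

universe u

/-! ### The spin group -/

/-- Generators of the spin group: the central element `z` and `t i` for `i + 1 < n`.
Letters are numbered from `0`, so `t i` is the generator lying over the transposition of the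
`i`-th and the `(i+1)`-st letter among `0, …, n - 1`. -/
inductive SpinGen (n : ℕ) : Type
  | z : SpinGen n
  | t (i : ℕ) (hi : i + 1 < n) : SpinGen n

/-- The defining relations of the spin group, for elements `ζ` and `τ i` of a group;
only the `τ i` with `i + 1 < n` matter. -/
structure SpinRel {G : Type*} [Group G] (n : ℕ) (ζ : G) (τ : ℕ → G) : Prop where
  z_sq : ζ ^ 2 = 1
  sq : ∀ i, i + 1 < n → τ i ^ 2 = ζ
  braid : ∀ i, i + 2 < n → (τ i * τ (i + 1)) ^ 3 = ζ
  far : ∀ i j, j + 1 < i → i + 1 < n → τ i * τ j = ζ * τ j * τ i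
  comm : ∀ i, i + 1 < n → ζ * τ i = τ i * ζ

/-- The relators `z²`, `tᵢ² z⁻¹`, `(tᵢ tᵢ₊₁)³ z⁻¹`, `tᵢ tⱼ (z tⱼ tᵢ)⁻¹` for `i > j + 1`, and
`z tᵢ (tᵢ z)⁻¹`. -/
inductive SpinRelator (n : ℕ) : FreeGroup (SpinGen n) → Prop
  | z_sq : SpinRelator n (FreeGroup.of .z ^ 2)
  | sq (i : ℕ) (hi : i + 1 < n) :
      SpinRelator n (FreeGroup.of (.t i hi) ^ 2 * (FreeGroup.of .z)⁻¹)
  | braid (i : ℕ) (hi : i + 1 < n) (hi' : (i + 1) + 1 < n) :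
      SpinRelator n
        ((FreeGroup.of (.t i hi) * FreeGroup.of (.t (i + 1) hi')) ^ 3 * (FreeGroup.of .z)⁻¹)
  | far (i j : ℕ) (hi : i + 1 < n) (hj : j + 1 < n) (hij : j + 1 < i) :
      SpinRelator n ((FreeGroup.of (.t i hi) * FreeGroup.of (.t j hj)) *
        (FreeGroup.of .z * FreeGroup.of (.t j hj) * FreeGroup.of (.t i hi))⁻¹)
  | comm (i : ℕ) (hi : i + 1 < n) :
      SpinRelator n ((FreeGroup.of .z * FreeGroup.of (.t i hi)) *
        (FreeGroup.of (.t i hi) * FreeGroup.of .z)⁻¹)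

/-- The spin group `S̃ₙ`, given by generators and relations. -/
abbrev SpinSymm (n : ℕ) : Type := PresentedGroup {r | SpinRelator n r}

namespace SpinSymm

/-- The central element `z` of `S̃ₙ`. -/
def z (n : ℕ) : SpinSymm n := PresentedGroup.of .z

/-- The generator `t i` of `S̃ₙ`; the value `1` for `i + 1 ≥ n` is never used. -/
def t (n i : ℕ) : SpinSymm n := if h : i + 1 < n then PresentedGroup.of (.t i h) else 1

lemma spinRel (n : ℕ) : SpinRel n (z n) (t n) := by
  have key : ∀ r, SpinRelator n r → PresentedGroup.mk {r | SpinRelator n r} r = 1 :=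
    fun r hr => PresentedGroup.one_of_mem hr
  refine ⟨?_, ?_, ?_, ?_, ?_⟩
  · have := key _ .z_sq
    rwa [map_pow] at this
  · intro i hi
    have := key _ (.sq i hi)
    rw [map_mul, map_inv, mul_inv_eq_one] at this
    simpa [t, hi, z, PresentedGroup.of] using this
  · intro i hi
    have h1 : i + 1 < n := by omega
    have h2 : i + 1 + 1 < n := by omega
    have := key _ (.braid i h1 h2)
    rw [map_mul, map_inv, mul_inv_eq_one] at this
    simpa [t, h1, h2, z, PresentedGroup.of] using this
  · intro i j hij hi
    have h1 : j + 1 < n := by omega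
    have := key _ (.far i j hi h1 hij)
    rw [map_mul, map_inv, mul_inv_eq_one] at this
    simpa [t, h1, hi, z, PresentedGroup.of] using this
  · intro i hi
    have := key _ (.comm i hi)
    rw [map_mul, map_inv, mul_inv_eq_one] at this
    simpa [t, hi, z, PresentedGroup.of] using this

/-- The homomorphism out of `S̃ₙ` given by elements satisfying the defining relations. -/
def lift {G : Type*} [Group G] {n : ℕ} {ζ : G} {τ : ℕ → G} (h : SpinRel n ζ τ) :
    SpinSymm n →* G :=
  PresentedGroup.toGroup (f := fun x => match x with | .z => ζ | .t i _ => τ i) (by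
    intro r hr
    induction hr with
    | z_sq => simpa using h.z_sq
    | sq i hi => simpa [mul_inv_eq_one] using h.sq i hi
    | braid i hi hi' => simpa [mul_inv_eq_one] using h.braid i hi'
    | far i j hi hj hij =>
      simp only [map_mul, map_inv, FreeGroup.lift_apply_of, mul_inv_eq_one]
      exact h.far i j hij hi
    | comm i hi =>
      simp only [map_mul, map_inv, FreeGroup.lift_apply_of, mul_inv_eq_one]
      exact h.comm i hi)

@[simp] lemma lift_z {G : Type*} [Group G] {n : ℕ} {ζ : G} {τ : ℕ → G} (h : SpinRel n ζ τ) :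
    lift h (z n) = ζ := by simp [lift, z]

lemma lift_t {G : Type*} [Group G] {n : ℕ} {ζ : G} {τ : ℕ → G} (h : SpinRel n ζ τ)
    {i : ℕ} (hi : i + 1 < n) : lift h (t n i) = τ i := by simp [lift, t, hi]

lemma mem_of_gen {n : ℕ} (H : Subgroup (SpinSymm n)) (hz : z n ∈ H)
    (ht : ∀ i, i + 1 < n → t n i ∈ H) (x : SpinSymm n) : x ∈ H := by
  refine PresentedGroup.generated_by _ H ?_ x
  rintro (_ | ⟨i, hi⟩)
  · exact hz
  · have := ht i hi
    simpa [t, hi] using this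

lemma hom_ext {G : Type*} [Group G] {n : ℕ} {f g : SpinSymm n →* G} (hz : f (z n) = g (z n))
    (ht : ∀ i, i + 1 < n → f (t n i) = g (t n i)) : f = g := by
  refine DFunLike.ext f g fun x => ?_
  exact mem_of_gen (f.eqLocus g) hz ht x

lemma z_comm {n : ℕ} (x : SpinSymm n) : z n * x = x * z n := by
  have := mem_of_gen (Subgroup.centralizer {z n}) (by simp [Subgroup.mem_centralizer_iff])
    (by simpa [Subgroup.mem_centralizer_iff] using (spinRel n).comm) x
  simpa [Subgroup.mem_centralizer_iff] using this

lemma z_mul_z (n : ℕ) : z n * z n = 1 := by simpa [sq] using (spinRel n).z_sq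

/-- The transposition of the letters `i` and `i + 1`. -/
def adjSwap (n i : ℕ) : Equiv.Perm (Fin n) :=
  if h : i + 1 < n then Equiv.swap ⟨i, by omega⟩ ⟨i + 1, h⟩ else 1

lemma adjSwap_rel (n : ℕ) : SpinRel n (1 : Equiv.Perm (Fin n)) (adjSwap n) := by
  refine ⟨by simp, ?_, ?_, ?_, by simp⟩
  · intro i hi
    simp [adjSwap, hi, sq]
  · intro i hi
    have h1 : i + 1 < n := by omega
    have h2 : i + 1 + 1 < n := by omega
    simp only [adjSwap, h1, h2, dif_pos]
    have h3 := Equiv.Perm.isThreeCycle_swap_mul_swap_same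
      (a := (⟨i + 1, h1⟩ : Fin n)) (b := ⟨i, by omega⟩) (c := ⟨i + 2, hi⟩)
      (by simp) (by simp) (by simp)
    rw [Equiv.swap_comm (⟨i, by omega⟩ : Fin n) ⟨i + 1, h1⟩, ← h3.orderOf]
    exact pow_orderOf_eq_one _
  · intro i j hij hi
    have h1 : j + 1 < n := by omega
    simp only [adjSwap, h1, hi, dif_pos, one_mul]
    refine (Equiv.Perm.disjoint_swap_swap ?_).commute.eq
    simp [Fin.ext_iff]
    omega

/-- The covering map `θₙ : S̃ₙ → Sₙ`. -/
def theta (n : ℕ) : SpinSymm n →* Equiv.Perm (Fin n) := lift (adjSwap_rel n)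

/-- The parity `d` of `S̃ₙ`, written multiplicatively: `1` is even and `-1` is odd. -/
def parity (n : ℕ) : SpinSymm n →* ℤˣ :=
  lift (ζ := 1) (τ := fun _ => -1) ⟨by simp, by simp, by simp, by simp, by simp⟩

@[simp] lemma theta_z (n : ℕ) : theta n (z n) = 1 := lift_z _
lemma theta_t {n i : ℕ} (h : i + 1 < n) : theta n (t n i) = adjSwap n i := lift_t _ h
@[simp] lemma parity_z (n : ℕ) : parity n (z n) = 1 := lift_z _
lemma parity_t {n i : ℕ} (h : i + 1 < n) : parity n (t n i) = -1 := lift_t _ h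

/-- The embedding of the `n` letters as the block `a, …, a + n - 1` of `N` letters. -/
def block (a n N : ℕ) (h : a + n ≤ N) : Fin n ↪ Fin N :=
  ⟨fun i => ⟨a + i, by omega⟩, fun i j hij => by simpa [Fin.ext_iff] using hij⟩

@[simp] lemma block_val (a n N : ℕ) (h : a + n ≤ N) (i : Fin n) :
    (block a n N h i : ℕ) = a + i := rfl

lemma mem_range_block {a n N : ℕ} (h : a + n ≤ N) (i : Fin N) :
    i ∈ Set.range (block a n N h) ↔ a ≤ i ∧ (i : ℕ) < a + n := by
  constructor
  · rintro ⟨j, rfl⟩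
    simp
  · rintro ⟨h1, h2⟩
    exact ⟨⟨i - a, by omega⟩, by ext; simp; omega⟩

/-- The embedding `S̃ₙ → S̃_N`, `tᵢ ↦ t_{a+i}`, `z ↦ z`. -/
def shift (a n N : ℕ) (h : a + n ≤ N) : SpinSymm n →* SpinSymm N :=
  lift (ζ := z N) (τ := fun i => t N (a + i))
    ⟨(spinRel N).z_sq, fun i hi => (spinRel N).sq _ (by omega),
      fun i hi => (spinRel N).braid (a + i) (by omega),
      fun i j hij hi => (spinRel N).far _ _ (by omega) (by omega),
      fun i hi => (spinRel N).comm _ (by omega)⟩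

@[simp] lemma shift_z (a n N : ℕ) (h : a + n ≤ N) : shift a n N h (z n) = z N := lift_z _
lemma shift_t {a n N : ℕ} (h : a + n ≤ N) {i : ℕ} (hi : i + 1 < n) :
    shift a n N h (t n i) = t N (a + i) := lift_t _ hi

lemma parity_shift {a n N : ℕ} (h : a + n ≤ N) (x : SpinSymm n) :
    parity N (shift a n N h x) = parity n x := by
  have : (parity N).comp (shift a n N h) = parity n := by
    refine hom_ext (by simp) fun i hi => ?_
    simp [shift_t h hi, parity_t hi, parity_t (show a + i + 1 < N by omega)]
  exact DFunLike.congr_fun this x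

lemma theta_shift {a n N : ℕ} (h : a + n ≤ N) (x : SpinSymm n) :
    theta N (shift a n N h x) = (theta n x).viaEmbedding (block a n N h) := by
  have : (theta N).comp (shift a n N h) =
      (Equiv.Perm.viaEmbeddingHom (block a n N h)).comp (theta n) := by
    refine hom_ext (by simp) fun i hi => ?_
    have h2 : a + i + 1 < N := by omega
    simp only [MonoidHom.comp_apply, shift_t h hi, theta_t hi, theta_t h2,
      Equiv.Perm.viaEmbeddingHom_apply]
    ext j
    by_cases hj : j ∈ Set.range (block a n N h)
    · obtain ⟨k, rfl⟩ := hj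
      rw [Equiv.Perm.viaEmbedding_apply]
      simp only [adjSwap, hi, h2, dif_pos, Equiv.swap_apply_def, Fin.ext_iff, block_val]
      split_ifs <;> simp_all <;> omega
    · rw [Equiv.Perm.viaEmbedding_apply_of_notMem _ _ _ hj]
      rw [mem_range_block h] at hj
      simp only [adjSwap, h2, dif_pos, Equiv.swap_apply_def, Fin.ext_iff]
      split_ifs <;> simp_all <;> omega
  exact DFunLike.congr_fun this x

/-! #### The kernel of the covering map -/

lemma t_inv {n i : ℕ} (h : i + 1 < n) : (t n i)⁻¹ = z n * t n i := by
  rw [inv_eq_iff_mul_eq_one, ← mul_assoc, ← z_comm, mul_assoc, ← sq, (spinRel n).sq i h, z_mul_z]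

lemma t_braid {n i : ℕ} (h : i + 2 < n) :
    t n i * t n (i + 1) * t n i = t n (i + 1) * t n i * t n (i + 1) := by
  have h1 : i + 1 < n := by omega
  have hb := (spinRel n).braid i h
  have e : t n i * t n (i + 1) * t n i * (t n (i + 1) * t n i * t n (i + 1)) = z n := by
    rw [← hb]; simp only [pow_succ, pow_zero, one_mul, mul_assoc]
  have e2 : t n (i + 1) * t n i * t n (i + 1) * (t n (i + 1) * t n i * t n (i + 1)) = z n := by
    have s1 := (spinRel n).sq i h1
    have s2 := (spinRel n).sq (i + 1) (by omega)
    calc _ = t n (i + 1) * t n i * (t n (i + 1) ^ 2) * t n i * t n (i + 1) := by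
            simp only [sq, mul_assoc]
      _ = z n * (t n (i + 1) * (t n i ^ 2) * t n (i + 1)) := by
            rw [s2, ← z_comm]; simp only [sq, mul_assoc]
      _ = z n * (z n * t n (i + 1) ^ 2) := by rw [s1, ← z_comm]; simp only [sq, mul_assoc]
      _ = z n := by rw [s2, z_mul_z, mul_one]
  exact mul_right_cancel (e.trans e2.symm)

/-- The descending product `t_{n-1} t_{n-2} ⋯ t_{n-m}` in `S̃_{n+1}`. -/
def desc (n : ℕ) : ℕ → SpinSymm (n + 1)
  | 0 => 1
  | m + 1 => desc n m * t (n + 1) (n - (m + 1))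

lemma desc_far (n m : ℕ) (hm : m ≤ n) (i : ℕ) (hi : i + 1 < n - m + 0) :
    ∃ p : ℕ, desc n m * t (n + 1) i = z (n + 1) ^ p * t (n + 1) i * desc n m := by
  induction m with
  | zero => exact ⟨0, by simp [desc]⟩
  | succ m ih =>
    obtain ⟨p, hp⟩ := ih (by omega) (by omega)
    refine ⟨p + 1, ?_⟩
    have hf := (spinRel (n + 1)).far (n - (m + 1)) i (by omega) (by omega)
    calc desc n m * t (n + 1) (n - (m + 1)) * t (n + 1) i
        = desc n m * (z (n + 1) * t (n + 1) i * t (n + 1) (n - (m + 1))) := by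
          rw [mul_assoc, hf]
      _ = z (n + 1) * (desc n m * t (n + 1) i) * t (n + 1) (n - (m + 1)) := by
          rw [mul_assoc, ← mul_assoc, ← z_comm]; simp only [mul_assoc]
      _ = _ := by rw [hp, pow_succ']; simp only [desc, mul_assoc]

lemma desc_braid (n m : ℕ) (hm : m ≤ n) (i : ℕ) (hi : n - m < i) (hin : i < n) :
    ∃ p : ℕ, desc n m * t (n + 1) i = z (n + 1) ^ p * t (n + 1) (i - 1) * desc n m := by
  induction m with
  | zero => omega
  | succ m ih =>
    by_cases hc : n - m < i
    · obtain ⟨p, hp⟩ := ih (by omega) hc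
      refine ⟨p + 1, ?_⟩
      have hf := (spinRel (n + 1)).far i (n - (m + 1)) (by omega) (by omega)
      have hf' : t (n + 1) (n - (m + 1)) * t (n + 1) i
          = z (n + 1) * t (n + 1) i * t (n + 1) (n - (m + 1)) := by
        rw [mul_assoc, hf, ← mul_assoc, ← mul_assoc, z_mul_z, one_mul]
      calc desc n m * t (n + 1) (n - (m + 1)) * t (n + 1) i
          = desc n m * (z (n + 1) * t (n + 1) i * t (n + 1) (n - (m + 1))) := by
            rw [mul_assoc, hf']
        _ = z (n + 1) * (desc n m * t (n + 1) i) * t (n + 1) (n - (m + 1)) := by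
            rw [mul_assoc, ← mul_assoc, ← z_comm]; simp only [mul_assoc]
        _ = _ := by rw [hp, pow_succ']; simp only [desc, mul_assoc]
    · obtain ⟨m, rfl⟩ : ∃ k, m = k + 1 := ⟨m - 1, by omega⟩
      have hi1 : n - (m + 1) = i := by omega
      have hi2 : n - (m + 1 + 1) = i - 1 := by omega
      obtain ⟨p, hp⟩ := desc_far n m (by omega) (i - 1) (by omega)
      refine ⟨p, ?_⟩
      have hb := t_braid (n := n + 1) (i := i - 1) (by omega)
      rw [show i - 1 + 1 = i by omega] at hb
      simp only [desc, hi1, hi2]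
      calc desc n m * t (n + 1) i * t (n + 1) (i - 1) * t (n + 1) i
          = desc n m * (t (n + 1) i * t (n + 1) (i - 1) * t (n + 1) i) := by
            simp only [mul_assoc]
        _ = (desc n m * t (n + 1) (i - 1)) * t (n + 1) i * t (n + 1) (i - 1) := by
            rw [← hb]; simp only [mul_assoc]
        _ = _ := by rw [hp]; simp only [mul_assoc]

lemma exists_desc (n : ℕ) (x : SpinSymm (n + 1)) :
    ∃ (w : SpinSymm n) (m : ℕ), m ≤ n ∧ x = shift 0 n (n + 1) (by omega) w * desc n m := by
  have hz : ∀ x : SpinSymm (n + 1),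
      (∃ (w : SpinSymm n) (m : ℕ), m ≤ n ∧ x = shift 0 n (n + 1) (by omega) w * desc n m) →
      (∃ (w : SpinSymm n) (m : ℕ), m ≤ n ∧
        x * z (n + 1) = shift 0 n (n + 1) (by omega) w * desc n m) := by
    rintro x ⟨w, m, hm, rfl⟩
    exact ⟨z n * w, m, hm, by rw [map_mul, shift_z, ← z_comm, mul_assoc]⟩
  have ht : ∀ i, i < n → ∀ x : SpinSymm (n + 1),
      (∃ (w : SpinSymm n) (m : ℕ), m ≤ n ∧ x = shift 0 n (n + 1) (by omega) w * desc n m) →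
      (∃ (w : SpinSymm n) (m : ℕ), m ≤ n ∧
        x * t (n + 1) i = shift 0 n (n + 1) (by omega) w * desc n m) := by
    rintro i hi x ⟨w, m, hm, rfl⟩
    rcases lt_trichotomy (i + 1) (n - m) with h | h | h
    · obtain ⟨p, hp⟩ := desc_far n m hm i h
      refine ⟨w * (z n ^ p * t n i), m, hm, ?_⟩
      rw [mul_assoc, hp, map_mul, map_mul, map_pow, shift_z, shift_t _ (by omega)]
      simp only [mul_assoc, Nat.zero_add]
    · refine ⟨w, m + 1, by omega, ?_⟩
      rw [desc, show n - (m + 1) = i by omega, mul_assoc]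
    · rcases (show n - m ≤ i by omega).lt_or_eq with h' | h'
      · obtain ⟨p, hp⟩ := desc_braid n m hm i h' hi
        refine ⟨w * (z n ^ p * t n (i - 1)), m, hm, ?_⟩
        rw [mul_assoc, hp, map_mul, map_mul, map_pow, shift_z, shift_t _ (by omega)]
        simp only [mul_assoc, Nat.zero_add]
      · obtain ⟨m, rfl⟩ : ∃ k, m = k + 1 := ⟨m - 1, by omega⟩
        refine ⟨w * z n, m, by omega, ?_⟩
        rw [desc, h', map_mul, shift_z, mul_assoc, mul_assoc, ← sq,
          (spinRel (n + 1)).sq i (by omega), ← z_comm, mul_assoc]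
  have hx : x ∈ Subgroup.closure (Set.range (PresentedGroup.of (rels := {r | SpinRelator (n+1) r})))
    := by rw [PresentedGroup.closure_range_of]; trivial
  induction hx using Subgroup.closure_induction_right with
  | one => exact ⟨1, 0, by omega, by simp [desc]⟩
  | mul_right x y hy g ih =>
    obtain ⟨(_ | ⟨i, hi⟩), rfl⟩ := g
    · exact hz _ ih
    · have := ht i (by omega) _ ih
      simpa [t, hi] using this
  | mul_inv_cancel x y hy g ih =>
    obtain ⟨(_ | ⟨i, hi⟩), rfl⟩ := g
    · have e : (PresentedGroup.of .z : SpinSymm (n + 1))⁻¹ = z (n + 1) := by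
        rw [inv_eq_iff_mul_eq_one]; exact z_mul_z _
      rw [e]; exact hz _ ih
    · have e : (PresentedGroup.of (.t i hi) : SpinSymm (n + 1))⁻¹ =
          z (n + 1) * t (n + 1) i := by
        rw [← t_inv hi]; simp [t, hi]
      rw [e, ← mul_assoc]; exact ht i (by omega) _ (hz _ ih)

lemma gen_zero (x : SpinSymm 0) : x = 1 ∨ x = z 0 := by
  have h : Subgroup.zpowers (z 0) = ⊤ := by
    rw [eq_top_iff]; intro y _
    exact mem_of_gen _ (Subgroup.mem_zpowers _) (fun i hi => by omega) y
  have hx : x ∈ Subgroup.zpowers (z 0) := h ▸ Subgroup.mem_top x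
  obtain ⟨k, rfl⟩ := hx
  have h2 : z 0 ^ (2 : ℤ) = 1 := (spinRel 0).z_sq
  rcases Int.even_or_odd' k with ⟨c, rfl | rfl⟩
  · left; simp only [zpow_mul, h2, one_zpow]
  · right; simp only [zpow_add, zpow_mul, h2, one_zpow, one_mul, zpow_one]

lemma theta_desc (n m : ℕ) (hm : m ≤ n) :
    theta (n + 1) (desc n m) ⟨n - m, by omega⟩ = ⟨n, by omega⟩ := by
  induction m with
  | zero => simp [desc]
  | succ m ih =>
    have h1 : n - (m + 1) + 1 < n + 1 := by omega
    have h2 : n - (m + 1) + 1 = n - m := by omega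
    rw [desc, map_mul, Equiv.Perm.mul_apply, theta_t h1]
    simp only [adjSwap, h1, dif_pos, Equiv.swap_apply_left]
    simpa [h2] using ih (by omega)

lemma eq_of_theta_eq_one {n : ℕ} {x : SpinSymm n} (hx : theta n x = 1) : x = 1 ∨ x = z n := by
  induction n with
  | zero => exact gen_zero x
  | succ n ih =>
    obtain ⟨w, m, hm, rfl⟩ := exists_desc n x
    have h0 : 0 + n ≤ n + 1 := by omega
    have hfix : theta (n + 1) (shift 0 n (n + 1) h0 w) ⟨n, by omega⟩ = ⟨n, by omega⟩ := by
      rw [theta_shift, Equiv.Perm.viaEmbedding_apply_of_notMem]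
      rw [mem_range_block]; simp
    have e := DFunLike.congr_fun hx ⟨n - m, by omega⟩
    rw [map_mul, Equiv.Perm.mul_apply, theta_desc n m hm, hfix] at e
    have hm0 : m = 0 := by
      simp [Fin.ext_iff] at e; omega
    subst hm0
    simp only [desc, mul_one] at hx ⊢
    rw [theta_shift] at hx
    have hw : theta n w = 1 := by
      apply Equiv.Perm.viaEmbeddingHom_injective (block 0 n (n + 1) h0)
      rw [map_one]; exact hx
    rcases ih hw with rfl | rfl
    · left; simp
    · right; simp

instance finite (n : ℕ) : Finite (SpinSymm n) := by
  induction n with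
  | zero =>
    have : (Set.univ : Set (SpinSymm 0)) ⊆ {1, z 0} := fun x _ => by simpa using gen_zero x
    exact Set.finite_univ_iff.mp ((Set.toFinite _).subset this)
  | succ n ih =>
    refine Finite.of_surjective (fun p : SpinSymm n × Fin (n + 1) =>
      shift 0 n (n + 1) (by omega) p.1 * desc n p.2) fun x => ?_
    obtain ⟨w, m, hm, rfl⟩ := exists_desc n x
    exact ⟨(w, ⟨m, by omega⟩), rfl⟩


/-! ### The basic spin supermodule -/

/-- The Pauli matrix `σ₁`. -/
def pauli1 : Matrix (Fin 2) (Fin 2) ℂ := !![0, 1; 1, 0]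
/-- The Pauli matrix `σ₂`. -/
def pauli2 : Matrix (Fin 2) (Fin 2) ℂ := !![0, -Complex.I; Complex.I, 0]
/-- The Pauli matrix `σ₃`. -/
def pauli3 : Matrix (Fin 2) (Fin 2) ℂ := !![1, 0; 0, -1]

/-- The index set of the standard basis of the `k`-fold tensor power of `ℂ^{1|1}`. -/
abbrev SpinIdx (k : ℕ) : Type := Fin k → Fin 2

/-- The matrix of `M₁ ⊗ ⋯ ⊗ M_k` on the `k`-fold tensor power of `ℂ^{1|1}`. -/
def tensorMat {k : ℕ} (M : Fin k → Matrix (Fin 2) (Fin 2) ℂ) :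
    Matrix (SpinIdx k) (SpinIdx k) ℂ :=
  fun a b => ∏ l, M l (a l) (b l)

lemma tensorMat_mul {k : ℕ} (M N : Fin k → Matrix (Fin 2) (Fin 2) ℂ) :
    tensorMat M * tensorMat N = tensorMat (fun l => M l * N l) := by
  ext a c
  simp only [tensorMat, Matrix.mul_apply, ← Finset.prod_mul_distrib]
  rw [Finset.prod_univ_sum, Fintype.piFinset_univ]

lemma tensorMat_one {k : ℕ} : tensorMat (k := k) (fun _ => 1) = 1 := by
  ext a b
  simp only [tensorMat, Matrix.one_apply]
  by_cases h : a = b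
  · simp [h]
  · obtain ⟨l, hl⟩ := Function.ne_iff.mp h
    rw [if_neg h]
    exact Finset.prod_eq_zero (Finset.mem_univ l) (by simp [hl])

lemma tensorMat_neg {k : ℕ} {M N : Fin k → Matrix (Fin 2) (Fin 2) ℂ} (l₀ : Fin k)
    (h₀ : M l₀ = -N l₀) (h : ∀ l, l ≠ l₀ → M l = N l) : tensorMat M = -tensorMat N := by
  ext a b
  simp only [tensorMat, Matrix.neg_apply]
  rw [← Finset.mul_prod_erase _ _ (Finset.mem_univ l₀),
    ← Finset.mul_prod_erase _ (fun l => N l (a l) (b l)) (Finset.mem_univ l₀), h₀,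
    Matrix.neg_apply, neg_mul]
  congr 2
  exact Finset.prod_congr rfl fun l hl => by rw [h l (Finset.ne_of_mem_erase hl)]

/-- The `l`-th tensor factor of the Clifford generator `e_{p+1}`, up to the scalar `√-1`. -/
def cliffFactor (p l : ℕ) : Matrix (Fin 2) (Fin 2) ℂ :=
  if l < p / 2 then pauli3
  else if l = p / 2 then (if p % 2 = 0 then pauli1 else pauli2) else 1

/-- The action of the Clifford generator `e_{p+1}`, `0 ≤ p < 2k`, on the `k`-fold tensor power
of `ℂ^{1|1}`: it is `√-1 σ₃^{⊗(j-1)} ⊗ σ₁ ⊗ σ₀^{⊗(k-j)}` for `p + 1 = 2j - 1` and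
`√-1 σ₃^{⊗(j-1)} ⊗ σ₂ ⊗ σ₀^{⊗(k-j)}` for `p + 1 = 2j`. -/
def cliff (k p : ℕ) : Matrix (SpinIdx k) (SpinIdx k) ℂ :=
  Complex.I • tensorMat (fun l => cliffFactor p l)

lemma pauli1_sq : pauli1 * pauli1 = 1 := by
  ext i j; fin_cases i <;> fin_cases j <;> simp [pauli1]
lemma pauli2_sq : pauli2 * pauli2 = 1 := by
  ext i j; fin_cases i <;> fin_cases j <;> simp [pauli2]
lemma pauli3_sq : pauli3 * pauli3 = 1 := by
  ext i j; fin_cases i <;> fin_cases j <;> simp [pauli3]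
lemma pauli12 : pauli2 * pauli1 = -(pauli1 * pauli2) := by
  ext i j; fin_cases i <;> fin_cases j <;> simp [pauli1, pauli2]
lemma pauli13 : pauli3 * pauli1 = -(pauli1 * pauli3) := by
  ext i j; fin_cases i <;> fin_cases j <;> simp [pauli1, pauli3]
lemma pauli23 : pauli3 * pauli2 = -(pauli2 * pauli3) := by
  ext i j; fin_cases i <;> fin_cases j <;> simp [pauli2, pauli3]

lemma cliffFactor_sq (p l : ℕ) : cliffFactor p l * cliffFactor p l = 1 := by
  unfold cliffFactor
  split_ifs <;> simp [pauli1_sq, pauli2_sq, pauli3_sq]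

lemma cliff_sq (k p : ℕ) : cliff k p * cliff k p = -1 := by
  simp [cliff, tensorMat_mul, cliffFactor_sq, tensorMat_one, smul_smul]

lemma cliff_anti_aux {k p q : ℕ} (hpq : p < q) (hq : q < 2 * k) :
    cliff k q * cliff k p = -(cliff k p * cliff k q) := by
  simp only [cliff, smul_mul_smul_comm, tensorMat_mul, ← smul_neg]
  congr 1
  refine tensorMat_neg ⟨p / 2, by omega⟩ ?_ ?_
  · simp only [cliffFactor]
    split_ifs <;> first | omega | simp [pauli12, pauli13, pauli23]
  · intro l hl
    have hl' : (l : ℕ) ≠ p / 2 := fun h => hl (Fin.ext h)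
    simp only [cliffFactor]
    split_ifs <;> first | omega | simp

lemma cliff_anti {k p q : ℕ} (hpq : p ≠ q) (hp : p < 2 * k) (hq : q < 2 * k) :
    cliff k q * cliff k p = -(cliff k p * cliff k q) := by
  rcases hpq.lt_or_gt with h | h
  · exact cliff_anti_aux h hq
  · rw [cliff_anti_aux h hp, neg_neg]

/-- The coefficient `√((j+1)/2j)`, for `j = i + 1`. -/
def coefA (i : ℕ) : ℂ := (Real.sqrt ((i + 2) / (2 * (i + 1))) : ℝ)
/-- The coefficient `√((j-1)/2j)`, for `j = i + 1`. -/
def coefB (i : ℕ) : ℂ := (Real.sqrt (i / (2 * (i + 1))) : ℝ)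

lemma coef_sq (i : ℕ) : coefA i * coefA i + coefB i * coefB i = 1 := by
  simp only [coefA, coefB]
  rw [← Complex.ofReal_mul, ← Complex.ofReal_mul, Real.mul_self_sqrt (by positivity),
    Real.mul_self_sqrt (by positivity), ← Complex.ofReal_add, ← Complex.ofReal_one]
  congr 1
  field_simp
  ring

lemma coef_mul (i : ℕ) : coefA i * coefB (i + 1) = 1 / 2 := by
  simp only [coefA, coefB]
  rw [← Complex.ofReal_mul, ← Real.sqrt_mul (by positivity)]
  have : ((i : ℝ) + 2) / (2 * (i + 1)) * (((i + 1 : ℕ) : ℝ) / (2 * (((i + 1 : ℕ) : ℝ) + 1)))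
      = (1 / 2) * (1 / 2) := by
    push_cast
    field_simp
    ring
  rw [this, Real.sqrt_mul_self (by norm_num)]
  norm_num

lemma coefB_zero : coefB 0 = 0 := by simp [coefB]

/-- The action `√((j+1)/2j) e_j - √((j-1)/2j) e_{j-1}`, with `j = i + 1`, of the generator `t i`
on the `k`-fold tensor power of `ℂ^{1|1}`. -/
def spinT (k i : ℕ) : Matrix (SpinIdx k) (SpinIdx k) ℂ :=
  coefA i • cliff k i - coefB i • cliff k (i - 1)

lemma spinT_sq {k i : ℕ} (hi : i < 2 * k) : spinT k i * spinT k i = -1 := by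
  have h := coef_sq i
  cases i with
  | zero =>
    simp only [coefB_zero, mul_zero, add_zero] at h
    simp [spinT, coefB_zero, cliff_sq, smul_smul, h]
  | succ i =>
    have ha := cliff_anti (k := k) (p := i) (q := i + 1) (by omega) (by omega) hi
    simp only [spinT, Nat.add_sub_cancel, sub_mul, mul_sub, smul_mul_smul_comm, ha, cliff_sq,
      smul_neg]
    rw [mul_comm (coefB (i + 1)) (coefA (i + 1))]
    have : (-1 : Matrix (SpinIdx k) (SpinIdx k) ℂ)
        = -((coefA (i + 1) * coefA (i + 1) + coefB (i + 1) * coefB (i + 1)) • 1) := by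
      rw [h, one_smul]
    rw [this, add_smul]
    abel

lemma spinT_adj {k i : ℕ} (hi : i + 1 < 2 * k) :
    spinT k i * spinT k (i + 1) + spinT k (i + 1) * spinT k i = 1 := by
  have h := coef_mul i
  have fin : (1 / 2 : ℂ) • (1 : Matrix (SpinIdx k) (SpinIdx k) ℂ) + (1 / 2 : ℂ) • 1 = 1 := by
    rw [← add_smul]; norm_num
  have h01 := cliff_anti (k := k) (p := i) (q := i + 1) (by omega) (by omega) hi
  cases i with
  | zero =>
    simp only [spinT, coefB_zero, zero_smul, sub_zero, Nat.add_sub_cancel, sub_mul, mul_sub,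
      smul_mul_smul_comm, cliff_sq, h01, smul_neg]
    rw [mul_comm (coefB (0 + 1)), h, mul_comm (coefA (0 + 1))]
    refine Eq.trans ?_ fin
    abel
  | succ i =>
    have h12 := cliff_anti (k := k) (p := i) (q := i + 1 + 1) (by omega) (by omega) hi
    have h02 := cliff_anti (k := k) (p := i) (q := i + 1) (by omega) (by omega) (by omega)
    simp only [spinT, Nat.add_sub_cancel, sub_mul, mul_sub,
      smul_mul_smul_comm, cliff_sq, h01, h02, h12, smul_neg]
    rw [mul_comm (coefB (i + 1 + 1)) (coefA (i + 1)), h, mul_comm (coefA (i + 1 + 1)),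
      mul_comm (coefA (i + 1 + 1)), mul_comm (coefB (i + 1 + 1))]
    refine Eq.trans ?_ fin
    abel

lemma spinT_far {k i j : ℕ} (hij : j + 1 < i) (hi : i < 2 * k) :
    spinT k i * spinT k j = -(spinT k j * spinT k i) := by
  have h1 := cliff_anti (k := k) (p := j) (q := i) (by omega) (by omega) (by omega)
  have h2 := cliff_anti (k := k) (p := j - 1) (q := i) (by omega) (by omega) (by omega)
  have h3 := cliff_anti (k := k) (p := j) (q := i - 1) (by omega) (by omega) (by omega)
  have h4 := cliff_anti (k := k) (p := j - 1) (q := i - 1) (by omega) (by omega) (by omega)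
  simp only [spinT, sub_mul, mul_sub, smul_mul_smul_comm, h1, h2, h3, h4, smul_neg]
  rw [mul_comm (coefA j), mul_comm (coefA j), mul_comm (coefB j), mul_comm (coefB j)]
  abel

/-- The action of `t i` on the basic spin module as an invertible matrix. -/
def spinTUnit (k i : ℕ) : (Matrix (SpinIdx k) (SpinIdx k) ℂ)ˣ :=
  if h : i < 2 * k then
    ⟨spinT k i, -spinT k i, by rw [mul_neg, spinT_sq h, neg_neg],
      by rw [neg_mul, spinT_sq h, neg_neg]⟩
  else 1

lemma spinTUnit_rel (n : ℕ) : SpinRel n (-1) (spinTUnit (n / 2)) := by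
  have val : ∀ i, i + 1 < n → (spinTUnit (n / 2) i : Matrix (SpinIdx (n / 2)) _ ℂ)
      = spinT (n / 2) i := fun i hi => by
    rw [spinTUnit, dif_pos (by omega)]
  refine ⟨by simp, ?_, ?_, ?_, ?_⟩
  · intro i hi
    ext1
    rw [Units.val_pow_eq_pow_val, val i hi, sq, spinT_sq (by omega)]
    simp
  · intro i hi
    ext1
    rw [Units.val_pow_eq_pow_val, Units.val_mul, val i (by omega), val (i + 1) hi]
    have ha := spinT_sq (k := n / 2) (i := i) (by omega)
    have hb := spinT_sq (k := n / 2) (i := i + 1) (by omega)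
    have hab := spinT_adj (k := n / 2) (i := i) (by omega)
    generalize spinT (n / 2) i = a at *
    generalize spinT (n / 2) (i + 1) = b at *
    have hba : b * a = 1 - a * b := by rw [← hab]; abel
    have h2 : a * b * (a * b) = a * b - 1 := by
      calc a * b * (a * b) = a * (b * a) * b := by simp only [mul_assoc]
        _ = a * b - a * a * (b * b) := by rw [hba]; noncomm_ring
        _ = a * b - 1 := by rw [ha, hb]; simp
    rw [pow_succ, sq, h2, sub_mul, h2]
    simp
  · intro i j hij hi
    ext1
    simp only [Units.val_mul, val i hi, val j (by omega), Units.val_neg, Units.val_one]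
    rw [spinT_far hij (by omega)]
    simp
  · intro i hi
    simp

/-- The basic spin supermodule of `S̃ₙ`: the action on the `⌊n/2⌋`-fold tensor power of
`ℂ^{1|1}`, in matrix form. -/
def basicSpin (n : ℕ) : SpinSymm n →* (Matrix (SpinIdx (n / 2)) (SpinIdx (n / 2)) ℂ)ˣ :=
  lift (spinTUnit_rel n)

lemma basicSpin_t {n i : ℕ} (hi : i + 1 < n) :
    (basicSpin n (t n i) : Matrix (SpinIdx (n / 2)) _ ℂ) = spinT (n / 2) i := by
  rw [basicSpin, lift_t _ hi, spinTUnit, dif_pos (by omega)]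

/-- The character `χₙ` of the basic spin supermodule. -/
def basicChar (n : ℕ) (x : SpinSymm n) : ℂ :=
  (basicSpin n x : Matrix (SpinIdx (n / 2)) (SpinIdx (n / 2)) ℂ).trace

lemma basicChar_conj {n : ℕ} (x y : SpinSymm n) : basicChar n (y * x * y⁻¹) = basicChar n x := by
  rw [basicChar, map_mul, map_mul, map_inv, Units.val_mul, Units.val_mul, Matrix.trace_mul_comm,
    ← mul_assoc, Units.inv_mul, one_mul, basicChar]

lemma basicChar_z {n : ℕ} (x : SpinSymm n) : basicChar n (z n * x) = -basicChar n x := by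
  rw [basicChar, map_mul]
  simp [basicSpin, basicChar]

lemma z_ne_one (n : ℕ) : z n ≠ 1 := by
  intro h
  have := congrArg (basicSpin n) h
  rw [basicSpin, lift_z, map_one, Units.ext_iff] at this
  have h2 := congrFun (congrFun this 0) 0
  norm_num at h2

/-- The parity operator of `ℂ^{1|1} ⊗ ⋯ ⊗ ℂ^{1|1}`. -/
def parityMat (k : ℕ) : Matrix (SpinIdx k) (SpinIdx k) ℂ := tensorMat fun _ => pauli3

lemma parityMat_sq (k : ℕ) : parityMat k * parityMat k = 1 := by
  simp [parityMat, tensorMat_mul, pauli3_sq, tensorMat_one]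

lemma parityMat_cliff {k p : ℕ} (hp : p < 2 * k) :
    parityMat k * cliff k p = -(cliff k p * parityMat k) := by
  simp only [parityMat, cliff, mul_smul_comm, smul_mul_assoc, tensorMat_mul, ← smul_neg]
  congr 1
  refine tensorMat_neg ⟨p / 2, by omega⟩ ?_ ?_
  · simp only [cliffFactor]
    split_ifs <;> first | omega | simp [pauli13, pauli23]
  · intro l hl
    have hl' : (l : ℕ) ≠ p / 2 := fun h => hl (Fin.ext h)
    simp only [cliffFactor]
    split_ifs <;> first | omega | simp

lemma parityMat_basicSpin {n : ℕ} (x : SpinSymm n) :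
    parityMat (n / 2) * (basicSpin n x : Matrix (SpinIdx (n / 2)) _ ℂ) =
      ((parity n x : ℤ) : ℂ) • ((basicSpin n x : Matrix (SpinIdx (n / 2)) _ ℂ)
        * parityMat (n / 2)) := by
  let H : Subgroup (SpinSymm n) :=
    { carrier := {x | parityMat (n / 2) * (basicSpin n x : Matrix (SpinIdx (n / 2)) _ ℂ) =
        ((parity n x : ℤ) : ℂ) • ((basicSpin n x : Matrix (SpinIdx (n / 2)) _ ℂ)
          * parityMat (n / 2))}
      one_mem' := by simp
      mul_mem' := by
        intro a b ha hb
        simp only [Set.mem_ofPred_eq] at ha hb ⊢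
        rw [map_mul, Units.val_mul, ← mul_assoc, ha, smul_mul_assoc, mul_assoc, hb,
          mul_smul_comm, smul_smul, map_mul, mul_assoc]
        push_cast
        rfl
      inv_mem' := by
        intro a ha
        simp only [Set.mem_ofPred_eq] at ha ⊢
        have hs : ((parity n a : ℤ) : ℂ) * ((parity n a : ℤ) : ℂ) = 1 := by
          rcases Int.units_eq_one_or (parity n a) with h | h <;> simp [h]
        rw [map_inv, map_inv, Int.units_inv_eq_self]
        set u := basicSpin n a
        have h2 := congrArg (fun M => u⁻¹.val * M * u⁻¹.val) ha
        simp only [mul_smul_comm, smul_mul_assoc] at h2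
        rw [← mul_assoc, mul_assoc, Units.mul_inv, mul_one, ← mul_assoc, Units.inv_mul,
          one_mul] at h2
        rw [h2, smul_smul, hs, one_smul] }
  refine mem_of_gen H ?_ ?_ x
  · change parityMat (n / 2) * _ = _
    simp [basicSpin]
  · intro i hi
    change parityMat (n / 2) * _ = _
    rw [basicSpin_t hi, parity_t hi, spinT, mul_sub, sub_mul, mul_smul_comm, mul_smul_comm,
      parityMat_cliff (by omega), parityMat_cliff (by omega)]
    simp
    abel

lemma basicChar_odd {n : ℕ} {x : SpinSymm n} (hx : parity n x = -1) : basicChar n x = 0 := by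
  have h := parityMat_basicSpin x
  rw [hx] at h
  have e : (basicSpin n x : Matrix (SpinIdx (n / 2)) _ ℂ) =
      -(parityMat (n / 2) * (basicSpin n x : Matrix (SpinIdx (n / 2)) _ ℂ)
        * parityMat (n / 2)) := by
    rw [h]; simp [mul_assoc, parityMat_sq]
  have e2 : basicChar n x = -basicChar n x := by
    conv_lhs => rw [basicChar, e, Matrix.trace_neg, Matrix.trace_mul_comm, ← mul_assoc,
      parityMat_sq, one_mul]
    rfl
  linear_combination e2 / 2


/-! ### Two commuting blocks -/

/-- The sign `z^{d(x) d(y)}` for parities `a = d(x)`, `b = d(y)`. -/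
def zsign (n : ℕ) (a b : ℤˣ) : SpinSymm n := if a = 1 ∨ b = 1 then 1 else z n

lemma zsign_mul_left (n : ℕ) (a a' b : ℤˣ) :
    zsign n (a * a') b = zsign n a b * zsign n a' b := by
  rcases Int.units_eq_one_or a with rfl | rfl <;> rcases Int.units_eq_one_or a' with rfl | rfl <;>
    rcases Int.units_eq_one_or b with rfl | rfl <;> simp [zsign, z_mul_z]

lemma zsign_mul_right (n : ℕ) (a b b' : ℤˣ) :
    zsign n a (b * b') = zsign n a b * zsign n a b' := by
  rcases Int.units_eq_one_or a with rfl | rfl <;> rcases Int.units_eq_one_or b' with rfl | rfl <;>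
    rcases Int.units_eq_one_or b with rfl | rfl <;> simp [zsign, z_mul_z]

lemma zsign_comm (n : ℕ) (a b : ℤˣ) (x : SpinSymm n) : zsign n a b * x = x * zsign n a b := by
  unfold zsign; split_ifs <;> simp [z_comm]

lemma zsign_sq (n : ℕ) (a b : ℤˣ) : zsign n a b * zsign n a b = 1 := by
  unfold zsign; split_ifs <;> simp [z_mul_z]

lemma shift_comm_shift {n m N : ℕ} (h : n + m ≤ N) (x : SpinSymm n) (y : SpinSymm m) :
    shift 0 n N (by omega) x * shift n m N h y =
      zsign N (parity n x) (parity m y) * shift n m N h y * shift 0 n N (by omega) x := by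
  have h0 : 0 + n ≤ N := by omega
  -- the set of elements commuting up to the right sign is a subgroup
  let K : SpinSymm N → (SpinSymm n →* SpinSymm N) := fun w =>
    (MulAut.conj w).toMonoidHom.comp (shift 0 n N h0)
  let L : ℤˣ → (SpinSymm n →* SpinSymm N) := fun b =>
    { toFun := fun x => zsign N (parity n x) b * shift 0 n N h0 x
      map_one' := by simp [zsign]
      map_mul' := fun x x' => by
        rw [map_mul, map_mul, zsign_mul_left]
        simp only [mul_assoc]
        rw [← mul_assoc (shift 0 n N h0 x) (zsign N (parity n x') b), ← zsign_comm]
        simp only [mul_assoc] }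
  let H : Subgroup (SpinSymm m) :=
    { carrier := {y | K (shift n m N h y) = L (parity m y)}
      one_mem' := by ext; simp [K, L, zsign]
      mul_mem' := by
        intro a b ha hb
        simp only [Set.mem_ofPred_eq] at ha hb ⊢
        refine DFunLike.ext _ _ fun x => ?_
        have hax := DFunLike.congr_fun ha x
        have hbx := DFunLike.congr_fun hb x
        simp only [K, L, MonoidHom.comp_apply, MulEquiv.coe_toMonoidHom, MulAut.conj_apply,
          MonoidHom.coe_mk, OneHom.coe_mk] at hax hbx ⊢
        rw [map_mul, map_mul]
        set A := shift n m N h a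
        set B := shift n m N h b
        set X := shift 0 n N h0 x
        calc A * B * X * (A * B)⁻¹ = A * (B * X * B⁻¹) * A⁻¹ := by group
          _ = zsign N (parity n x) (parity m b) * (A * X * A⁻¹) := by
            rw [hbx, ← mul_assoc, ← zsign_comm]; group
          _ = _ := by
            rw [hax, zsign_mul_right, ← mul_assoc, zsign_comm]
      inv_mem' := by
        intro a ha
        simp only [Set.mem_ofPred_eq] at ha ⊢
        refine DFunLike.ext _ _ fun x => ?_
        have hax := DFunLike.congr_fun ha x
        simp only [K, L, MonoidHom.comp_apply, MulEquiv.coe_toMonoidHom, MulAut.conj_apply,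
          MonoidHom.coe_mk, OneHom.coe_mk] at hax ⊢
        rw [map_inv, map_inv (parity m), Int.units_inv_eq_self]
        set A := shift n m N h a
        set X := shift 0 n N h0 x
        have hX : X = zsign N (parity n x) (parity m a) * (A * X * A⁻¹) := by
          rw [hax, ← mul_assoc, zsign_sq, one_mul]
        calc A⁻¹ * X * A⁻¹⁻¹
            = A⁻¹ * (zsign N (parity n x) (parity m a) * (A * X * A⁻¹)) * A := by
              rw [← hX, inv_inv]
          _ = _ := by rw [← mul_assoc, ← zsign_comm]; group }
  have hy : y ∈ H := by
    refine mem_of_gen H ?_ ?_ y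
    · change K (shift n m N h (z m)) = L (parity m (z m))
      refine DFunLike.ext _ _ fun x => ?_
      simp only [K, L, MonoidHom.comp_apply, MulEquiv.coe_toMonoidHom, MulAut.conj_apply,
        MonoidHom.coe_mk, OneHom.coe_mk, shift_z, parity_z, zsign, or_true, if_true, one_mul]
      rw [z_comm]; group
    · intro j hj
      change K (shift n m N h (t m j)) = L (parity m (t m j))
      refine hom_ext ?_ fun i hi => ?_
      · simp only [K, L, MonoidHom.comp_apply, MulEquiv.coe_toMonoidHom, MulAut.conj_apply,
          MonoidHom.coe_mk, OneHom.coe_mk, shift_z, parity_z, zsign, true_or, if_true, one_mul]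
        rw [← z_comm]; group
      · simp only [K, L, MonoidHom.comp_apply, MulEquiv.coe_toMonoidHom, MulAut.conj_apply,
          MonoidHom.coe_mk, OneHom.coe_mk, shift_t _ hi, shift_t _ hj, parity_t hi, parity_t hj]
        rw [(spinRel N).far (n + j) (0 + i) (by omega) (by omega)]
        simp [zsign, show (-1 : ℤˣ) ≠ 1 by decide]
  have e := DFunLike.congr_fun (show K (shift n m N h y) = L (parity m y) from hy) x
  simp only [K, L, MonoidHom.comp_apply, MulEquiv.coe_toMonoidHom, MulAut.conj_apply,
    MonoidHom.coe_mk, OneHom.coe_mk] at e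
  have e2 : shift n m N h y * shift 0 n N h0 x =
      zsign N (parity n x) (parity m y) * shift 0 n N h0 x * shift n m N h y := by
    rw [← e]; group
  rw [mul_assoc (zsign _ _ _), e2, ← mul_assoc, ← mul_assoc, zsign_sq, one_mul]

end SpinSymm

/-! ### The spin wreath product -/

/-- The action of `S̃ₙ` on `Γⁿ` through `θₙ` by `(σ • g)(i) = g (σ⁻¹ i)`. -/
def wreathAct (Γ : Type u) [Group Γ] (n : ℕ) : SpinSymm n →* MulAut (Fin n → Γ) :=
  (mulAutArrow (G := Equiv.Perm (Fin n)) (A := Fin n) (M := Γ)).comp (SpinSymm.theta n)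

lemma wreathAct_apply {Γ : Type u} [Group Γ] {n : ℕ} (x : SpinSymm n) (g : Fin n → Γ)
    (i : Fin n) : wreathAct Γ n x g i = g ((SpinSymm.theta n x)⁻¹ i) := rfl

/-- The spin wreath product `Γ̃ₙ = Γⁿ ⋊ S̃ₙ`. -/
abbrev SpinWreath (Γ : Type u) [Group Γ] (n : ℕ) : Type u :=
  (Fin n → Γ) ⋊[wreathAct Γ n] SpinSymm n

/-- A finite group with a central element `z` and a parity homomorphism `d` with `d(z) = 0`. The
parity is written multiplicatively: `d x = 1` for even and `d x = -1` for odd `x`. -/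
class SuperGroup (G : Type*) [Group G] where
  finite : Finite G
  z : G
  z_sq : z * z = 1
  z_comm : ∀ x : G, z * x = x * z
  d : G →* ℤˣ
  d_z : d z = 1



attribute [instance] SuperGroup.finite

instance SuperGroup.toFintype (G : Type*) [Group G] [SuperGroup G] : Fintype G :=
  Fintype.ofFinite G

/-- The space `R⁻(G)` of spin super class functions: class functions `f` with `f (z x) = - f x`
which vanish on the odd elements. -/
def RMinus (G : Type*) [Group G] [SuperGroup G] : Submodule ℂ (G → ℂ) where
  carrier := {f | (∀ x y, f (y * x * y⁻¹) = f x) ∧ (∀ x, f (SuperGroup.z * x) = -f x) ∧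
    ∀ x, SuperGroup.d x = -1 → f x = 0}
  add_mem' := by
    rintro f g ⟨h1, h2, h3⟩ ⟨k1, k2, k3⟩
    refine ⟨fun x y => ?_, fun x => ?_, fun x hx => ?_⟩
    · simp [h1, k1]
    · simp only [Pi.add_apply, h2, k2]; ring
    · simp [h3 x hx, k3 x hx]
  zero_mem' := ⟨by simp, by simp, by simp⟩
  smul_mem' := by
    rintro a f ⟨h1, h2, h3⟩
    refine ⟨fun x y => ?_, fun x => ?_, fun x hx => ?_⟩
    · simp [h1]
    · simp [h2]
    · simp [h3 x hx]

section IndRes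
variable {G : Type*} [Group G] [SuperGroup G]

lemma RMinus.conj (f : RMinus G) (x y : G) : f.1 (y * x * y⁻¹) = f.1 x := f.2.1 x y
lemma RMinus.spin (f : RMinus G) (x : G) : f.1 (SuperGroup.z * x) = -f.1 x := f.2.2.1 x
lemma RMinus.odd (f : RMinus G) {x : G} (hx : SuperGroup.d x = -1) : f.1 x = 0 := f.2.2.2 x hx

lemma d_conj (x y : G) : SuperGroup.d (y * x * y⁻¹) = SuperGroup.d x := by
  rw [map_mul, map_mul, map_inv, mul_comm, ← mul_assoc, inv_mul_cancel, one_mul]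

/-- A subgroup containing `z`, with the restricted parity. -/
instance subgroupSuperGroup (H : Subgroup G) [h : Fact (SuperGroup.z ∈ H)] : SuperGroup H where
  finite := inferInstance
  z := ⟨SuperGroup.z, h.out⟩
  z_sq := Subtype.ext SuperGroup.z_sq
  z_comm := fun x => Subtype.ext (SuperGroup.z_comm x.1)
  d := SuperGroup.d.comp H.subtype
  d_z := SuperGroup.d_z

/-- Restriction of spin super class functions to a subgroup. -/
def res (H : Subgroup G) [Fact (SuperGroup.z ∈ H)] : RMinus G →ₗ[ℂ] RMinus H where
  toFun f := ⟨fun x => f.1 x, fun _ _ => RMinus.conj f _ _, fun _ => RMinus.spin f _,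
    fun _ hx => RMinus.odd f hx⟩
  map_add' _ _ := rfl
  map_smul' _ _ := rfl

open Classical in
/-- Extension by `0` of a function on a subgroup. -/
def zeroExt (H : Subgroup G) (F : H → ℂ) (w : G) : ℂ := if h : w ∈ H then F ⟨w, h⟩ else 0

/-- The usual formula for induction from a subgroup: `(Ind F)(w) = |H|⁻¹ ∑_s F(s⁻¹ w s)`, where `s`
runs over `G` and `F` is extended by `0`. -/
def indFun (H : Subgroup G) (F : H → ℂ) (w : G) : ℂ :=
  (Nat.card H : ℂ)⁻¹ * ∑ s : G, zeroExt H F (s⁻¹ * w * s)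

/-- Induction of spin super class functions from a subgroup. -/
def ind (H : Subgroup G) [Fact (SuperGroup.z ∈ H)] : RMinus H →ₗ[ℂ] RMinus G where
  toFun F := ⟨indFun H F.1, by
    refine ⟨fun w y => ?_, fun w => ?_, fun w hw => ?_⟩
    · simp only [indFun]
      congr 1
      refine Fintype.sum_equiv (Equiv.mulLeft y⁻¹) _ _ fun s => congrArg _ ?_
      simp only [Equiv.coe_mulLeft]; group
    · simp only [indFun]
      rw [← mul_neg, ← Finset.sum_neg_distrib]
      congr 1
      refine Finset.sum_congr rfl fun s _ => ?_
      have e : s⁻¹ * (SuperGroup.z * w) * s = SuperGroup.z * (s⁻¹ * w * s) := by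
        rw [← mul_assoc, ← SuperGroup.z_comm]; simp only [mul_assoc]
      have hm : SuperGroup.z * (s⁻¹ * w * s) ∈ H ↔ s⁻¹ * w * s ∈ H :=
        H.mul_mem_cancel_left Fact.out
      rw [e]
      by_cases h : s⁻¹ * w * s ∈ H
      · rw [zeroExt, zeroExt, dif_pos h, dif_pos (hm.mpr h)]
        exact RMinus.spin F ⟨_, h⟩
      · rw [zeroExt, zeroExt, dif_neg h, dif_neg (fun h' => h (hm.mp h')), neg_zero]
    · simp only [indFun]
      rw [Finset.sum_eq_zero, mul_zero]
      intro s _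
      unfold zeroExt
      split_ifs with h
      · refine RMinus.odd F ?_
        change SuperGroup.d (s⁻¹ * w * s) = -1
        rw [map_mul, map_mul, map_inv, hw, mul_comm, ← mul_assoc, mul_inv_cancel, one_mul]
      · rfl⟩
  map_add' F F' := by
    ext w
    simp only [indFun, zeroExt, Submodule.coe_add, Pi.add_apply, ← mul_add, ← Finset.sum_add_distrib]
    congr 1
    refine Finset.sum_congr rfl fun s _ => ?_
    split_ifs <;> simp
  map_smul' a F := by
    ext w
    simp only [indFun, zeroExt, SetLike.val_smul, Pi.smul_apply, smul_eq_mul, RingHom.id_apply]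
    rw [mul_left_comm, Finset.mul_sum (a := a)]
    congr 1
    refine Finset.sum_congr rfl fun s _ => ?_
    split_ifs <;> simp

end IndRes

section Wreath
variable {Γ : Type u} [Group Γ]

instance wreathSuperGroup [Finite Γ] (n : ℕ) : SuperGroup (SpinWreath Γ n) where
  finite := Finite.of_equiv _ SemidirectProduct.equivProd.symm
  z := SemidirectProduct.inr (SpinSymm.z n)
  z_sq := by rw [← map_mul, SpinSymm.z_mul_z, map_one]
  z_comm := fun x => by
    ext1
    · ext i
      simp [wreathAct_apply]
    · exact SpinSymm.z_comm x.right
  d := (SpinSymm.parity n).comp SemidirectProduct.rightHom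
  d_z := by simp

/-- The underlying permutation `θₙ(x)` of an element of `Γ̃ₙ`. -/
def perm {n : ℕ} (x : SpinWreath Γ n) : Equiv.Perm (Fin n) := SpinSymm.theta n x.right

lemma perm_mul {n : ℕ} (x y : SpinWreath Γ n) : perm (x * y) = perm x * perm y := by
  simp [perm]

lemma perm_inv {n : ℕ} (x : SpinWreath Γ n) : perm x⁻¹ = (perm x)⁻¹ := by simp [perm]

lemma left_mul {n : ℕ} (x y : SpinWreath Γ n) (i : Fin n) :
    (x * y).left i = x.left i * y.left ((perm x)⁻¹ i) := rfl

lemma block_act {a n N : ℕ} (h : a + n ≤ N) (x : SpinSymm n) (g : Fin n → Γ) :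
    Function.ExtendByOne.hom Γ (SpinSymm.block a n N h) (wreathAct Γ n x g) =
      wreathAct Γ N (SpinSymm.shift a n N h x)
        (Function.ExtendByOne.hom Γ (SpinSymm.block a n N h) g) := by
  ext i
  have hinj := (SpinSymm.block a n N h).injective
  rw [wreathAct_apply, ← map_inv, ← map_inv, SpinSymm.theta_shift]
  simp only [Function.ExtendByOne.hom_apply]
  by_cases hi : i ∈ Set.range (SpinSymm.block a n N h)
  · obtain ⟨k, rfl⟩ := hi
    rw [Equiv.Perm.viaEmbedding_apply, hinj.extend_apply, hinj.extend_apply, wreathAct_apply,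
      map_inv]
  · rw [Equiv.Perm.viaEmbedding_apply_of_notMem _ _ _ hi, Function.extend_apply' _ _ _ hi,
      Function.extend_apply' _ _ _ hi]

/-- The embedding `Γ̃ₙ → Γ̃_N` onto the block of letters `a, …, a + n - 1`: the generators
`tᵢ` go to `t_{a+i}`, and elements of `Γⁿ` are extended by `1`. -/
def emb (Γ : Type u) [Group Γ] (a n N : ℕ) (h : a + n ≤ N) : SpinWreath Γ n →* SpinWreath Γ N :=
  SemidirectProduct.map (Function.ExtendByOne.hom Γ (SpinSymm.block a n N h))
    (SpinSymm.shift a n N h) (fun x => MonoidHom.ext fun g => block_act h x g)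

lemma emb_z [Finite Γ] {a n N : ℕ} (h : a + n ≤ N) :
    emb Γ a n N h SuperGroup.z = SuperGroup.z := by
  change emb Γ a n N h (SemidirectProduct.inr _) = SemidirectProduct.inr _
  rw [emb, SemidirectProduct.map_inr, SpinSymm.shift_z]

lemma d_emb [Finite Γ] {a n N : ℕ} (h : a + n ≤ N) (x : SpinWreath Γ n) :
    SuperGroup.d (emb Γ a n N h x) = SuperGroup.d x :=
  SpinSymm.parity_shift h x.right

/-- The element `z^{d(x) d(y)}` of `Γ̃_N`, for parities `a = d(x)` and `b = d(y)`. -/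
def wsign (Γ : Type u) [Group Γ] [Finite Γ] (N : ℕ) (a b : ℤˣ) : SpinWreath Γ N :=
  if a = 1 ∨ b = 1 then 1 else SuperGroup.z

lemma wsign_comm [Finite Γ] (N : ℕ) (a b : ℤˣ) (x : SpinWreath Γ N) :
    wsign Γ N a b * x = x * wsign Γ N a b := by
  unfold wsign; split_ifs <;> simp [SuperGroup.z_comm]

lemma wsign_right [Finite Γ] (N : ℕ) (a b : ℤˣ) :
    (wsign Γ N a b).right = SpinSymm.zsign N a b := by
  unfold wsign SpinSymm.zsign; split_ifs <;> rfl

lemma wsign_left [Finite Γ] (N : ℕ) (a b : ℤˣ) : (wsign Γ N a b).left = 1 := by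
  unfold wsign; split_ifs <;> rfl

lemma emb_left_mul {n m N : ℕ} (h : n + m = N) (x : SpinWreath Γ n) (y : SpinWreath Γ m) :
    (emb Γ 0 n N (by omega) x * emb Γ n m N h.le y).left =
      (emb Γ 0 n N (by omega) x).left * (emb Γ n m N h.le y).left := by
  have h0 : 0 + n ≤ N := by omega
  ext i
  rw [left_mul, Pi.mul_apply]
  congr 1
  change Function.extend _ _ _ _ = Function.extend _ _ _ _
  have hp : perm (emb Γ 0 n N h0 x) = (SpinSymm.theta n x.right).viaEmbedding
    (SpinSymm.block 0 n N h0) := SpinSymm.theta_shift h0 x.right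
  have hinv : (perm (emb Γ 0 n N h0 x))⁻¹ = (SpinSymm.theta n x.right)⁻¹.viaEmbedding
    (SpinSymm.block 0 n N h0) := by
    rw [hp]; exact (map_inv (Equiv.Perm.viaEmbeddingHom (SpinSymm.block 0 n N h0)) _).symm
  rw [hinv]
  by_cases hi : i ∈ Set.range (SpinSymm.block 0 n N h0)
  · obtain ⟨k, rfl⟩ := hi
    rw [Equiv.Perm.viaEmbedding_apply, Function.extend_apply', Function.extend_apply']
    · rfl
    · change ¬ (_ ∈ Set.range (SpinSymm.block n m N h.le))
      rw [SpinSymm.mem_range_block]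
      simp
    · change ¬ (_ ∈ Set.range (SpinSymm.block n m N h.le))
      rw [SpinSymm.mem_range_block]
      simp
  · rw [Equiv.Perm.viaEmbedding_apply_of_notMem _ _ _ hi]

lemma emb_left_mul' {n m N : ℕ} (h : n + m = N) (x : SpinWreath Γ n) (y : SpinWreath Γ m) :
    (emb Γ n m N h.le y * emb Γ 0 n N (by omega) x).left =
      (emb Γ n m N h.le y).left * (emb Γ 0 n N (by omega) x).left := by
  have h0 : 0 + n ≤ N := by omega
  ext i
  rw [left_mul, Pi.mul_apply]
  congr 1
  change Function.extend _ _ _ _ = Function.extend _ _ _ _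
  have hp : perm (emb Γ n m N h.le y) = (SpinSymm.theta m y.right).viaEmbedding
    (SpinSymm.block n m N h.le) := SpinSymm.theta_shift h.le y.right
  have hinv : (perm (emb Γ n m N h.le y))⁻¹ = (SpinSymm.theta m y.right)⁻¹.viaEmbedding
    (SpinSymm.block n m N h.le) := by
    rw [hp]; exact (map_inv (Equiv.Perm.viaEmbeddingHom (SpinSymm.block n m N h.le)) _).symm
  rw [hinv]
  by_cases hi : i ∈ Set.range (SpinSymm.block n m N h.le)
  · obtain ⟨k, rfl⟩ := hi
    rw [Equiv.Perm.viaEmbedding_apply, Function.extend_apply', Function.extend_apply']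
    · rfl
    · change ¬ (_ ∈ Set.range (SpinSymm.block 0 n N h0))
      rw [SpinSymm.mem_range_block]
      simp
    · change ¬ (_ ∈ Set.range (SpinSymm.block 0 n N h0))
      rw [SpinSymm.mem_range_block]
      simp
  · rw [Equiv.Perm.viaEmbedding_apply_of_notMem _ _ _ hi]

lemma block_cases {n m N : ℕ} (h : n + m = N) (i : Fin N) :
    (i ∈ Set.range (SpinSymm.block 0 n N (by omega)) ∧
      i ∉ Set.range (SpinSymm.block n m N h.le)) ∨
    (i ∉ Set.range (SpinSymm.block 0 n N (by omega)) ∧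
      i ∈ Set.range (SpinSymm.block n m N h.le)) := by
  simp only [SpinSymm.mem_range_block]
  omega

lemma emb_comm [Finite Γ] {n m N : ℕ} (h : n + m = N) (x : SpinWreath Γ n)
    (y : SpinWreath Γ m) :
    emb Γ 0 n N (by omega) x * emb Γ n m N h.le y =
      wsign Γ N (SuperGroup.d x) (SuperGroup.d y) *
        (emb Γ n m N h.le y * emb Γ 0 n N (by omega) x) := by
  have h0 : 0 + n ≤ N := by omega
  have hw : ∀ (a b : ℤˣ) (w : SpinWreath Γ N), (wsign Γ N a b * w).left = w.left := by
    intro a b w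
    unfold wsign
    split_ifs
    · rw [one_mul]
    · rw [SuperGroup.z_comm]
      ext i
      rw [left_mul]
      change _ * (1 : Γ) = _
      rw [mul_one]
  ext1
  · rw [hw, emb_left_mul h, emb_left_mul' h]
    ext i
    rw [Pi.mul_apply, Pi.mul_apply]
    change Function.extend (SpinSymm.block 0 n N h0) x.left 1 i *
        Function.extend (SpinSymm.block n m N h.le) y.left 1 i =
      Function.extend (SpinSymm.block n m N h.le) y.left 1 i *
        Function.extend (SpinSymm.block 0 n N h0) x.left 1 i
    rcases block_cases h i with ⟨_, hi⟩ | ⟨hi, _⟩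
    · rw [Function.extend_apply' (f := SpinSymm.block n m N h.le) _ _ _ hi]; simp
    · rw [Function.extend_apply' (f := SpinSymm.block 0 n N h0) _ _ _ hi]; simp
  · rw [SemidirectProduct.mul_right, SemidirectProduct.mul_right, wsign_right,
      SemidirectProduct.mul_right, ← mul_assoc]
    exact SpinSymm.shift_comm_shift h.le x.right y.right

lemma shift_eq_shift {n m N : ℕ} (h : n + m = N) {u : SpinSymm n} {v : SpinSymm m}
    (e : SpinSymm.shift 0 n N (by omega) u = SpinSymm.shift n m N h.le v) :
    (u = 1 ∧ v = 1) ∨ (u = SpinSymm.z n ∧ v = SpinSymm.z m) := by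
  have h0 : 0 + n ≤ N := by omega
  have et := congrArg (SpinSymm.theta N) e
  rw [SpinSymm.theta_shift, SpinSymm.theta_shift] at et
  have hu : SpinSymm.theta n u = 1 := by
    ext i
    have := DFunLike.congr_fun et (SpinSymm.block 0 n N h0 i)
    rcases block_cases h (SpinSymm.block 0 n N h0 i) with ⟨_, hi⟩ | ⟨hi, _⟩
    · rw [Equiv.Perm.viaEmbedding_apply, Equiv.Perm.viaEmbedding_apply_of_notMem _ _ _ hi] at this
      simp [(SpinSymm.block 0 n N h0).injective this]
    · exact absurd ⟨i, rfl⟩ hi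
  have hv : SpinSymm.theta m v = 1 := by
    ext i
    have := DFunLike.congr_fun et (SpinSymm.block n m N h.le i)
    rcases block_cases h (SpinSymm.block n m N h.le i) with ⟨_, hi⟩ | ⟨hi, _⟩
    · exact absurd ⟨i, rfl⟩ hi
    · rw [Equiv.Perm.viaEmbedding_apply, Equiv.Perm.viaEmbedding_apply_of_notMem _ _ _ hi] at this
      simp [← (SpinSymm.block n m N h.le).injective this]
  rcases SpinSymm.eq_of_theta_eq_one hu with rfl | rfl <;>
    rcases SpinSymm.eq_of_theta_eq_one hv with rfl | rfl
  · simp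
  · exact absurd (by simpa using e.symm) (SpinSymm.z_ne_one N)
  · exact absurd (by simpa using e) (SpinSymm.z_ne_one N)
  · simp

lemma emb_mul_inj [Finite Γ] {n m N : ℕ} (h : n + m = N) {x x' : SpinWreath Γ n}
    {y y' : SpinWreath Γ m}
    (e : emb Γ 0 n N (by omega) x * emb Γ n m N h.le y =
      emb Γ 0 n N (by omega) x' * emb Γ n m N h.le y') :
    (x' = x ∧ y' = y) ∨ (x' = SuperGroup.z * x ∧ y' = SuperGroup.z * y) := by
  have h0 : 0 + n ≤ N := by omega
  have zmul : ∀ {k : ℕ} (u w : SpinWreath Γ k), u.left = w.left →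
      u.right = SpinSymm.z k * w.right → u = SuperGroup.z * w := by
    intro k u w hl hr
    ext1
    · rw [SuperGroup.z_comm, hl]
      ext i
      rw [left_mul]
      change _ = _ * (1 : Γ)
      rw [mul_one]
    · exact hr
  have el := congrArg SemidirectProduct.left e
  rw [emb_left_mul h, emb_left_mul h] at el
  have el' : ∀ i, Function.extend (SpinSymm.block 0 n N h0) x.left 1 i *
        Function.extend (SpinSymm.block n m N h.le) y.left 1 i =
      Function.extend (SpinSymm.block 0 n N h0) x'.left 1 i *
        Function.extend (SpinSymm.block n m N h.le) y'.left 1 i := fun i => congrFun el i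
  have hxl : x'.left = x.left := by
    ext i
    have := el' (SpinSymm.block 0 n N h0 i)
    rcases block_cases h (SpinSymm.block 0 n N h0 i) with ⟨_, hi⟩ | ⟨hi, _⟩
    · rw [(SpinSymm.block 0 n N h0).injective.extend_apply,
        (SpinSymm.block 0 n N h0).injective.extend_apply,
        Function.extend_apply' (f := SpinSymm.block n m N h.le) _ _ _ hi,
        Function.extend_apply' (f := SpinSymm.block n m N h.le) _ _ _ hi] at this
      simpa using this.symm
    · exact absurd ⟨i, rfl⟩ hi
  have hyl : y'.left = y.left := by
    ext i
    have := el' (SpinSymm.block n m N h.le i)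
    rcases block_cases h (SpinSymm.block n m N h.le i) with ⟨_, hi⟩ | ⟨hi, _⟩
    · exact absurd ⟨i, rfl⟩ hi
    · rw [(SpinSymm.block n m N h.le).injective.extend_apply,
        (SpinSymm.block n m N h.le).injective.extend_apply,
        Function.extend_apply' (f := SpinSymm.block 0 n N h0) _ _ _ hi,
        Function.extend_apply' (f := SpinSymm.block 0 n N h0) _ _ _ hi] at this
      simpa using this.symm
  have er : SpinSymm.shift 0 n N h0 x.right * SpinSymm.shift n m N h.le y.right =
      SpinSymm.shift 0 n N h0 x'.right * SpinSymm.shift n m N h.le y'.right :=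
    congrArg SemidirectProduct.right e
  have er2 : SpinSymm.shift 0 n N h0 (x'.right⁻¹ * x.right) =
      SpinSymm.shift n m N h.le (y'.right * y.right⁻¹) := by
    rw [map_mul, map_mul, map_inv, map_inv, inv_mul_eq_iff_eq_mul, ← mul_assoc,
      eq_mul_inv_iff_mul_eq, er]
  rcases shift_eq_shift h er2 with ⟨h1, h2⟩ | ⟨h1, h2⟩
  · left
    rw [inv_mul_eq_one] at h1
    rw [mul_inv_eq_one] at h2
    exact ⟨SemidirectProduct.ext hxl h1, SemidirectProduct.ext hyl h2⟩
  · right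
    rw [inv_mul_eq_iff_eq_mul, ← SpinSymm.z_comm] at h1
    rw [mul_inv_eq_iff_eq_mul] at h2
    refine ⟨zmul _ _ hxl ?_, zmul _ _ hyl h2⟩
    rw [h1, ← mul_assoc, SpinSymm.z_mul_z, one_mul]

/-- The copy of the spin product `Γ̃ₙ ×̂ Γ̃ₘ` in `Γ̃_N`, `N = n + m`: the products of an element of
`Γ̃ₙ`, acting on the first `n` letters, and an element of `Γ̃ₘ`, acting on the last `m` letters. By
`emb_comm` and `emb_mul_inj` these multiply as in the twisted direct product, with `(1, 1)` and
`(z, z)` identified. -/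
def spinProd (Γ : Type u) [Group Γ] [Finite Γ] (n m N : ℕ) (h : n + m = N) :
    Subgroup (SpinWreath Γ N) where
  carrier := {w | ∃ (x : SpinWreath Γ n) (y : SpinWreath Γ m),
    emb Γ 0 n N (by omega) x * emb Γ n m N h.le y = w}
  one_mem' := ⟨1, 1, by simp⟩
  mul_mem' := by
    rintro _ _ ⟨x, y, rfl⟩ ⟨x', y', rfl⟩
    have h0 : 0 + n ≤ N := by omega
    have key : ∀ a b : ℤˣ, ∃ u : SpinWreath Γ n, wsign Γ N a b = emb Γ 0 n N h0 u := by
      intro a b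
      unfold wsign
      split_ifs
      · exact ⟨1, by simp⟩
      · exact ⟨SuperGroup.z, (emb_z h0).symm⟩
    obtain ⟨u, hu⟩ := key (SuperGroup.d x') (SuperGroup.d y)
    have hc : emb Γ n m N h.le y * emb Γ 0 n N h0 x' =
        emb Γ 0 n N h0 (u * x') * emb Γ n m N h.le y := by
      have hs : wsign Γ N (SuperGroup.d x') (SuperGroup.d y) *
          wsign Γ N (SuperGroup.d x') (SuperGroup.d y) = 1 := by
        unfold wsign; split_ifs <;> simp [SuperGroup.z_sq]
      rw [map_mul, mul_assoc, emb_comm h, ← hu, ← mul_assoc, hs, one_mul]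
    refine ⟨x * (u * x'), y * y', ?_⟩
    rw [map_mul, map_mul (emb Γ n m N h.le)]
    calc _ = emb Γ 0 n N h0 x * (emb Γ 0 n N h0 (u * x') * emb Γ n m N h.le y) *
          emb Γ n m N h.le y' := by simp only [mul_assoc]
      _ = _ := by rw [← hc]; simp only [mul_assoc]
  inv_mem' := by
    rintro _ ⟨x, y, rfl⟩
    have h0 : 0 + n ≤ N := by omega
    have e := emb_comm h x⁻¹ y⁻¹
    have key : ∀ a b : ℤˣ, ∃ u : SpinWreath Γ n, wsign Γ N a b = emb Γ 0 n N h0 u := by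
      intro a b
      unfold wsign
      split_ifs
      · exact ⟨1, by simp⟩
      · exact ⟨SuperGroup.z, (emb_z h0).symm⟩
    obtain ⟨u, hu⟩ := key (SuperGroup.d x⁻¹) (SuperGroup.d y⁻¹)
    refine ⟨u⁻¹ * x⁻¹, y⁻¹, ?_⟩
    rw [map_mul, mul_assoc, e, hu, map_inv, inv_mul_cancel_left, mul_inv_rev, map_inv, map_inv]

lemma mul_mem_spinProd [Finite Γ] {n m N : ℕ} (h : n + m = N) (x : SpinWreath Γ n)
    (y : SpinWreath Γ m) :
    emb Γ 0 n N (by omega) x * emb Γ n m N h.le y ∈ spinProd Γ n m N h := ⟨x, y, rfl⟩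

instance z_mem_spinProd [Finite Γ] (n m N : ℕ) (h : n + m = N) :
    Fact (SuperGroup.z ∈ spinProd Γ n m N h) :=
  ⟨⟨SuperGroup.z, 1, by rw [emb_z, map_one, mul_one]⟩⟩

lemma exists_of_mem_spinProd [Finite Γ] {n m N : ℕ} (h : n + m = N) (w : spinProd Γ n m N h) :
    ∃ p : SpinWreath Γ n × SpinWreath Γ m,
      emb Γ 0 n N (by omega) p.1 * emb Γ n m N h.le p.2 = w.1 := by
  obtain ⟨x, y, hw⟩ := w.2
  exact ⟨(x, y), hw⟩

/-- The function `x y ↦ f(x) g(y)` on `Γ̃ₙ ×̂ Γ̃ₘ`. -/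
def outerFun [Finite Γ] {n m N : ℕ} (h : n + m = N) (f : SpinWreath Γ n → ℂ)
    (g : SpinWreath Γ m → ℂ) (w : spinProd Γ n m N h) : ℂ :=
  f (exists_of_mem_spinProd h w).choose.1 * g (exists_of_mem_spinProd h w).choose.2

lemma outerFun_mul [Finite Γ] {n m N : ℕ} (h : n + m = N) (f : RMinus (SpinWreath Γ n))
    (g : RMinus (SpinWreath Γ m)) (x : SpinWreath Γ n) (y : SpinWreath Γ m)
    (w : spinProd Γ n m N h) (hw : emb Γ 0 n N (by omega) x * emb Γ n m N h.le y = w.1) :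
    outerFun h f.1 g.1 w = f.1 x * g.1 y := by
  have e := (exists_of_mem_spinProd h w).choose_spec
  rcases emb_mul_inj h (hw.trans e.symm) with ⟨h1, h2⟩ | ⟨h1, h2⟩
  · rw [outerFun, h1, h2]
  · rw [outerFun, h1, h2, RMinus.spin, RMinus.spin, neg_mul_neg]

/-- The super outer tensor product `φ(f ⊗ g)` of spin super class functions, as a function of `g`:
its value at `x y` is `f(x) g(y)`. -/
def outer [Finite Γ] {n m N : ℕ} (h : n + m = N) (f : RMinus (SpinWreath Γ n)) :
    RMinus (SpinWreath Γ m) →ₗ[ℂ] RMinus (spinProd Γ n m N h) where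
  toFun g := ⟨outerFun h f.1 g.1, by
    have h0 : 0 + n ≤ N := by omega
    refine ⟨?_, ?_, ?_⟩
    · rintro ⟨_, x, y, rfl⟩ ⟨_, s, t, rfl⟩
      rw [outerFun_mul h f g x y ⟨_, x, y, rfl⟩ rfl]
      by_cases hxy : SuperGroup.d x = 1 ∧ SuperGroup.d y = 1
      · rw [outerFun_mul h f g (s * x * s⁻¹) (t * y * t⁻¹) _ ?_, RMinus.conj, RMinus.conj]
        change _ = (emb Γ 0 n N h0 s * emb Γ n m N h.le t) *
          (emb Γ 0 n N h0 x * emb Γ n m N h.le y) * (emb Γ 0 n N h0 s * emb Γ n m N h.le t)⁻¹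
        have c1 := emb_comm h x t
        have c2 := emb_comm h s (t * y * t⁻¹)
        have hd : SuperGroup.d (t * y * t⁻¹) = 1 := by simp [hxy.2]
        simp only [wsign, hxy.1, hd, true_or, or_true, if_true, one_mul] at c1 c2
        simp only [map_mul, map_inv] at c2 ⊢
        rw [mul_inv_rev]
        set S := emb Γ 0 n N h0 s
        set T := emb Γ n m N h.le t
        set X := emb Γ 0 n N h0 x
        set Y := emb Γ n m N h.le y
        calc S * X * S⁻¹ * (T * Y * T⁻¹)
            = S * X * S⁻¹ * ((T * Y * T⁻¹) * S) * S⁻¹ := by group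
          _ = S * (X * T) * Y * T⁻¹ * S⁻¹ := by rw [← c2]; group
          _ = _ := by rw [c1]; group
      · have hz : f.1 x * g.1 y = 0 := by
          rcases Int.units_eq_one_or (SuperGroup.d x) with hx | hx
          · rcases Int.units_eq_one_or (SuperGroup.d y) with hy | hy
            · exact absurd ⟨hx, hy⟩ hxy
            · rw [RMinus.odd g hy, mul_zero]
          · rw [RMinus.odd f hx, zero_mul]
        rw [hz]
        by_contra hne
        apply hxy
        -- the conjugate is again a product, whose two factors have the parities of `x` and `y`
        have ex : ∃ e : SpinWreath Γ n, SuperGroup.d e = 1 ∧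
            emb Γ 0 n N h0 (e * (s * x * s⁻¹)) * emb Γ n m N h.le (t * y * t⁻¹) =
            (emb Γ 0 n N h0 s * emb Γ n m N h.le t) *
              (emb Γ 0 n N h0 x * emb Γ n m N h.le y) *
              (emb Γ 0 n N h0 s * emb Γ n m N h.le t)⁻¹ := by
          have key : ∀ a b : ℤˣ, ∃ u : SpinWreath Γ n, SuperGroup.d u = 1 ∧
              wsign Γ N a b = emb Γ 0 n N h0 u := by
            intro a b
            unfold wsign
            split_ifs
            · exact ⟨1, by simp⟩
            · exact ⟨SuperGroup.z, SuperGroup.d_z, (emb_z h0).symm⟩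
          obtain ⟨u, hu, hu'⟩ := key (SuperGroup.d x) (SuperGroup.d t)
          obtain ⟨v, hv, hv'⟩ := key (SuperGroup.d s) (SuperGroup.d (t * y * t⁻¹))
          refine ⟨u⁻¹ * v, by simp [hu, hv], ?_⟩
          have c1 := emb_comm h x t
          have c2 := emb_comm h s (t * y * t⁻¹)
          have hcu : ∀ w, emb Γ 0 n N h0 u * w = w * emb Γ 0 n N h0 u := by
            rw [← hu']; exact wsign_comm N _ _
          have hcv : ∀ w, emb Γ 0 n N h0 v * w = w * emb Γ 0 n N h0 v := by
            rw [← hv']; exact wsign_comm N _ _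
          rw [hu'] at c1
          rw [hv'] at c2
          simp only [map_mul, map_inv] at c2 ⊢
          rw [mul_inv_rev]
          set S := emb Γ 0 n N h0 s
          set T := emb Γ n m N h.le t
          set X := emb Γ 0 n N h0 x
          set Y := emb Γ n m N h.le y
          set U := emb Γ 0 n N h0 u
          set V := emb Γ 0 n N h0 v
          have c1' : T * X = U⁻¹ * (X * T) := by rw [c1]; group
          calc U⁻¹ * V * (S * X * S⁻¹) * (T * Y * T⁻¹)
              = U⁻¹ * (V * (S * X * S⁻¹)) * (T * Y * T⁻¹ * S) * S⁻¹ := by group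
            _ = U⁻¹ * (S * X * S⁻¹) * (V * (T * Y * T⁻¹ * S)) * S⁻¹ := by rw [hcv]; group
            _ = U⁻¹ * S * (X * T) * Y * T⁻¹ * S⁻¹ := by rw [← c2]; group
            _ = S * (U⁻¹ * (X * T)) * Y * T⁻¹ * S⁻¹ := by
              have : U⁻¹ * S = S * U⁻¹ := by
                rw [inv_mul_eq_iff_eq_mul, ← mul_assoc, hcu, mul_inv_cancel_right]
              rw [this]; group
            _ = _ := by rw [← c1']; group
        obtain ⟨e, he, hE⟩ := ex
        rw [outerFun_mul h f g (e * (s * x * s⁻¹)) (t * y * t⁻¹) _ hE] at hne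
        have dx : SuperGroup.d (e * (s * x * s⁻¹)) = SuperGroup.d x := by
          rw [map_mul, he, one_mul, d_conj]
        have dy : SuperGroup.d (t * y * t⁻¹) = SuperGroup.d y := d_conj _ _
        constructor
        · rcases Int.units_eq_one_or (SuperGroup.d x) with hx | hx
          · exact hx
          · exact absurd (by rw [RMinus.odd f (dx.trans hx), zero_mul]) hne
        · rcases Int.units_eq_one_or (SuperGroup.d y) with hy | hy
          · exact hy
          · exact absurd (by rw [RMinus.odd g (dy.trans hy), mul_zero]) hne
    · rintro ⟨_, x, y, rfl⟩
      rw [outerFun_mul h f g x y ⟨_, x, y, rfl⟩ rfl, outerFun_mul h f g (SuperGroup.z * x) y, RMinus.spin,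
        neg_mul]
      rw [map_mul, emb_z, mul_assoc]
      rfl
    · rintro ⟨_, x, y, rfl⟩ hw
      rw [outerFun_mul h f g x y ⟨_, x, y, rfl⟩ rfl]
      change SuperGroup.d (emb Γ 0 n N h0 x * emb Γ n m N h.le y) = -1 at hw
      rw [map_mul, d_emb, d_emb] at hw
      rcases Int.units_eq_one_or (SuperGroup.d x) with hx | hx
      · rw [hx, one_mul] at hw
        rw [RMinus.odd g hw, mul_zero]
      · rw [RMinus.odd f hx, zero_mul]⟩
  map_add' g g' := by
    ext w
    simp [outerFun, mul_add]
  map_smul' a g := by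
    ext w
    simp only [outerFun, SetLike.val_smul, Pi.smul_apply, smul_eq_mul, RingHom.id_apply]
    ring

/-- The map `R⁻(Γ̃ₙ ×̂ Γ̃ₘ) → R⁻(Γ̃ₘ)`, `F ↦ ⟨f, F⟩`, given by the standard form of `R⁻(Γ̃ₙ)` in
the first factor: it sends `φ(f' ⊗ g)` to `⟨f, f'⟩ g`. As in the standard form, the sum is over
the even elements of `Γ̃ₙ`. -/
def contract [Finite Γ] {n m N : ℕ} (h : n + m = N) (f : SpinWreath Γ n → ℂ) :
    RMinus (spinProd Γ n m N h) →ₗ[ℂ] RMinus (SpinWreath Γ m) where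
  toFun F := ⟨fun y => (Nat.card (SpinWreath Γ n) : ℂ)⁻¹ *
      ∑ x : SpinWreath Γ n with SuperGroup.d x = 1,
        f x * F.1 ⟨_, mul_mem_spinProd h x⁻¹ y⟩, by
    have h0 : 0 + n ≤ N := by omega
    refine ⟨fun y s => ?_, fun y => ?_, fun y hy => ?_⟩
    · dsimp only
      congr 1
      refine Finset.sum_congr rfl fun x hx => ?_
      rw [← RMinus.conj F ⟨_, mul_mem_spinProd h x⁻¹ y⟩ ⟨_, mul_mem_spinProd h 1 s⟩]
      refine congrArg (f x * ·) (congrArg F.1 (Subtype.ext ?_))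
      change emb Γ 0 n N h0 x⁻¹ * emb Γ n m N h.le (s * y * s⁻¹) =
        (emb Γ 0 n N h0 1 * emb Γ n m N h.le s) *
          (emb Γ 0 n N h0 x⁻¹ * emb Γ n m N h.le y) *
          (emb Γ 0 n N h0 1 * emb Γ n m N h.le s)⁻¹
      have c := emb_comm h x⁻¹ s
      have hd : SuperGroup.d x⁻¹ = 1 := by
        rw [map_inv, (Finset.mem_filter.mp hx).2, inv_one]
      simp only [wsign, hd, true_or, if_true, one_mul] at c
      rw [map_one, one_mul, ← mul_assoc (emb Γ n m N h.le s), ← c, map_mul, map_mul,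
        map_inv (emb Γ n m N h.le)]
      simp only [mul_assoc]
    · dsimp only
      rw [← mul_neg, ← Finset.sum_neg_distrib]
      congr 1
      refine Finset.sum_congr rfl fun x _ => ?_
      rw [← mul_neg, ← RMinus.spin F]
      refine congrArg (f x * ·) (congrArg F.1 (Subtype.ext ?_))
      change emb Γ 0 n N h0 x⁻¹ * emb Γ n m N h.le (SuperGroup.z * y) =
        SuperGroup.z * (emb Γ 0 n N h0 x⁻¹ * emb Γ n m N h.le y)
      rw [map_mul, emb_z, ← mul_assoc, ← SuperGroup.z_comm, mul_assoc]
    · dsimp only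
      rw [Finset.sum_eq_zero, mul_zero]
      intro x hx
      rw [RMinus.odd F, mul_zero]
      change SuperGroup.d (emb Γ 0 n N h0 x⁻¹ * emb Γ n m N h.le y) = -1
      rw [map_mul, d_emb, d_emb, map_inv, (Finset.mem_filter.mp hx).2, inv_one, one_mul, hy]⟩
  map_add' F F' := by
    ext y
    simp [mul_add, Finset.sum_add_distrib]
  map_smul' a F := by
    ext y
    simp only [SetLike.val_smul, Pi.smul_apply, smul_eq_mul, RingHom.id_apply, Finset.mul_sum]
    refine Finset.sum_congr rfl fun x _ => ?_
    ring

end Wreath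

/-! ### Class functions of `Γ` and the characters `χₙ(γ)` -/

section Characters
variable {Γ : Type u} [Group Γ]

/-- The space `R(Γ)` of complex class functions on `Γ`. -/
abbrev ClassFn (Γ : Type u) [Group Γ] : Type u := ConjClasses Γ → ℂ

/-- `g_{i_k} ⋯ g_{i_2} g_{i_1}` for `i_1 = i`, `i_{j+1} = σ(i_j)`. -/
def cycleProdAux {n : ℕ} (g : Fin n → Γ) (σ : Equiv.Perm (Fin n)) (i : Fin n) : ℕ → Γ
  | 0 => 1
  | k + 1 => g ((σ ^ k) i) * cycleProdAux g σ i k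

/-- The conjugacy class of the cycle product `g_{i_k} ⋯ g_{i_1}` of `x = (g, t)` for the cycle
`(i_1 i_2 … i_k)` of `θₙ(x)` with `i_1 = i`. -/
def cycleClass {n : ℕ} (x : SpinWreath Γ n) (i : Fin n) : ConjClasses Γ :=
  ConjClasses.mk (cycleProdAux x.left (perm x) i (Function.minimalPeriod (perm x) i))

/-- The character `ηₙ(γ)` of `Γ ≀ Sₙ`, viewed as a function on `Γ̃ₙ`: its value at `x` is the product
of the values of `γ` at the cycle products of `x`, one for each cycle of `θₙ(x)`. -/
def eta (n : ℕ) (γ : ClassFn Γ) (x : SpinWreath Γ n) : ℂ :=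
  ∏ᶠ o : Quotient (Equiv.Perm.SameCycle.setoid (perm x)), γ (cycleClass x o.out)

lemma left_pow {n : ℕ} (x : SpinWreath Γ n) (i : Fin n) (k : ℕ) :
    (x ^ (k + 1)).left ((perm x ^ k) i) = cycleProdAux x.left (perm x) i (k + 1) := by
  induction k with
  | zero => simp [cycleProdAux]
  | succ k ih =>
    rw [pow_succ' x, left_mul, cycleProdAux, ← ih]
    congr 1
    refine congrArg (x ^ (k + 1)).left ?_
    rw [Equiv.Perm.inv_eq_iff_eq, ← Equiv.Perm.mul_apply, ← pow_succ']

lemma minimalPeriod_pos {n : ℕ} (σ : Equiv.Perm (Fin n)) (i : Fin n) :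
    0 < Function.minimalPeriod σ i :=
  Function.minimalPeriod_pos_of_mem_periodicPts
    (Function.mem_periodicPts.mpr ⟨orderOf σ, orderOf_pos σ, by
      rw [Function.IsPeriodicPt, Function.IsFixedPt, ← Equiv.Perm.coe_pow, pow_orderOf_eq_one]
      rfl⟩)

lemma cycleClass_eq {n : ℕ} (x : SpinWreath Γ n) (i : Fin n) :
    cycleClass x i = ConjClasses.mk
      ((x ^ Function.minimalPeriod (perm x) i).left ((perm x)⁻¹ i)) := by
  have hp := minimalPeriod_pos (perm x) i
  obtain ⟨k, hk⟩ : ∃ k, Function.minimalPeriod (perm x) i = k + 1 := ⟨_, (Nat.sub_add_cancel hp).symm⟩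
  rw [cycleClass, hk, ← left_pow]
  refine congrArg (fun j => ConjClasses.mk ((x ^ (k + 1)).left j)) ?_
  rw [Equiv.Perm.eq_inv_iff_eq, ← Equiv.Perm.mul_apply, ← pow_succ', ← hk, Equiv.Perm.coe_pow]
  exact Function.isPeriodicPt_minimalPeriod _ _

lemma perm_pow {n : ℕ} (x : SpinWreath Γ n) (k : ℕ) : perm (x ^ k) = perm x ^ k := by
  induction k with
  | zero => simp [perm]
  | succ k ih => rw [pow_succ, perm_mul, ih, pow_succ]

lemma left_conj {n : ℕ} (a y : SpinWreath Γ n) (i : Fin n) (hi : perm a i = i) :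
    (y * a * y⁻¹).left (perm y i) = y.left (perm y i) * a.left i * (y.left (perm y i))⁻¹ := by
  have hi' : (perm a)⁻¹ i = i := by rw [Equiv.Perm.inv_eq_iff_eq]; exact hi.symm
  have hy : (perm y)⁻¹ (perm y i) = i := by simp
  rw [left_mul, left_mul, perm_mul, mul_inv_rev, Equiv.Perm.mul_apply, hy, hi']
  congr 1
  rw [SemidirectProduct.inv_left, wreathAct_apply, map_inv, inv_inv]
  rfl

lemma perm_conj {n : ℕ} (x y : SpinWreath Γ n) :
    perm (y * x * y⁻¹) = perm y * perm x * (perm y)⁻¹ := by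
  rw [perm_mul, perm_mul, perm_inv]

lemma minimalPeriod_conj {n : ℕ} (σ τ : Equiv.Perm (Fin n)) (i : Fin n) :
    Function.minimalPeriod (τ * σ * τ⁻¹) (τ i) = Function.minimalPeriod σ i := by
  refine Function.minimalPeriod_eq_minimalPeriod_iff.mpr fun k => ?_
  rw [Function.IsPeriodicPt, Function.IsPeriodicPt, Function.IsFixedPt, Function.IsFixedPt,
    ← Equiv.Perm.coe_pow, ← Equiv.Perm.coe_pow, conj_pow]
  simp

lemma cycleClass_conj {n : ℕ} (x y : SpinWreath Γ n) (i : Fin n) :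
    cycleClass (y * x * y⁻¹) (perm y i) = cycleClass x i := by
  have e : (perm (y * x * y⁻¹))⁻¹ (perm y i) = perm y ((perm x)⁻¹ i) := by
    rw [perm_conj]; simp
  rw [cycleClass_eq, cycleClass_eq, e, perm_conj, minimalPeriod_conj, conj_pow, left_conj]
  · exact ConjClasses.mk_eq_mk_iff_isConj.mpr (isConj_iff.mpr ⟨_, rfl⟩).symm
  · rw [perm_pow, ← Equiv.Perm.mul_apply, ← zpow_natCast, ← zpow_neg_one,
      (Commute.zpow_zpow_self (perm x) _ (-1)).eq, Equiv.Perm.mul_apply, zpow_natCast,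
      Equiv.Perm.coe_pow]
    congr 1
    exact Function.isPeriodicPt_minimalPeriod _ _

lemma cycleClass_sameCycle {n : ℕ} (x : SpinWreath Γ n) {i j : Fin n}
    (h : (perm x).SameCycle i j) : cycleClass x i = cycleClass x j := by
  obtain ⟨k, rfl⟩ := h
  have e := cycleClass_conj x (x ^ k) i
  rw [(Commute.zpow_self x k).eq, mul_inv_cancel_right] at e
  have ep : perm (x ^ k) = perm x ^ k := by
    have : ∀ m : ℕ, perm (x ^ m) = perm x ^ m := perm_pow x
    cases k with
    | ofNat m => simpa using this m
    | negSucc m => rw [zpow_negSucc, perm_inv, this, zpow_negSucc]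
  rw [← ep, e]

lemma eta_conj {n : ℕ} (γ : ClassFn Γ) (x y : SpinWreath Γ n) :
    eta n γ (y * x * y⁻¹) = eta n γ x := by
  have hs : ∀ i j, (perm x).SameCycle i j ↔ (perm (y * x * y⁻¹)).SameCycle (perm y i) (perm y j) := by
    intro i j
    rw [perm_conj, Equiv.Perm.sameCycle_conj]
    simp
  let E : Quotient (Equiv.Perm.SameCycle.setoid (perm x)) ≃
      Quotient (Equiv.Perm.SameCycle.setoid (perm (y * x * y⁻¹))) :=
    Quotient.congr (perm y) hs
  rw [eta, eta]
  refine (finprod_eq_of_bijective E E.bijective fun o => ?_).symm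
  congr 1
  rw [← cycleClass_conj x y o.out]
  refine cycleClass_sameCycle _ ?_
  have h1 : E o = Quotient.mk (Equiv.Perm.SameCycle.setoid (perm (y * x * y⁻¹))) (perm y o.out) := by
    conv_lhs => rw [← Quotient.out_eq o]
    rfl
  rw [h1]
  exact (Quotient.exact (Quotient.out_eq
    (Quotient.mk (Equiv.Perm.SameCycle.setoid (perm (y * x * y⁻¹))) (perm y o.out)))).symm

/-- The spin super character `χₙ(γ)` of `Γ̃ₙ`, for an arbitrary class function `γ` of `Γ`: the
product of `ηₙ(γ)` and the character `χₙ` of the basic spin supermodule of `S̃ₙ`. If `γ` is the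
character of a `Γ`-module `V`, it is the character of the tensor product of `V^{⊗ n}` and the basic
spin supermodule. -/
def chi [Finite Γ] (n : ℕ) (γ : ClassFn Γ) : RMinus (SpinWreath Γ n) :=
  ⟨fun x => eta n γ x * SpinSymm.basicChar n x.right, by
    refine ⟨fun x y => ?_, fun x => ?_, fun x hx => ?_⟩
    · change eta n γ (y * x * y⁻¹) * _ = _
      rw [eta_conj]
      refine congrArg (eta n γ x * ·) ?_
      exact SpinSymm.basicChar_conj x.right y.right
    · have hp : perm (SuperGroup.z * x) = perm x := by
        change SpinSymm.theta n (SpinSymm.z n * x.right) = _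
        rw [map_mul, SpinSymm.theta_z, one_mul]; rfl
      have hl : (SuperGroup.z * x).left = x.left := by
        rw [SuperGroup.z_comm]
        ext i
        rw [left_mul]
        exact mul_one _
      have he : eta n γ (SuperGroup.z * x) = eta n γ x := by
        have key : ∀ w : SpinWreath Γ n, perm w = perm x → w.left = x.left →
            eta n γ w = eta n γ x := by
          intro w h1 h2
          simp only [eta, cycleClass]
          rw [h1, h2]
        exact key _ hp hl
      change eta n γ (SuperGroup.z * x) * _ = _
      rw [he, ← mul_neg, ← SpinSymm.basicChar_z]
      rfl
    · exact mul_eq_zero_of_right _ (SpinSymm.basicChar_odd hx)⟩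

/-- The matrix by which `x` acts on the tensor product of `V^{⊗ n}`, where `Γ` acts on `V = ℂᵐ`
through the matrices `A g`, and the basic spin supermodule:
`(g, t) (v₁ ⊗ ⋯ ⊗ vₙ ⊗ u) = g₁ v_{σ⁻¹(1)} ⊗ ⋯ ⊗ gₙ v_{σ⁻¹(n)} ⊗ t u` with `σ = θₙ(t)`. -/
def tensorSpinMat {m : ℕ} (A : Γ →* Matrix (Fin m) (Fin m) ℂ) (n : ℕ) (x : SpinWreath Γ n) :
    Matrix ((Fin n → Fin m) × SpinSymm.SpinIdx (n / 2))
      ((Fin n → Fin m) × SpinSymm.SpinIdx (n / 2)) ℂ :=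
  fun p q => (∏ i, A (x.left i) (p.1 i) (q.1 ((perm x)⁻¹ i))) *
    (SpinSymm.basicSpin n x.right).val p.2 q.2

/-- The weighted form `⟨f, g⟩_ξ = |Γ|⁻¹ ∑ₓ ξ(x) f(x) g(x⁻¹)` on `R(Γ)`. -/
def form (ξ f g : ClassFn Γ) : ℂ :=
  (Nat.card Γ : ℂ)⁻¹ *
    ∑ᶠ x : Γ, ξ (ConjClasses.mk x) * f (ConjClasses.mk x) * g (ConjClasses.mk x⁻¹)

/-- A class function `ξ` is self-dual if `ξ(x⁻¹) = ξ(x)`. -/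
def SelfDual (ξ : ClassFn Γ) : Prop :=
  ∀ x : Γ, ξ (ConjClasses.mk x⁻¹) = ξ (ConjClasses.mk x)

/-- The lattice `R_ℤ(Γ)` of virtual characters, spanned by the irreducible characters. -/
def RZ (Γ : Type u) [Group Γ] : AddSubgroup (ClassFn Γ) :=
  AddSubgroup.closure {χ | ∃ (m : ℕ) (ρ : Representation ℂ Γ (Fin m → ℂ)),
    ρ.IsIrreducible ∧ ∀ g, χ (ConjClasses.mk g) = ρ.character g}

end Characters

/-! ### The operators `H_{±n}(γ)` -/

section Operators
variable {Γ : Type u} [Group Γ] [Finite Γ]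

/-- The space `R⁻_Γ = ⨁ₙ R⁻(Γ̃ₙ)`. -/
abbrev RGamma (Γ : Type u) [Group Γ] [Finite Γ] : Type u :=
  DirectSum ℕ fun n => RMinus (SpinWreath Γ n)

/-- `2^{n̄/2} χₙ(γ)`, where `n̄` is `0` or `1` according to whether `n` is even or odd. -/
def chiNorm (n : ℕ) (γ : ClassFn Γ) : RMinus (SpinWreath Γ n) :=
  ((Real.sqrt 2 : ℂ) ^ (n % 2)) • chi n γ

/-- `H_{-n}(γ)`: on `R⁻(Γ̃ₘ)`, the super outer tensor product with `2^{n̄/2} χₙ(γ)`, followed by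
induction to `Γ̃_{n+m}`. -/
def Hup (γ : ClassFn Γ) (n : ℕ) : Module.End ℂ (RGamma Γ) :=
  DirectSum.toModule ℂ ℕ _ fun m =>
    DirectSum.lof ℂ ℕ (fun k => RMinus (SpinWreath Γ k)) (n + m) ∘ₗ
      ind (spinProd Γ n m (n + m) rfl) ∘ₗ outer rfl (chiNorm n γ)

/-- `H_n(γ)`: on `R⁻(Γ̃ₘ)`, restriction to `Γ̃ₙ ×̂ Γ̃_{m-n}`, followed by the pairing
`⟨2^{n̄/2} χₙ(γ), ·⟩_ξ = ⟨ηₙ(ξ) * 2^{n̄/2} χₙ(γ), ·⟩` in the first factor; it is `0` for `n > m`. -/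
def Hdown (ξ γ : ClassFn Γ) (n : ℕ) : Module.End ℂ (RGamma Γ) :=
  DirectSum.toModule ℂ ℕ _ fun m =>
    if h : n ≤ m then
      DirectSum.lof ℂ ℕ (fun k => RMinus (SpinWreath Γ k)) (m - n) ∘ₗ
        contract (Nat.add_sub_cancel' h) (fun x => eta n ξ x * (chiNorm n γ).1 x) ∘ₗ
          res (spinProd Γ n (m - n) m (Nat.add_sub_cancel' h))
    else 0

/-- `H₊(γ, z) = ∑_{n ≥ 0} H_{-n}(γ) zⁿ`, as a power series in `z`. -/
def Hplus (γ : ClassFn Γ) : PowerSeries (Module.End ℂ (RGamma Γ)) :=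
  PowerSeries.mk fun n => Hup γ n

/-- `H₋(γ, z) = ∑_{n ≥ 0} H_n(γ) z⁻ⁿ`, as a power series in `z⁻¹`. -/
def Hminus (ξ γ : ClassFn Γ) : PowerSeries (Module.End ℂ (RGamma Γ)) :=
  PowerSeries.mk fun n => Hdown ξ γ n

end Operators

/-! ### The twisted Heisenberg algebra and its Fock space -/

section Fock
variable {Γ : Type u} [Group Γ]

/-- The order `ζ_c` of the centralizer of an element of the class `c`. -/
def zeta (c : ConjClasses Γ) : ℕ := Nat.card (Subgroup.centralizer ({Quotient.out c} : Set Γ))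

/-- The index set of the generators `a_{-n}(c)`, `n` odd and positive, `c` a conjugacy class. -/
abbrev Var (Γ : Type u) [Group Γ] : Type u := {n : ℕ // Odd n} × ConjClasses Γ

/-- The symmetric algebra `S⁻_Γ` on the span of the `a_{-n}(γ)`, `n` odd and positive, `γ ∈ R(Γ)`,
as the polynomial algebra in the `a_{-n}(c)`. -/
abbrev Fock (Γ : Type u) [Group Γ] : Type u := MvPolynomial (Var Γ) ℂ

/-- The element `a_{-n}(γ) = ∑_c ζ_c⁻¹ γ(c) a_{-n}(c)` of `S⁻_Γ`. -/
def aNeg (n : {n : ℕ // Odd n}) (γ : ClassFn Γ) : Fock Γ :=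
  ∑ᶠ c : ConjClasses Γ, ((zeta c : ℂ)⁻¹ * γ c) • MvPolynomial.X (n, c)

open Classical in
/-- The class function `∑_i γ_i(c⁻¹) γ_i`, the sum being over the irreducible characters; by the
orthogonality relations it takes the value `ζ_c` on `c` and `0` elsewhere. Thus
`a_{-n}(c) = a_{-n}(classElt c)`. -/
def classElt (c : ConjClasses Γ) : ClassFn Γ := Pi.single c (zeta c : ℂ)

open Classical in
/-- The operator `a_n(γ)`, `n > 0`, on `S⁻_Γ`: the derivation with
`a_n(γ) · a_{-m}(β) = (n/2) δ_{n,m} ⟨γ, β⟩_ξ`. Together with the multiplication operators `a_{-n}(γ)`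
these satisfy `[a_m(γ), a_n(β)] = (m/2) δ_{m,-n} ⟨γ, β⟩_ξ`. -/
def aPos (ξ : ClassFn Γ) (n : {n : ℕ // Odd n}) (γ : ClassFn Γ) : Module.End ℂ (Fock Γ) :=
  (MvPolynomial.mkDerivation ℂ (A := Fock Γ) fun p =>
    if p.1 = n then MvPolynomial.C (((n : ℕ) : ℂ) / 2 * form ξ γ (classElt p.2)) else 0).toLinearMap

/-- The exponential `∑_k A(w)ᵏ / k!` of a power series `A(w)` with constant term `0`. -/
def opExp {R : Type*} [Ring R] [Algebra ℂ R] (A : PowerSeries R) : PowerSeries R :=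
  PowerSeries.mk fun n =>
    ∑ k ∈ Finset.range (n + 1), ((k.factorial : ℂ)⁻¹) • PowerSeries.coeff n (A ^ k)

/-- `∑_{n ≥ 1 odd} (2/n) a_{-n}(γ) zⁿ`, as a power series in `z`. -/
def negSeries (γ : ClassFn Γ) : PowerSeries (Module.End ℂ (Fock Γ)) :=
  PowerSeries.mk fun n =>
    if h : Odd n then (2 / n : ℂ) • LinearMap.mulLeft ℂ (aNeg ⟨n, h⟩ γ) else 0

/-- `∑_{n ≥ 1 odd} (2/n) a_n(γ) z⁻ⁿ`, as a power series in `z⁻¹`. -/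
def posSeries (ξ γ : ClassFn Γ) : PowerSeries (Module.End ℂ (Fock Γ)) :=
  PowerSeries.mk fun n => if h : Odd n then (2 / n : ℂ) • aPos ξ ⟨n, h⟩ γ else 0

/-! ### The characteristic map -/

/-- The partition-valued functions `ρ ∈ 𝒪𝒫(Γ_*)` on the classes of `Γ` with all parts odd, given
by the multiplicities `m_n(c)` of the part `n` in `ρ(c)`. -/
abbrev OP (Γ : Type u) [Group Γ] : Type u := Var Γ →₀ ℕ

/-- `‖ρ‖`, the sum of all parts. -/
def OP.size (ρ : OP Γ) : ℕ := ρ.sum fun p m => m * p.1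

/-- `l(ρ)`, the number of parts. -/
def OP.len (ρ : OP Γ) : ℕ := ρ.sum fun _ m => m

/-- `Z_ρ = ∏_c z_{ρ(c)} ζ_c^{l(ρ(c))}` with `z_λ = ∏_i i^{m_i} m_i!`. -/
def OP.bigZ (ρ : OP Γ) : ℕ := ρ.prod fun p m => (p.1 : ℕ) ^ m * m.factorial * zeta p.2 ^ m

/-- The monomial `a'_{-ρ} = ∏_{n, c} a_{-n}(c)^{m_n(c)}`. -/
def OP.mono (ρ : OP Γ) : Fock Γ := MvPolynomial.monomial ρ 1

lemma OP.finite_size [Finite Γ] (n : ℕ) : {ρ : OP Γ | ρ.size = n}.Finite := by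
  classical
  have hfin : {p : Var Γ | (p.1 : ℕ) ≤ n}.Finite := by
    have h1 : {k : {n : ℕ // Odd n} | (k : ℕ) ≤ n}.Finite :=
      Set.Finite.preimage Subtype.val_injective.injOn (Set.finite_Iic n)
    have : Finite (ConjClasses Γ) := inferInstance
    exact (h1.prod (Set.finite_univ (α := ConjClasses Γ))).subset fun p hp => ⟨hp, trivial⟩
  refine (Set.finite_Iic (Finsupp.indicator hfin.toFinset fun _ _ => n)).subset ?_
  intro ρ hρ p
  by_cases hp : p ∈ ρ.support
  · have hle : ρ p * (p.1 : ℕ) ≤ n := by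
      rw [← hρ]
      exact Finset.single_le_sum (f := fun p : Var Γ => ρ p * (p.1 : ℕ)) (fun _ _ => Nat.zero_le _) hp
    have h1 : 0 < ρ p := Nat.pos_of_ne_zero (Finsupp.mem_support_iff.mp hp)
    have h2 : 0 < (p.1 : ℕ) := p.1.2.pos
    have h3 : (p.1 : ℕ) ≤ n := le_trans (Nat.le_mul_of_pos_left _ h1) hle
    rw [Finsupp.indicator_of_mem (by simpa using h3)]
    exact le_trans (Nat.le_mul_of_pos_right _ h2) hle
  · rw [Finsupp.notMem_support_iff.mp hp]
    exact Nat.zero_le _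

/-- The finite set `𝒪𝒫ₙ(Γ_*)` of the `ρ` with `‖ρ‖ = n`. -/
def OP.ofSize (Γ : Type u) [Group Γ] [Finite Γ] (n : ℕ) : Finset (OP Γ) :=
  (OP.finite_size n).toFinset

/-- The lift `[i, i+1, …, i+j-1] = z^{j-1} t_i t_{i+1} ⋯ t_{i+j-2}` of a cycle to `S̃ₙ`. -/
def liftCycle (n i j : ℕ) : SpinSymm n :=
  SpinSymm.z n ^ (j - 1) * ((List.range (j - 1)).map fun k => SpinSymm.t n (i + k)).prod

/-- The product of the lifts of consecutive cycles, starting at the letter `a`, whose lengths are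
those in the list. -/
def blockSpin (n : ℕ) : ℕ → List (Var Γ) → SpinSymm n
  | _, [] => 1
  | a, p :: L => liftCycle n a p.1 * blockSpin n (a + p.1) L

/-- The element of `Γⁿ` which, at the first letter of each of the consecutive blocks, starting at
the letter `a`, is a representative of the corresponding class, and `1` elsewhere. -/
def blockBase (n : ℕ) : ℕ → List (Var Γ) → Fin n → Γ
  | _, [] => 1
  | a, p :: L => fun i => if (i : ℕ) = a then Quotient.out p.2 else blockBase n (a + p.1) L i

/-- An element `(g, t^ρ)` of the class `D_ρ⁺`, for `ρ ∈ 𝒪𝒫ₙ(Γ_*)`. Here `t^ρ` is the product of the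
lifts of consecutive disjoint cycles; as the cycles have odd length their lifts commute, and the
class does not depend on the order of the blocks. -/
def classRep (n : ℕ) (ρ : OP Γ) : SpinWreath Γ n :=
  ⟨blockBase n 0 (Finsupp.toMultiset ρ).toList, blockSpin n 0 (Finsupp.toMultiset ρ).toList⟩

/-- The characteristic map on `R⁻(Γ̃ₙ)`: `ch(f) = ∑_ρ 2^{l(ρ)/2} Z_ρ⁻¹ f(D_ρ⁺) a'_{-ρ}`. -/
def chN [Finite Γ] (n : ℕ) : RMinus (SpinWreath Γ n) →ₗ[ℂ] Fock Γ where
  toFun f := ∑ ρ ∈ OP.ofSize Γ n,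
    ((Real.sqrt 2 : ℂ) ^ ρ.len / (ρ.bigZ : ℂ) * f.1 (classRep n ρ)) • ρ.mono
  map_add' f g := by
    simp only [Submodule.coe_add, Pi.add_apply, mul_add, add_smul, Finset.sum_add_distrib]
  map_smul' a f := by
    simp only [SetLike.val_smul, Pi.smul_apply, smul_eq_mul, RingHom.id_apply, Finset.smul_sum,
      smul_smul]
    exact Finset.sum_congr rfl fun ρ _ => by ring_nf

/-- The characteristic map `ch : R⁻_Γ → S⁻_Γ`. -/
def ch (Γ : Type u) [Group Γ] [Finite Γ] : RGamma Γ →ₗ[ℂ] Fock Γ :=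
  DirectSum.toModule ℂ ℕ _ fun n => chN n

end Fock

/-! ### Twisted vertex operators -/

section Vertex
variable {Γ : Type u} [Group Γ]

/-- The form `⟨α, β⟩_ξ` on `R_ℤ(Γ)` as an integer; it is integral if `ξ` is a virtual character. -/
def intForm (ξ : ClassFn Γ) (α β : RZ Γ) : ℤ :=
  Function.invFun (Int.cast : ℤ → ℂ) (form ξ α.1 β.1)

/-- The alternating form `c₁(α, β) = ⟨α, β⟩_ξ + ⟨α, α⟩_ξ ⟨β, β⟩_ξ mod 2`. -/
def c1 (ξ : ClassFn Γ) (α β : RZ Γ) : ZMod 2 :=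
  (intForm ξ α β + intForm ξ α α * intForm ξ β β : ℤ)

/-- The subgroup `2 R_ℤ(Γ)` of `R_ℤ(Γ)`. -/
def twoRZ (Γ : Type u) [Group Γ] : AddSubgroup (RZ Γ) := (nsmulAddMonoidHom 2).range

/-- The choices entering the definition of the twisted vertex operators: a maximal subgroup `Φ` of
`R_ℤ(Γ)` for which `c₁` vanishes on `Φ/2R_ℤ(Γ)`; a central extension of `R_ℤ(Γ)/2R_ℤ(Γ)` by
`{1, κ}`, with `κ = -1`, whose commutator map is `(-1)^{c₁}`; elements `e_ᾱ` of the extension lying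
over the elements `ᾱ`; and an irreducible module structure on `ℂ[R_ℤ(Γ)/Φ]` for the extension in
which `κ` acts by `-1` and `e_ᾱ e^{[β]} = ε(α, β) e^{[α+β]}` with signs `ε(α, β)`. -/
structure VertexData (ξ : ClassFn Γ) where
  Φ : AddSubgroup (RZ Γ)
  maximal : Maximal (fun Ψ : AddSubgroup (RZ Γ) =>
    twoRZ Γ ≤ Ψ ∧ ∀ α ∈ Ψ, ∀ β ∈ Ψ, c1 ξ α β = 0) Φ
  Ext : Type
  [group : Group Ext]
  κ : Ext
  κ_ne_one : κ ≠ 1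
  κ_sq : κ * κ = 1
  proj : Ext →* Multiplicative (RZ Γ ⧸ twoRZ Γ)
  proj_surjective : Function.Surjective proj
  proj_eq_one : ∀ a, proj a = 1 ↔ a = 1 ∨ a = κ
  commutator : ∀ (a b : Ext) (α β : RZ Γ),
    proj a = Multiplicative.ofAdd (QuotientAddGroup.mk α) →
    proj b = Multiplicative.ofAdd (QuotientAddGroup.mk β) →
    a * b * a⁻¹ * b⁻¹ = κ ^ (c1 ξ α β).val
  e : RZ Γ ⧸ twoRZ Γ → Ext
  proj_e : ∀ a, proj (e a) = Multiplicative.ofAdd a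
  rep : Representation ℂ Ext (AddMonoidAlgebra ℂ (RZ Γ ⧸ Φ))
  irreducible : rep.IsIrreducible
  rep_κ : rep κ = -1
  ε : RZ Γ → RZ Γ → ℤˣ
  rep_e : ∀ α β : RZ Γ, rep (e (QuotientAddGroup.mk α))
    (AddMonoidAlgebra.single (QuotientAddGroup.mk β) 1) =
      ((ε α β : ℤ) : ℂ) • AddMonoidAlgebra.single (QuotientAddGroup.mk (α + β)) 1

attribute [instance] VertexData.group

/-- The operator `e_γ̄` on `ℂ[R_ℤ(Γ)/Φ]`. -/
def VertexData.op {ξ : ClassFn Γ} (D : VertexData ξ) (γ : RZ Γ) :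
    Module.End ℂ (AddMonoidAlgebra ℂ (RZ Γ ⧸ D.Φ)) :=
  D.rep (D.e (QuotientAddGroup.mk γ))

open TensorProduct in
/-- The coefficient of `z⁻ⁿ` in `P(z) M(z⁻¹) T`, where `P` and `M` are power series of operators on
`V` and `T` is an operator on `W`, acting on `V ⊗ W`. The sum is finite if, for every
vector of `V`, all but finitely many coefficients of `M` vanish on it. -/
def vertexMode {V W : Type*} [AddCommMonoid V] [Module ℂ V] [AddCommMonoid W] [Module ℂ W]
    (P M : PowerSeries (Module.End ℂ V)) (T : Module.End ℂ W) (n : ℤ) (v : V ⊗[ℂ] W) :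
    V ⊗[ℂ] W :=
  ∑ᶠ p : ℕ × ℕ, if (p.2 : ℤ) - p.1 = n then
    (PowerSeries.coeff p.1 P).rTensor W ((PowerSeries.coeff p.2 M).rTensor W (T.lTensor V v))
    else 0

/-- The series `A(-w)`. -/
def negArg {R : Type*} [Semiring R] [Algebra ℂ R] (A : PowerSeries R) : PowerSeries R :=
  PowerSeries.mk fun n => ((-1 : ℂ) ^ n) • PowerSeries.coeff n A

open TensorProduct in
/-- The component `X_n(γ)`, the coefficient of `z⁻ⁿ`, of the vertex operator
`X(γ, z) = H₊(γ, z) H₋(γ, -z) e_γ̄` on `R⁻_Γ ⊗ ℂ[R_ℤ(Γ)/Φ]`. -/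
def groupX [Finite Γ] {ξ : ClassFn Γ} (D : VertexData ξ) (γ : RZ Γ) (n : ℤ)
    (v : RGamma Γ ⊗[ℂ] AddMonoidAlgebra ℂ (RZ Γ ⧸ D.Φ)) :
    RGamma Γ ⊗[ℂ] AddMonoidAlgebra ℂ (RZ Γ ⧸ D.Φ) :=
  vertexMode (V := RGamma Γ) (Hplus γ.1) (negArg (Hminus ξ γ.1)) (D.op γ) n v

open TensorProduct in
/-- The coefficient of `z⁻ⁿ` of the usual twisted vertex operator
`exp(∑_{n odd} (2/n) a_{-n}(γ) zⁿ) exp(-∑_{n odd} (2/n) a_n(γ) z⁻ⁿ) e_γ̄` on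
`S⁻_Γ ⊗ ℂ[R_ℤ(Γ)/Φ]`. -/
def usualX {ξ : ClassFn Γ} (D : VertexData ξ) (γ : RZ Γ) (n : ℤ)
    (v : Fock Γ ⊗[ℂ] AddMonoidAlgebra ℂ (RZ Γ ⧸ D.Φ)) :
    Fock Γ ⊗[ℂ] AddMonoidAlgebra ℂ (RZ Γ ⧸ D.Φ) :=
  vertexMode (opExp (negSeries γ.1)) (opExp (-posSeries ξ γ.1)) (D.op γ) n v

end Vertex

end SpinWr

end

/-! Spin class functions live on cycle types with odd parts. A cycle of even length lifts to an odd
element. If an even element has such a cycle, it is a product of two odd factors on disjoint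
letters, which commute only up to `z`; conjugating one past the other gives f = -f, so f vanishes
there (`RMinus.eq_zero_of_even`). If all cycles are odd, the type ρ determines the element up to
conjugation and a factor `z` (`HasType.exists_conj`). A trace computation in the Clifford algebra
shows that 2^{n̄/2} χₙ takes the value 2^{l(ρ)/2} on the standard element of type ρ
(`basicChar_blockSpin`). This is not zero, so the sign ambiguity is harmless and the values f(D_ρ⁺)
are independent coordinates on the spin class functions.

The main tool is the class formula `avg_eq_sum_classRep`: the average over Γ̃ₙ of a suitable
function F equals ∑ Z_ρ⁻¹ F(D_ρ⁺). Centralizers are not computed. Instead one counts pairs of an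
element and a coloured letter in {1, …, n} × Γ, splits off the cycle through the letter
(`exists_split`, `card_split`), and uses induction on n. The same recursion holds for the weights
Z_ρ⁻¹ because n is the sum of k m_k(c) over all parts (`OP.sum_ofSize`).

The class formula for |f|² shows that ch is injective. The basic spin character cut down to a single
type (`typeChar`) is sent to a nonzero multiple of a monomial, so ch is surjective. Frobenius
reciprocity, tested against these functions, shows that ch turns induction products into products
(`chN_ind_outer`). Hence H_{-n}(γ) becomes multiplication by ∑ 2^{l(ρ)} Z_ρ⁻¹ γ^ρ a'_{-ρ}, while
H_n(γ) gets an explicit form in the monomial basis (`coeff_ch_Hdown`). Adding one part to ρ changes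
Z_ρ by a simple factor, so both families of operators satisfy n h_n = ∑ 2 a_{∓k}(γ) h_{n-k} over odd
k. This is the equation w u' = (w A') u for a series A with commuting coefficients, and its only
solution with constant term 1 is the exponential (`eq_opExp_odd`).

For the vertex operators, the exponent of H₋ has only odd powers, so replacing z by -z changes its
sign (`negArg_opExp`), and ch acts on the first tensor factor alone. For the characters of modules,
the trace on V^{⊗n} is invariant under conjugation and multiplicative over blocks, and on a single
cycle it is the trace of the cycle product (`trace_tensorPowMat`). -/

noncomputable section

namespace SpinWr

universe u

open SpinSymm

/-! ### The action on coloured letters, and splitting off one cycle -/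

section Action
variable {Γ : Type u} [Group Γ]

/-- The action of `Γ̃ₙ` on `{1, …, n} × Γ`, which commutes with the right action of `Γ`. -/
def pact {n : ℕ} (x : SpinWreath Γ n) (e : Fin n × Γ) : Fin n × Γ :=
  (perm x e.1, x.left (perm x e.1) * e.2)

lemma pact_mul {n : ℕ} (x y : SpinWreath Γ n) (e : Fin n × Γ) :
    pact (x * y) e = pact x (pact y e) := by
  simp [pact, perm_mul, left_mul, mul_assoc]

@[simp] lemma perm_one {n : ℕ} : perm (1 : SpinWreath Γ n) = 1 := by simp [perm]

@[simp] lemma pact_one {n : ℕ} (e : Fin n × Γ) : pact (1 : SpinWreath Γ n) e = e := by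
  simp [pact]

lemma pact_inv_eq {n : ℕ} {x : SpinWreath Γ n} {e f : Fin n × Γ} :
    pact x⁻¹ e = f ↔ pact x f = e := by
  constructor
  · rintro rfl
    rw [← pact_mul, mul_inv_cancel, pact_one]
  · rintro rfl
    rw [← pact_mul, inv_mul_cancel, pact_one]

lemma pact_smul {n : ℕ} (x : SpinWreath Γ n) (i : Fin n) (a r : Γ) :
    pact x (i, a * r) = ((pact x (i, a)).1, (pact x (i, a)).2 * r) := by
  simp [pact, mul_assoc]

lemma pact_pow_fst {n : ℕ} (x : SpinWreath Γ n) (k : ℕ) (e : Fin n × Γ) :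
    (pact (x ^ k) e).1 = (perm x ^ k) e.1 := by
  simp [pact, perm_pow]

/-- Adjacent transpositions generate the symmetric group. -/
lemma theta_surjective (n : ℕ) : Function.Surjective (theta n) := by
  cases n with
  | zero => intro σ; exact ⟨1, Subsingleton.elim _ _⟩
  | succ n =>
    rw [← MonoidHom.range_eq_top, ← Subgroup.toSubmonoid_inj, Subgroup.top_toSubmonoid,
      eq_top_iff, ← Equiv.Perm.mclosure_swap_castSucc_succ n, Submonoid.closure_le]
    rintro _ ⟨i, rfl⟩
    refine ⟨t (n + 1) i, ?_⟩
    rw [theta_t (by omega), adjSwap, dif_pos (by omega)]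
    rfl

lemma exists_perm_extend {k n : ℕ} (h : k ≤ n) (f : Fin k → Fin n) (hf : Function.Injective f) :
    ∃ b : Equiv.Perm (Fin n), ∀ i : Fin k, b ⟨i, by omega⟩ = f i := by
  classical
  have hc : Function.Injective (Fin.castLE h) := Fin.castLE_injective h
  let E : {x // x ∈ Set.range (Fin.castLE h)} ≃ {x // x ∈ Set.range f} :=
    (Equiv.ofInjective _ hc).symm.trans (Equiv.ofInjective f hf)
  refine ⟨E.extendSubtype, fun i => ?_⟩
  refine (Equiv.extendSubtype_apply_of_mem E (Fin.castLE h i) ⟨i, rfl⟩).trans ?_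
  have : (⟨Fin.castLE h i, ⟨i, rfl⟩⟩ : {x // x ∈ Set.range (Fin.castLE h)}) =
      Equiv.ofInjective _ hc i := rfl
  rw [this]
  simp [E]

lemma exists_viaEmbedding {k m n : ℕ} (h : k + m = n) (σ : Equiv.Perm (Fin n))
    (hσ : ∀ i : Fin n, (i : ℕ) < k → σ i = i) :
    ∃ π : Equiv.Perm (Fin m), σ = π.viaEmbedding (block k m n h.le) := by
  -- The first `k` letters are fixed, so injectivity keeps the remaining ones out of them.
  have hge : ∀ i : Fin n, k ≤ (i : ℕ) → k ≤ (σ i : ℕ) := by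
    intro i hi
    by_contra hlt
    have := σ.injective (hσ (σ i) (by omega))
    rw [this] at hlt
    omega
  let f : Fin m → Fin m := fun j => ⟨σ (block k m n h.le j) - k, by
    have := hge (block k m n h.le j) (by simp)
    omega⟩
  have hf' : ∀ j, block k m n h.le (f j) = σ (block k m n h.le j) := by
    intro j
    have := hge (block k m n h.le j) (by simp)
    ext
    simp only [block_val, f]
    omega
  have hf : Function.Injective f := by
    intro i j hij
    have := congrArg (block k m n h.le) hij
    rw [hf', hf'] at this
    exact (block k m n h.le).injective (σ.injective this)
  refine ⟨Equiv.ofBijective f (Finite.injective_iff_bijective.mp hf), ?_⟩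
  ext i
  by_cases hi : i ∈ Set.range (block k m n h.le)
  · obtain ⟨j, rfl⟩ := hi
    rw [Equiv.Perm.viaEmbedding_apply, ← hf']
    rfl
  · rw [Equiv.Perm.viaEmbedding_apply_of_notMem _ _ _ hi]
    rw [mem_range_block] at hi
    rw [hσ i (by omega)]

@[simp] lemma z_right [Finite Γ] {n : ℕ} : (SuperGroup.z : SpinWreath Γ n).right = z n := rfl

@[simp] lemma perm_z_mul [Finite Γ] {n : ℕ} (x : SpinWreath Γ n) :
    perm (SuperGroup.z * x) = perm x := by
  simp [perm]

@[simp] lemma left_z_mul [Finite Γ] {n : ℕ} (x : SpinWreath Γ n) :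
    (SuperGroup.z * x).left = x.left := by
  rw [SuperGroup.z_comm]
  ext i
  rw [left_mul]
  exact mul_one _

/-- The kernel of `theta` is {1, z} by `eq_of_theta_eq_one`. This lets elements be compared through
their action on coloured letters, at the price of an undetermined factor `z`. -/
lemma eq_or_eq_z_mul [Finite Γ] {n : ℕ} {x y : SpinWreath Γ n} (hp : perm x = perm y)
    (hl : x.left = y.left) : x = y ∨ x = SuperGroup.z * y := by
  have h1 : theta n (x.right * y.right⁻¹) = 1 := by
    rw [map_mul, map_inv]
    change perm x * (perm y)⁻¹ = 1
    rw [hp, mul_inv_cancel]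
  rcases eq_of_theta_eq_one h1 with h | h
  · left
    rw [mul_inv_eq_one] at h
    exact SemidirectProduct.ext hl h
  · right
    rw [mul_inv_eq_iff_eq_mul] at h
    refine SemidirectProduct.ext ?_ h
    rw [left_z_mul, hl]

lemma emb_left_block {a m n : ℕ} (h : a + m ≤ n) (y : SpinWreath Γ m) (j : Fin m) :
    (emb Γ a m n h y).left (block a m n h j) = y.left j :=
  (block a m n h).injective.extend_apply _ _ _

lemma emb_left_notMem {a m n : ℕ} (h : a + m ≤ n) (y : SpinWreath Γ m) {i : Fin n}
    (hi : i ∉ Set.range (block a m n h)) : (emb Γ a m n h y).left i = 1 :=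
  Function.extend_apply' _ _ _ hi

lemma perm_emb {a m n : ℕ} (h : a + m ≤ n) (y : SpinWreath Γ m) :
    perm (emb Γ a m n h y) = (perm y).viaEmbedding (block a m n h) := theta_shift h y.right

lemma pact_emb_block {a m n : ℕ} (h : a + m ≤ n) (y : SpinWreath Γ m) (j : Fin m) (g : Γ) :
    pact (emb Γ a m n h y) (block a m n h j, g) =
      (block a m n h (pact y (j, g)).1, (pact y (j, g)).2) := by
  simp only [pact, perm_emb, Equiv.Perm.viaEmbedding_apply, emb_left_block]

lemma pact_emb_notMem {a m n : ℕ} (h : a + m ≤ n) (y : SpinWreath Γ m) {i : Fin n}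
    (hi : i ∉ Set.range (block a m n h)) (g : Γ) :
    pact (emb Γ a m n h y) (i, g) = (i, g) := by
  simp only [pact, perm_emb, Equiv.Perm.viaEmbedding_apply_of_notMem _ _ _ hi,
    emb_left_notMem h y hi, one_mul]

/-- An element that fixes the letters of the first block, with colour `1`, lies in the copy of
`Γ̃ₘ` on the second block. -/
lemma exists_emb_of_fix [Finite Γ] {k m n : ℕ} (h : k + m = n) (w : SpinWreath Γ n)
    (hw : ∀ i : Fin n, (i : ℕ) < k → pact w (i, 1) = (i, 1)) :
    ∃ y : SpinWreath Γ m, w = emb Γ k m n h.le y := by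
  have h1 : ∀ i : Fin n, (i : ℕ) < k → perm w i = i := fun i hi => congrArg Prod.fst (hw i hi)
  have h2 : ∀ i : Fin n, (i : ℕ) < k → w.left i = 1 := fun i hi => by
    have := congrArg Prod.snd (hw i hi)
    simpa [pact, h1 i hi] using this
  obtain ⟨π, hπ⟩ := exists_viaEmbedding h (perm w) h1
  obtain ⟨s, hs⟩ := theta_surjective m π
  let y : SpinWreath Γ m := ⟨fun j => w.left (block k m n h.le j), s⟩
  have hp : perm w = perm (emb Γ k m n h.le y) := by
    rw [perm_emb, hπ, ← hs]
    rfl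
  have hl : w.left = (emb Γ k m n h.le y).left := by
    ext i
    by_cases hi : i ∈ Set.range (block k m n h.le)
    · obtain ⟨j, rfl⟩ := hi
      rw [emb_left_block]
    · rw [emb_left_notMem h.le y hi]
      rw [mem_range_block] at hi
      exact h2 i (by omega)
  -- The lift `s` of the permutation was arbitrary; if it is the wrong one, multiplying `y` by `z`
  -- corrects it.
  rcases eq_or_eq_z_mul hp hl with e | e
  · exact ⟨y, e⟩
  · exact ⟨SuperGroup.z * y, by rw [map_mul, emb_z, e]⟩

/-- The lift of the cycle `(a, a + 1, …, a + k - 1)`, with the element `r` of `Γ` at the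
letter `a`. -/
def cyc (n a k : ℕ) (r : Γ) : SpinWreath Γ n :=
  ⟨fun i => if (i : ℕ) = a then r else 1, liftCycle n a k⟩

lemma adjSwap_apply {n i : ℕ} (h : i + 1 < n) (j : Fin n) :
    ((adjSwap n i j : Fin n) : ℕ) =
      if (j : ℕ) = i then i + 1 else if (j : ℕ) = i + 1 then i else j := by
  simp only [adjSwap, h, dif_pos, Equiv.swap_apply_def, Fin.ext_iff]
  split_ifs <;> rfl

/-- A word of `k` adjacent transpositions is a cycle on `k + 1` letters: the rightmost factor acts
first and inserts the new last letter into the cycle of the shorter word. -/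
lemma theta_word {n a k : ℕ} (h : a + k + 1 ≤ n) (j : Fin n) :
    ((theta n ((List.range k).map fun l => t n (a + l)).prod j : Fin n) : ℕ) =
      if (j : ℕ) = a + k then a else if a ≤ j ∧ (j : ℕ) < a + k then j + 1 else j := by
  induction k generalizing j with
  | zero =>
    simp
    split_ifs <;> omega
  | succ k ih =>
    have hi : a + k + 1 < n := by omega
    rw [List.range_succ, List.map_append, List.prod_append, map_mul, Equiv.Perm.mul_apply,
      ih (by omega)]
    simp only [List.map_cons, List.map_nil, List.prod_cons, List.prod_nil, mul_one, theta_t hi,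
      adjSwap_apply hi]
    split_ifs <;> omega

lemma perm_cyc {n a k : ℕ} (hk : 0 < k) (h : a + k ≤ n) (r : Γ) (j : Fin n) :
    ((perm (cyc n a k r) j : Fin n) : ℕ) =
      if (j : ℕ) + 1 = a + k then a else if a ≤ j ∧ (j : ℕ) + 1 < a + k then j + 1 else j := by
  rw [perm, cyc, liftCycle, map_mul, map_pow, theta_z, one_pow, one_mul, theta_word (by omega)]
  split_ifs <;> omega

lemma pact_cyc_of_lt {n a k : ℕ} (hk : 0 < k) (h : a + k ≤ n) (r g : Γ) (j j' : Fin n)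
    (h1 : a ≤ j) (h2 : (j : ℕ) + 1 < a + k) (h3 : (j' : ℕ) = j + 1) :
    pact (cyc n a k r) (j, g) = (j', g) := by
  have hj : perm (cyc n a k r) j = j' := by
    ext; rw [perm_cyc hk h, if_neg (by omega), if_pos ⟨h1, h2⟩, h3]
  have : (cyc n a k r).left j' = 1 := if_neg (by omega)
  simp [pact, hj, this]

lemma pact_cyc_last {n a k : ℕ} (hk : 0 < k) (h : a + k ≤ n) (r g : Γ) (j j' : Fin n)
    (h2 : (j : ℕ) + 1 = a + k) (h3 : (j' : ℕ) = a) :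
    pact (cyc n a k r) (j, g) = (j', r * g) := by
  have hj : perm (cyc n a k r) j = j' := by
    ext; rw [perm_cyc hk h, if_pos h2, h3]
  have : (cyc n a k r).left j' = r := if_pos h3
  simp [pact, hj, this]

lemma shift_liftCycle {a m n b j : ℕ} (h : a + m ≤ n) (hj : b + j ≤ m) :
    shift a m n h (liftCycle m b j) = liftCycle n (a + b) j := by
  rw [liftCycle, liftCycle, map_mul, map_pow, shift_z, map_list_prod, List.map_map]
  congr 2
  refine List.map_congr_left fun l hl => ?_
  rw [List.mem_range] at hl
  rw [Function.comp_apply, shift_t h (by omega), add_assoc]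

lemma emb_cyc {a m n b k : ℕ} (hk : 0 < k) (h : a + m ≤ n) (hb : b + k ≤ m) (r : Γ) :
    emb Γ a m n h (cyc m b k r) = cyc n (a + b) k r := by
  refine SemidirectProduct.ext ?_ (shift_liftCycle h hb)
  ext i
  by_cases hi : i ∈ Set.range (block a m n h)
  · obtain ⟨j, rfl⟩ := hi
    rw [emb_left_block]
    simp [cyc]
  · rw [emb_left_notMem h _ hi]
    rw [mem_range_block] at hi
    exact (if_neg (by omega)).symm

/-- A cycle of `k` letters uses `k - 1` odd generators, and `z` is even. So cycles of odd length are
even elements and conversely. -/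
lemma parity_liftCycle {n a k : ℕ} (h : a + k ≤ n) :
    parity n (liftCycle n a k) = (-1) ^ (k - 1) := by
  rw [liftCycle, map_mul, map_pow, parity_z, one_pow, one_mul, map_list_prod, List.map_map]
  rw [List.map_congr_left (g := fun _ => -1)]
  · simp
  · intro l hl
    rw [List.mem_range] at hl
    exact parity_t (by omega)

lemma d_cyc [Finite Γ] {n a k : ℕ} (h : a + k ≤ n) (r : Γ) :
    SuperGroup.d (cyc n a k r) = (-1) ^ (k - 1) := parity_liftCycle h

lemma d_cyc_odd [Finite Γ] {n a k : ℕ} (h : a + k ≤ n) (hk : Odd k) (r : Γ) :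
    SuperGroup.d (cyc n a k r) = 1 := by
  rw [d_cyc h, (Nat.Odd.sub_odd hk odd_one).neg_one_pow]

lemma d_cyc_even [Finite Γ] {n a k : ℕ} (h : a + k ≤ n) (hk0 : 0 < k) (hk : Even k) (r : Γ) :
    SuperGroup.d (cyc n a k r) = -1 := by
  rw [d_cyc h, (Nat.Even.sub_odd hk0 hk odd_one).neg_one_pow]

/-- `x` moves `e` around a cycle of length `k` and multiplies it by `r` from the right. -/
def IsCycleAt {n : ℕ} (x : SpinWreath Γ n) (e : Fin n × Γ) (k : ℕ) (r : Γ) : Prop :=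
  Function.minimalPeriod (perm x) e.1 = k ∧ pact (x ^ k) e = (e.1, e.2 * r)

lemma IsCycleAt.pos {n : ℕ} {x : SpinWreath Γ n} {e : Fin n × Γ} {k : ℕ} {r : Γ}
    (h : IsCycleAt x e k r) : 0 < k := h.1 ▸ minimalPeriod_pos _ _

lemma minimalPeriod_le {n : ℕ} (σ : Equiv.Perm (Fin n)) (i : Fin n) :
    Function.minimalPeriod σ i ≤ n := by
  classical
  have h : Function.Injective (fun j : Fin (Function.minimalPeriod σ i) => (σ ^ (j : ℕ)) i) := by
    intro a b hab
    simp only [Equiv.Perm.coe_pow] at hab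
    exact Fin.ext (Function.iterate_injOn_Iio_minimalPeriod a.2 b.2 hab)
  simpa using Fintype.card_le_of_injective _ h

lemma IsCycleAt.le {n : ℕ} {x : SpinWreath Γ n} {e : Fin n × Γ} {k : ℕ} {r : Γ}
    (h : IsCycleAt x e k r) : k ≤ n := h.1 ▸ minimalPeriod_le _ _

lemma pact_conj_pow {n : ℕ} (x s : SpinWreath Γ n) (k : ℕ) (e : Fin n × Γ) :
    pact ((s * x * s⁻¹) ^ k) (pact s e) = pact s (pact (x ^ k) e) := by
  rw [conj_pow, ← pact_mul, ← pact_mul, inv_mul_cancel_right]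

lemma IsCycleAt.conj {n : ℕ} {x : SpinWreath Γ n} {e : Fin n × Γ} {k : ℕ} {r : Γ}
    (h : IsCycleAt x e k r) (s : SpinWreath Γ n) :
    IsCycleAt (s * x * s⁻¹) (pact s e) k r := by
  refine ⟨?_, ?_⟩
  · rw [perm_conj]
    change Function.minimalPeriod _ (perm s e.1) = k
    rw [minimalPeriod_conj, h.1]
  · rw [pact_conj_pow, h.2, pact_smul]

lemma perm_pow_fix {n : ℕ} (σ : Equiv.Perm (Fin n)) (i : Fin n) :
    (σ ^ Function.minimalPeriod σ i) i = i := by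
  rw [Equiv.Perm.coe_pow]
  exact Function.isPeriodicPt_minimalPeriod _ _

lemma cycleClass_eq' {n : ℕ} (x : SpinWreath Γ n) (i : Fin n) :
    cycleClass x i = ConjClasses.mk ((x ^ Function.minimalPeriod (perm x) i).left i) := by
  have h1 := minimalPeriod_conj (perm x) (perm x) i
  rw [mul_inv_cancel_right] at h1
  rw [cycleClass_sameCycle x (i := i) (j := perm x i) ⟨1, by simp⟩, cycleClass_eq, h1]
  simp

lemma isCycleAt_iff {n : ℕ} (x : SpinWreath Γ n) (e : Fin n × Γ) (k : ℕ) (r : Γ) :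
    IsCycleAt x e k r ↔ Function.minimalPeriod (perm x) e.1 = k ∧
      (x ^ k).left e.1 * e.2 = e.2 * r := by
  refine and_congr_right fun h => ?_
  have := perm_pow_fix (perm x) e.1
  rw [h, ← perm_pow] at this
  simp [pact, this]

lemma IsCycleAt.cycleClass {n : ℕ} {x : SpinWreath Γ n} {e : Fin n × Γ} {k : ℕ} {r : Γ}
    (h : IsCycleAt x e k r) : cycleClass x e.1 = ConjClasses.mk r := by
  rw [isCycleAt_iff] at h
  rw [cycleClass_eq', h.1, ConjClasses.mk_eq_mk_iff_isConj, isConj_iff]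
  exact ⟨e.2⁻¹, by rw [inv_inv, mul_assoc, h.2]; group⟩

/-- Changing the colour of the starting letter conjugates the factor picked up around the cycle, so
any representative of the class can be achieved. -/
lemma exists_isCycleAt {n : ℕ} (x : SpinWreath Γ n) (i : Fin n) (r : Γ)
    (h : cycleClass x i = ConjClasses.mk r) :
    ∃ a, IsCycleAt x (i, a) (Function.minimalPeriod (perm x) i) r := by
  rw [cycleClass_eq', ConjClasses.mk_eq_mk_iff_isConj, isConj_comm, isConj_iff] at h
  obtain ⟨a, ha⟩ := h
  exact ⟨a, (isCycleAt_iff _ _ _ _).mpr ⟨rfl, by rw [← ha]; simp⟩⟩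

lemma pact_cyc_mul_emb {k m n : ℕ} (h : k + m = n) (r : Γ) (y : SpinWreath Γ m)
    (i : Fin n) (hi : (i : ℕ) < k) (g : Γ) :
    pact (cyc n 0 k r * emb Γ k m n h.le y) (i, g) = pact (cyc n 0 k r) (i, g) := by
  rw [pact_mul, pact_emb_notMem]
  rw [mem_range_block]
  omega

lemma pact_cyc_mul_emb_pow {k m n : ℕ} (hk : 0 < k) (h : k + m = n) (r : Γ) (y : SpinWreath Γ m)
    (i : ℕ) (hi : i < k) :
    pact ((cyc n 0 k r * emb Γ k m n h.le y) ^ i) (⟨0, by omega⟩, 1) = (⟨i, by omega⟩, 1) := by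
  induction i with
  | zero => simp
  | succ i ih =>
    rw [pow_succ', pact_mul, ih (by omega), pact_cyc_mul_emb h _ _ _ (show i < k by omega)]
    exact pact_cyc_of_lt hk (by omega) r 1 _ _ (Nat.zero_le _) (show i + 1 < 0 + k by omega) rfl

lemma isCycleAt_cyc_mul_emb {k m n : ℕ} (hk : 0 < k) (h : k + m = n) (r : Γ)
    (y : SpinWreath Γ m) :
    IsCycleAt (cyc n 0 k r * emb Γ k m n h.le y) (⟨0, by omega⟩, 1) k r := by
  set w := cyc n 0 k r * emb Γ k m n h.le y
  have h2 : pact (w ^ k) (⟨0, by omega⟩, 1) = (⟨0, by omega⟩, 1 * r) := by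
    obtain ⟨k', rfl⟩ : ∃ k', k = k' + 1 := ⟨k - 1, by omega⟩
    rw [pow_succ', pact_mul, pact_cyc_mul_emb_pow hk h _ _ _ (by omega),
      pact_cyc_mul_emb h _ _ _ (by simp)]
    rw [pact_cyc_last (a := 0) hk (by omega) r 1 _ ⟨0, by omega⟩ (by simp) rfl]
    simp
  refine ⟨?_, h2⟩
  have h3 : ((perm w) ^ k) ⟨0, by omega⟩ = ⟨0, by omega⟩ := by
    have := congrArg Prod.fst h2
    rwa [pact_pow_fst] at this
  have hle : Function.minimalPeriod (perm w) (⟨0, by omega⟩ : Fin n) ≤ k := by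
    refine Function.IsPeriodicPt.minimalPeriod_le hk ?_
    rw [Function.IsPeriodicPt, Function.IsFixedPt, ← Equiv.Perm.coe_pow]
    exact h3
  -- A shorter period would return the first letter to itself, but before time `k` its orbit visits
  -- the letters 0, 1, …, k - 1 in order.
  refine le_antisymm hle (le_of_not_gt fun hlt => ?_)
  have h4 := congrArg Prod.fst (pact_cyc_mul_emb_pow hk h r y _ hlt)
  rw [pact_pow_fst] at h4
  have h5 := perm_pow_fix (perm w) (⟨0, by omega⟩ : Fin n)
  rw [h5] at h4
  have h6 := minimalPeriod_pos (perm w) (⟨0, by omega⟩ : Fin n)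
  have := congrArg Fin.val h4
  simp only at this
  omega

/-- Every element is conjugate to the product of a standard cycle on the first letters and an
element on the remaining letters; the cycle may be chosen. -/
lemma exists_split [Finite Γ] {n k m : ℕ} (h : k + m = n) {x : SpinWreath Γ n} {e : Fin n × Γ}
    {r : Γ} (he : IsCycleAt x e k r) :
    ∃ (s : SpinWreath Γ n) (y : SpinWreath Γ m),
      pact s (⟨0, by have := he.pos; omega⟩, 1) = e ∧
        x = s * (cyc n 0 k r * emb Γ k m n h.le y) * s⁻¹ := by
  have hk := he.pos
  -- The conjugator has to carry the coloured letter (i, 1) to `x ^ i` applied to `e`, for each `i <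
  -- k`. First its permutation is chosen, then the colours in `s`.
  obtain ⟨b, hb⟩ := exists_perm_extend (show k ≤ n by omega)
    (fun j : Fin k => (perm x ^ (j : ℕ)) e.1) (by
      intro a b hab
      simp only [Equiv.Perm.coe_pow] at hab
      have h1 := he.1
      exact Fin.ext (Function.iterate_injOn_Iio_minimalPeriod
        (by rw [Set.mem_Iio, h1]; exact a.2) (by rw [Set.mem_Iio, h1]; exact b.2) hab))
  obtain ⟨b', hb'⟩ := theta_surjective n b
  let s : SpinWreath Γ n := ⟨fun l => if (b⁻¹ l : ℕ) < k then (pact (x ^ (b⁻¹ l : ℕ)) e).2 else 1, b'⟩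
  have hs : perm s = b := hb'
  have hse : ∀ i : Fin n, (i : ℕ) < k → pact s (i, 1) = pact (x ^ (i : ℕ)) e := by
    intro i hi
    have h1 : b i = (perm x ^ (i : ℕ)) e.1 := hb ⟨i, hi⟩
    have h2 : s.left (b i) = (pact (x ^ (i : ℕ)) e).2 := by
      simp [s, hi]
    refine Prod.ext ?_ ?_
    · rw [pact_pow_fst, ← h1, ← hs]; rfl
    · change s.left (perm s i) * 1 = _
      rw [hs, h2, mul_one]
  have h0 : pact s (⟨0, by omega⟩, 1) = e := by rw [hse _ hk]; simp
  -- On the first `k` coloured letters, the conjugate of `x` by `s⁻¹` moves as the standard cycle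
  -- does: one step forward, and at the end back to the start with the factor `r`. The quotient
  -- therefore fixes them.
  obtain ⟨y, hy⟩ := exists_emb_of_fix h ((cyc n 0 k r)⁻¹ * (s⁻¹ * x * s)) (by
    intro i hi
    have hx : pact x (pact s (i, 1)) = pact (x ^ ((i : ℕ) + 1)) e := by
      rw [hse i hi, ← pact_mul, ← pow_succ']
    rw [pact_mul, pact_mul, pact_mul, hx, pact_inv_eq, eq_comm, pact_inv_eq]
    by_cases hi' : (i : ℕ) + 1 < k
    · rw [pact_cyc_of_lt hk (by omega) r 1 i ⟨i + 1, by omega⟩ (by omega) (by omega) rfl]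
      exact hse _ hi'
    · rw [pact_cyc_last (a := 0) hk (by omega) r 1 i ⟨0, by omega⟩ (by omega) rfl, mul_one]
      have h3 := pact_smul s ⟨0, by omega⟩ 1 r
      rw [one_mul] at h3
      rw [h3, h0, show (i : ℕ) + 1 = k by omega, he.2])
  refine ⟨s, y, h0, ?_⟩
  rw [← hy]
  group

end Action

/-! ### Standard elements, cycle types, and vanishing at even cycles -/

section Types
variable {Γ : Type u} [Group Γ]

/-! ### Products of block cycles -/

/-- The sum of the parts of a list. -/
def lsum (L : List (Var Γ)) : ℕ := (L.map fun p => (p.1 : ℕ)).sum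

@[simp] lemma lsum_nil : lsum ([] : List (Var Γ)) = 0 := rfl
@[simp] lemma lsum_cons (p : Var Γ) (L : List (Var Γ)) : lsum (p :: L) = p.1 + lsum L := by
  simp [lsum]
lemma lsum_append (L L' : List (Var Γ)) : lsum (L ++ L') = lsum L + lsum L' := by
  simp [lsum]

/-- The product of the standard cycles on consecutive blocks, starting at the letter `a`. -/
def blockEl (n a : ℕ) (L : List (Var Γ)) : SpinWreath Γ n := ⟨blockBase n a L, blockSpin n a L⟩

@[simp] lemma blockEl_nil (n a : ℕ) : blockEl n a ([] : List (Var Γ)) = 1 := rfl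

lemma blockBase_cons {n a : ℕ} (p : Var Γ) (L : List (Var Γ)) (i : Fin n) :
    blockBase n a (p :: L) i =
      if (i : ℕ) = a then Quotient.out p.2 else blockBase n (a + p.1) L i := rfl

lemma blockBase_of_lt {n a : ℕ} (L : List (Var Γ)) (i : Fin n) (hi : (i : ℕ) < a) :
    blockBase n a L i = 1 := by
  induction L generalizing a with
  | nil => rfl
  | cons p L ih =>
    rw [blockBase_cons, if_neg (by omega), ih (by omega)]

/-- The multiplication twists the Γⁿ-part of the second factor by the first cycle, but that part is
1 on all letters before `a + p.1`, and the cycle fixes the letters after them. -/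
lemma blockEl_cons {n a : ℕ} (p : Var Γ) (L : List (Var Γ)) (h : a + p.1 ≤ n) :
    blockEl n a (p :: L) = cyc n a p.1 (Quotient.out p.2) * blockEl n (a + p.1) L := by
  have hk : 0 < (p.1 : ℕ) := p.1.2.pos
  refine SemidirectProduct.ext ?_ rfl
  ext i
  rw [left_mul]
  set σ := perm (cyc n a p.1 (Quotient.out p.2))
  obtain ⟨j, hj⟩ : ∃ j, σ j = i := ⟨σ⁻¹ i, by simp⟩
  have hj' : σ⁻¹ i = j := by rw [← hj]; simp
  rw [hj']
  have hv := perm_cyc hk h (Quotient.out p.2) j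
  change (σ j : ℕ) = _ at hv
  rw [hj] at hv
  change blockBase n a (p :: L) i = (if (i : ℕ) = a then _ else 1) * blockBase n (a + p.1) L j
  rw [blockBase_cons]
  split_ifs with h1
  · have hlt : (j : ℕ) < a + p.1 := by split_ifs at hv <;> omega
    rw [blockBase_of_lt L j hlt, mul_one]
  · rw [one_mul]
    by_cases h2 : (i : ℕ) < a + p.1
    · rw [blockBase_of_lt L i h2, blockBase_of_lt L j]
      split_ifs at hv <;> omega
    · congr 1
      refine Fin.ext ?_
      split_ifs at hv <;> omega

lemma emb_blockEl {a m n b : ℕ} (h : a + m ≤ n) (L : List (Var Γ)) (hb : b + lsum L ≤ m) :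
    emb Γ a m n h (blockEl m b L) = blockEl n (a + b) L := by
  induction L generalizing b with
  | nil => simp
  | cons p L ih =>
    rw [lsum_cons] at hb
    have hk : 0 < (p.1 : ℕ) := p.1.2.pos
    rw [blockEl_cons p L (by omega), blockEl_cons p L (by omega), map_mul,
      emb_cyc hk h (by omega), ih (by omega), add_assoc]

lemma blockEl_append {n a : ℕ} (L L' : List (Var Γ)) (h : a + lsum L ≤ n) :
    blockEl n a (L ++ L') = blockEl n a L * blockEl n (a + lsum L) L' := by
  induction L generalizing a with
  | nil => simp
  | cons p L ih =>
    rw [lsum_cons] at h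
    rw [List.cons_append, blockEl_cons _ _ (by omega), blockEl_cons _ _ (by omega),
      ih (by omega), lsum_cons, mul_assoc, add_assoc]

lemma emb_mul_emb_blockEl {n m N : ℕ} (h : n + m = N) (L L' : List (Var Γ)) (hL : lsum L = n)
    (hL' : lsum L' = m) :
    emb Γ 0 n N (by omega) (blockEl n 0 L) * emb Γ n m N h.le (blockEl m 0 L') =
      blockEl N 0 (L ++ L') := by
  rw [emb_blockEl _ _ (by omega), emb_blockEl _ _ (by omega), blockEl_append _ _ (by omega), hL]
  simp

/-! ### Cycle types -/

lemma minimalPeriod_sameCycle {n : ℕ} {σ : Equiv.Perm (Fin n)} {i j : Fin n}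
    (h : σ.SameCycle i j) : Function.minimalPeriod σ i = Function.minimalPeriod σ j := by
  obtain ⟨k, rfl⟩ := h
  have e := minimalPeriod_conj σ (σ ^ k) i
  rw [(Commute.zpow_self σ k).eq, mul_inv_cancel_right] at e
  exact e.symm

lemma sameCycle_iff_exists_nat {n : ℕ} {σ : Equiv.Perm (Fin n)} {i j : Fin n} :
    σ.SameCycle i j ↔ ∃ t : ℕ, (σ ^ t) i = j :=
  ⟨fun h => by obtain ⟨t, _, ht⟩ := h.exists_pow_eq'; exact ⟨t, ht⟩, fun ⟨t, ht⟩ => ⟨t, by simpa⟩⟩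

section Embedded
variable {m n : ℕ} {w : SpinWreath Γ n} {y : SpinWreath Γ m} {ι : Fin m → Fin n}

/-- `w` restricts to `y` along the injection `ι` of letters. -/
def RestrictsTo (w : SpinWreath Γ n) (y : SpinWreath Γ m) (ι : Fin m → Fin n) : Prop :=
  Function.Injective ι ∧ ∀ j g, pact w (ι j, g) = (ι (pact y (j, g)).1, (pact y (j, g)).2)

lemma RestrictsTo.pow (h : RestrictsTo w y ι) (t : ℕ) : RestrictsTo (w ^ t) (y ^ t) ι := by
  refine ⟨h.1, fun j g => ?_⟩
  induction t with
  | zero => simp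
  | succ t ih =>
    rw [pow_succ', pow_succ', pact_mul, pact_mul, ih, h.2]

lemma RestrictsTo.perm_apply (h : RestrictsTo w y ι) (j : Fin m) : perm w (ι j) = ι (perm y j) :=
  congrArg Prod.fst (h.2 j 1)

lemma RestrictsTo.perm_pow_apply (h : RestrictsTo w y ι) (t : ℕ) (j : Fin m) :
    (perm w ^ t) (ι j) = ι ((perm y ^ t) j) := by
  rw [← perm_pow, ← perm_pow, (h.pow t).perm_apply]

lemma RestrictsTo.minimalPeriod (h : RestrictsTo w y ι) (j : Fin m) :
    Function.minimalPeriod (perm w) (ι j) = Function.minimalPeriod (perm y) j := by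
  refine Function.minimalPeriod_eq_minimalPeriod_iff.mpr fun k => ?_
  rw [Function.IsPeriodicPt, Function.IsPeriodicPt, Function.IsFixedPt, Function.IsFixedPt,
    ← Equiv.Perm.coe_pow, ← Equiv.Perm.coe_pow, h.perm_pow_apply, h.1.eq_iff]

lemma RestrictsTo.cycleClass (h : RestrictsTo w y ι) (j : Fin m) :
    cycleClass w (ι j) = cycleClass y j := by
  rw [cycleClass_eq', cycleClass_eq', h.minimalPeriod]
  set k := Function.minimalPeriod (perm y) j with hk
  have h1 := congrArg Prod.snd ((h.pow k).2 j 1)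
  have h2 : perm (y ^ k) j = j := by rw [perm_pow, hk, perm_pow_fix]
  have h3 : perm (w ^ k) (ι j) = ι j := by rw [(h.pow k).perm_apply, h2]
  simp only [pact, h2, h3, mul_one] at h1
  rw [h1]

lemma RestrictsTo.sameCycle (h : RestrictsTo w y ι) (j : Fin m) (l : Fin n) :
    (perm w).SameCycle (ι j) l ↔ ∃ j', l = ι j' ∧ (perm y).SameCycle j j' := by
  simp only [sameCycle_iff_exists_nat, h.perm_pow_apply]
  constructor
  · rintro ⟨t, rfl⟩
    exact ⟨_, rfl, t, rfl⟩
  · rintro ⟨j', rfl, t, rfl⟩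
    exact ⟨t, rfl⟩

end Embedded

/-- Each factor acts trivially on the letters of the other block, colours included; periods, cycle
classes and cycles of a product are thus read off from the factors. -/
lemma restrictsTo_left {n m N : ℕ} (h : n + m = N) (x : SpinWreath Γ n) (y : SpinWreath Γ m) :
    RestrictsTo (emb Γ 0 n N (by omega) x * emb Γ n m N h.le y) x
      (block 0 n N (by omega)) := by
  refine ⟨(block 0 n N _).injective, fun j g => ?_⟩
  rw [pact_mul, pact_emb_notMem h.le y (by rw [mem_range_block]; simp), pact_emb_block]

lemma restrictsTo_right {n m N : ℕ} (h : n + m = N) (x : SpinWreath Γ n) (y : SpinWreath Γ m) :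
    RestrictsTo (emb Γ 0 n N (by omega) x * emb Γ n m N h.le y) y (block n m N h.le) := by
  refine ⟨(block n m N _).injective, fun j g => ?_⟩
  rw [pact_mul, pact_emb_block, pact_emb_notMem (by omega) x (by rw [mem_range_block]; simp)]

lemma prod_block {M : Type*} [CommMonoid M] {n m N : ℕ} (h : n + m = N) (f : Fin N → M) :
    ∏ i, f i = (∏ i, f (block 0 n N (by omega) i)) * ∏ j, f (block n m N h.le j) := by
  subst h
  rw [Fin.prod_univ_add]
  congr 1
  refine Finset.prod_congr rfl fun i _ => congrArg f (Fin.ext ?_)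
  simp

lemma sum_block {M : Type*} [AddCommMonoid M] {n m N : ℕ} (h : n + m = N) (f : Fin N → M) :
    ∑ i, f i = (∑ i, f (block 0 n N (by omega) i)) + ∑ j, f (block n m N h.le j) := by
  subst h
  rw [Fin.sum_univ_add]
  congr 1
  refine Finset.sum_congr rfl fun i _ => congrArg f (Fin.ext ?_)
  simp

open Classical in
/-- The number of letters on cycles of length `k` with cycle product in `c`. -/
def cnt {n : ℕ} (x : SpinWreath Γ n) (k : ℕ) (c : ConjClasses Γ) : ℕ :=
  ∑ i, if Function.minimalPeriod (perm x) i = k ∧ cycleClass x i = c then 1 else 0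

lemma cnt_conj {n : ℕ} (x s : SpinWreath Γ n) (k : ℕ) (c : ConjClasses Γ) :
    cnt (s * x * s⁻¹) k c = cnt x k c := by
  classical
  refine (Fintype.sum_equiv (perm s) _ _ fun i => ?_).symm
  rw [cycleClass_conj, perm_conj, minimalPeriod_conj]

lemma cycleClass_z_mul [Finite Γ] {n : ℕ} (x : SpinWreath Γ n) (i : Fin n) :
    cycleClass (SuperGroup.z * x) i = cycleClass x i := by
  rw [cycleClass, cycleClass, perm_z_mul, left_z_mul]

lemma cnt_z_mul [Finite Γ] {n : ℕ} (x : SpinWreath Γ n) (k : ℕ) (c : ConjClasses Γ) :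
    cnt (SuperGroup.z * x) k c = cnt x k c := by
  classical
  refine Finset.sum_congr rfl fun i _ => if_congr ?_ rfl rfl
  rw [cycleClass_z_mul, perm_z_mul]

lemma cnt_emb_mul_emb {n m N : ℕ} (h : n + m = N) (x : SpinWreath Γ n) (y : SpinWreath Γ m)
    (k : ℕ) (c : ConjClasses Γ) :
    cnt (emb Γ 0 n N (by omega) x * emb Γ n m N h.le y) k c = cnt x k c + cnt y k c := by
  classical
  have h1 := restrictsTo_left h x y
  have h2 := restrictsTo_right h x y
  rw [cnt, sum_block h]
  simp only [h1.minimalPeriod, h1.cycleClass, h2.minimalPeriod, h2.cycleClass]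
  rfl

lemma isCycleAt_cyc {k : ℕ} (hk : 0 < k) (r : Γ) :
    IsCycleAt (cyc k 0 k r) (⟨0, hk⟩, 1) k r := by
  have := isCycleAt_cyc_mul_emb hk (Nat.add_zero k) r 1
  rwa [map_one, mul_one] at this

lemma sameCycle_cyc {k : ℕ} (hk : 0 < k) (r : Γ) (i : Fin k) :
    (perm (cyc k 0 k r)).SameCycle ⟨0, hk⟩ i := by
  have := pact_cyc_mul_emb_pow hk (Nat.add_zero k) r 1 i i.2
  rw [map_one, mul_one] at this
  refine ⟨(i : ℕ), ?_⟩
  rw [zpow_natCast, ← pact_pow_fst _ _ (⟨0, hk⟩, 1), this]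

open Classical in
lemma cnt_cyc {k : ℕ} (hk : 0 < k) (r : Γ) (k' : ℕ) (c : ConjClasses Γ) :
    cnt (cyc k 0 k r) k' c = if k = k' ∧ ConjClasses.mk r = c then k else 0 := by
  have h0 := isCycleAt_cyc hk r
  have : ∀ i : Fin k, Function.minimalPeriod (perm (cyc k 0 k r)) i = k ∧
      cycleClass (cyc k 0 k r) i = ConjClasses.mk r := fun i =>
    ⟨by rw [← minimalPeriod_sameCycle (sameCycle_cyc hk r i), h0.1],
      by rw [← cycleClass_sameCycle _ (sameCycle_cyc hk r i), h0.cycleClass]⟩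
  simp only [cnt, this]
  rw [Finset.sum_const]
  split_ifs <;> simp

lemma cyc_eq_emb {k n : ℕ} (hk : 0 < k) (h : 0 + k ≤ n) (r : Γ) :
    cyc n 0 k r = emb Γ 0 k n h (cyc k 0 k r) := by
  rw [emb_cyc hk h (by omega)]

open Classical in
/-- The number of letters on the cycles of type `(k, c)` for the parts in a list. -/
def lcount (L : List (Var Γ)) (k : ℕ) (c : ConjClasses Γ) : ℕ :=
  (L.map fun p => if (p.1 : ℕ) = k ∧ p.2 = c then (p.1 : ℕ) else 0).sum

lemma lcount_append (L L' : List (Var Γ)) (k : ℕ) (c : ConjClasses Γ) :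
    lcount (L ++ L') k c = lcount L k c + lcount L' k c := by
  simp [lcount]

lemma lcount_perm {L L' : List (Var Γ)} (h : L.Perm L') : lcount L = lcount L' := by
  ext k c
  exact (h.map _).sum_eq

-- The factor `p.1` appears because letters are counted rather than cycles; it is positive, so
-- multiplicities can be recovered.
open Classical in
lemma lcount_eq (L : List (Var Γ)) (p : Var Γ) :
    lcount L p.1 p.2 = p.1 * L.count p := by
  induction L with
  | nil => simp [lcount]
  | cons q L ih =>
    have : lcount (q :: L) p.1 p.2 = (if q = p then (p.1 : ℕ) else 0) + lcount L p.1 p.2 := by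
      simp only [lcount, List.map_cons, List.sum_cons]
      congr 1
      by_cases h : q = p
      · simp [h]
      · rw [if_neg h, if_neg]
        rintro ⟨h1, h2⟩
        exact h (Prod.ext (Subtype.ext h1) h2)
    rw [this, ih, List.count_cons]
    by_cases h : q = p
    · simp [h]; ring
    · simp [h]

/-- The cycles of `x` have the lengths and classes given by the list. -/
def HasType {n : ℕ} (x : SpinWreath Γ n) (L : List (Var Γ)) : Prop :=
  ∀ k c, cnt x k c = lcount L k c

lemma HasType.conj {n : ℕ} {x : SpinWreath Γ n} {L : List (Var Γ)} (h : HasType x L)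
    (s : SpinWreath Γ n) : HasType (s * x * s⁻¹) L := fun k c => by rw [cnt_conj, h]

lemma HasType.z_mul [Finite Γ] {n : ℕ} {x : SpinWreath Γ n} {L : List (Var Γ)} (h : HasType x L) :
    HasType (SuperGroup.z * x) L := fun k c => by rw [cnt_z_mul, h]

lemma HasType.perm {n : ℕ} {x : SpinWreath Γ n} {L L' : List (Var Γ)} (h : HasType x L)
    (hL : L.Perm L') : HasType x L' := fun k c => by rw [h, lcount_perm hL]

lemma HasType.emb_mul_emb {n m N : ℕ} (h : n + m = N) {x : SpinWreath Γ n} {y : SpinWreath Γ m}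
    {L L' : List (Var Γ)} (hx : HasType x L) (hy : HasType y L') :
    HasType (emb Γ 0 n N (by omega) x * emb Γ n m N h.le y) (L ++ L') := fun k c => by
  rw [cnt_emb_mul_emb h, hx, hy, lcount_append]

lemma hasType_cyc {k : ℕ} (hk : Odd k) (r : Γ) :
    HasType (cyc k 0 k r) [(⟨k, hk⟩, ConjClasses.mk r)] := fun k' c => by
  classical
  rw [cnt_cyc hk.pos]
  simp [lcount]

lemma hasType_blockEl {n : ℕ} (L : List (Var Γ)) (hL : lsum L = n) :
    HasType (blockEl n 0 L) L := by
  induction L generalizing n with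
  | nil =>
    intro k c
    subst hL
    simp [cnt, lcount]
  | cons p L ih =>
    rw [lsum_cons] at hL
    have hk : 0 < (p.1 : ℕ) := p.1.2.pos
    have h1 := HasType.emb_mul_emb hL (hasType_cyc p.1.2 (Quotient.out p.2)) (ih rfl)
    rw [emb_cyc hk _ (by omega), emb_blockEl _ _ (by omega)] at h1
    rw [blockEl_cons p L (by omega)]
    have h2 : ConjClasses.mk (Quotient.out p.2) = p.2 := Quotient.out_eq p.2
    rw [h2] at h1
    simpa using h1

/-- A cycle of odd length is an even element, so no sign arises when it passes an element of the
other block. -/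
lemma emb_comm_cyc [Finite Γ] {k m n : ℕ} (hk : Odd k) (h : k + m = n) (r : Γ)
    (s : SpinWreath Γ m) :
    cyc n 0 k r * emb Γ k m n h.le s = emb Γ k m n h.le s * cyc n 0 k r := by
  rw [cyc_eq_emb hk.pos (by omega), emb_comm h, wsign, if_pos, one_mul]
  exact Or.inl (d_cyc_odd (by omega) hk r)

/-- The cycle type determines an element up to conjugation and multiplication by `z`. -/
lemma HasType.exists_conj [Finite Γ] {n : ℕ} {x : SpinWreath Γ n} {L : List (Var Γ)}
    (h : HasType x L) (hL : lsum L = n) : ∃ s, x = s * blockEl n 0 L * s⁻¹ ∨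
      x = SuperGroup.z * (s * blockEl n 0 L * s⁻¹) := by
  classical
  induction L generalizing n with
  | nil =>
    have hn : n = 0 := hL.symm
    subst hn
    refine ⟨1, ?_⟩
    simpa using eq_or_eq_z_mul (x := x) (y := 1) (Subsingleton.elim _ _) (Subsingleton.elim _ _)
  | cons p L ih =>
    have hk : 0 < (p.1 : ℕ) := p.1.2.pos
    obtain ⟨i, hi1, hi2⟩ : ∃ i, Function.minimalPeriod (SpinWr.perm x) i = p.1 ∧
        cycleClass x i = p.2 := by
      -- Without such a letter the count for the part `p` would be zero, yet `p` occurs in the list.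
      by_contra! hne
      have h1 := h p.1 p.2
      rw [cnt, Finset.sum_eq_zero (fun i _ => if_neg fun hh => hne i hh.1 hh.2), lcount_eq] at h1
      simp at h1
      omega
    have h2 : ConjClasses.mk (Quotient.out p.2) = p.2 := Quotient.out_eq p.2
    obtain ⟨a, ha⟩ := exists_isCycleAt x i (Quotient.out p.2) (by rw [h2, hi2])
    rw [hi1] at ha
    obtain ⟨m, hm⟩ : ∃ m, (p.1 : ℕ) + m = n := ⟨n - p.1, by have := ha.le; omega⟩
    obtain ⟨s, y, -, hx⟩ := exists_split hm ha
    have hy : HasType y L := by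
      intro k c
      have h3 := h k c
      rw [hx, cnt_conj, cyc_eq_emb hk (by omega), cnt_emb_mul_emb hm,
        hasType_cyc p.1.2 (Quotient.out p.2) k c, h2] at h3
      change _ = lcount ([p] ++ L) k c at h3
      rw [lcount_append] at h3
      exact Nat.add_left_cancel h3
    have hb : lsum L = m → cyc n 0 p.1 (Quotient.out p.2) * emb Γ p.1 m n hm.le (blockEl m 0 L) =
        blockEl n 0 (p :: L) := fun hl => by
      rw [emb_blockEl _ _ (by omega), blockEl_cons _ _ (by omega), add_comm 0, add_zero]
    have hl : lsum L = m := by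
      rw [lsum_cons] at hL
      omega
    obtain ⟨t, ht⟩ := ih hy hl
    refine ⟨s * emb Γ p.1 m n hm.le t, ?_⟩
    -- The conjugator found for the remainder is moved past the odd cycle.
    have hc : ∀ w, cyc n 0 p.1 (Quotient.out p.2) * emb Γ p.1 m n hm.le (t * w * t⁻¹) =
        emb Γ p.1 m n hm.le t * (cyc n 0 p.1 (Quotient.out p.2) * emb Γ p.1 m n hm.le w) *
          (emb Γ p.1 m n hm.le t)⁻¹ := by
      intro w
      rw [map_mul, map_mul, map_inv, ← mul_assoc, ← mul_assoc, emb_comm_cyc p.1.2 hm, mul_assoc,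
        mul_assoc, mul_assoc, mul_assoc]
    rcases ht with rfl | rfl
    · left
      rw [hx, hc, hb hl]
      group
    · right
      rw [hx, map_mul, emb_z, ← mul_assoc (cyc _ _ _ _), ← SuperGroup.z_comm, mul_assoc SuperGroup.z,
        hc, hb hl, ← mul_assoc s, ← SuperGroup.z_comm]
      simp only [mul_assoc, mul_inv_rev]

/-- Spin class functions vanish on the elements which have a cycle of even length. -/
lemma RMinus.eq_zero_of_even [Finite Γ] {n : ℕ} (f : RMinus (SpinWreath Γ n)) (x : SpinWreath Γ n)
    (i : Fin n) (hi : Even (Function.minimalPeriod (SpinWr.perm x) i)) : f.1 x = 0 := by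
  rcases Int.units_eq_one_or (SuperGroup.d x) with hd | hd
  swap
  · exact RMinus.odd f hd
  obtain ⟨r, hr⟩ := ConjClasses.exists_rep (cycleClass x i)
  obtain ⟨a, ha⟩ := exists_isCycleAt x i r hr.symm
  set k := Function.minimalPeriod (SpinWr.perm x) i
  have hk := ha.pos
  obtain ⟨m, hm⟩ : ∃ m, k + m = n := ⟨n - k, by have := ha.le; omega⟩
  obtain ⟨s, y, -, hx⟩ := exists_split hm ha
  have hdc := d_cyc_even (show 0 + k ≤ n by omega) hk hi r
  -- `x` is even and its even cycle is an odd element, so the remainder is odd as well.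
  have hdy : SuperGroup.d y = -1 := by
    rw [hx, d_conj, map_mul, d_emb, hdc] at hd
    rwa [neg_one_mul, neg_eq_iff_eq_neg] at hd
  rw [hx, RMinus.conj]
  have h1 := emb_comm hm (cyc k 0 k r) y
  rw [← cyc_eq_emb hk (by omega), d_cyc_even (by omega) hk hi, hdy, wsign, if_neg (by decide)] at h1
  -- The two orders of the product are conjugate by the cycle, and by `h1` they differ by `z`; hence
  -- the value of `f` is its own negative.
  have h2 := RMinus.conj f (emb Γ k m n hm.le y * cyc n 0 k r) (cyc n 0 k r)
  rw [← mul_assoc, mul_inv_cancel_right, h1, RMinus.spin] at h2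
  rw [h1, RMinus.spin]
  linear_combination (1 / 2 : ℂ) * h2

end Types

/-! ### The functions ηₙ(γ) and traces on tensor powers -/

section EtaTrace
variable {Γ : Type u} [Group Γ]

/-! ### The characters `ηₙ(γ)` -/

/-- The letter `i` is the least one on its cycle. -/
def IsLeast {n : ℕ} (σ : Equiv.Perm (Fin n)) (i : Fin n) : Prop := ∀ j, σ.SameCycle i j → i ≤ j

-- Taking the least letter as the representative of each cycle turns the product over cycles into
-- one over letters, which splits along blocks.
open Classical in
lemma eta_eq_prod {n : ℕ} (γ : ClassFn Γ) (x : SpinWreath Γ n) :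
    eta n γ x = ∏ i, if IsLeast (perm x) i then γ (cycleClass x i) else 1 := by
  rw [← Finset.prod_filter, Finset.prod_subtype (p := IsLeast (perm x)) _ (by simp),
    ← finprod_eq_prod_of_fintype, eta]
  symm
  let e : {i // IsLeast (perm x) i} → Quotient (Equiv.Perm.SameCycle.setoid (perm x)) :=
    fun i => Quotient.mk _ i.1
  refine finprod_eq_of_bijective e ⟨?_, ?_⟩ ?_
  · intro i j hij
    have h : (perm x).SameCycle i j := Quotient.exact hij
    exact Subtype.ext (le_antisymm (i.2 _ h) (j.2 _ h.symm))
  · intro o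
    induction o using Quotient.inductionOn with
    | h i =>
      obtain ⟨j, hj, hmin⟩ := Finset.exists_minimal
        (s := Finset.univ.filter fun j => (perm x).SameCycle i j)
        ⟨i, by simpa using Equiv.Perm.SameCycle.refl (perm x) i⟩
      rw [Finset.mem_filter] at hj
      refine ⟨⟨j, fun l hl => ?_⟩, Quotient.sound hj.2.symm⟩
      by_contra hlt
      exact hlt (hmin (by simpa using hj.2.trans hl) (le_of_not_ge hlt))
  · intro i
    refine congrArg γ (cycleClass_sameCycle x ?_)
    exact (Quotient.exact (Quotient.out_eq (e i))).symm

/-- The cycle through `ι j` lies entirely in the image of `ι`, and `ι` preserves the order. -/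
lemma RestrictsTo.isLeast {m n : ℕ} {w : SpinWreath Γ n} {y : SpinWreath Γ m} {ι : Fin m → Fin n}
    (h : RestrictsTo w y ι) (hι : StrictMono ι) (j : Fin m) :
    IsLeast (perm w) (ι j) ↔ IsLeast (perm y) j := by
  constructor
  · intro hl j' hj'
    exact hι.le_iff_le.mp (hl _ ((h.sameCycle _ _).mpr ⟨j', rfl, hj'⟩))
  · intro hl l hl'
    obtain ⟨j', rfl, hj'⟩ := (h.sameCycle _ _).mp hl'
    exact hι.le_iff_le.mpr (hl _ hj')

lemma block_strictMono (a n N : ℕ) (h : a + n ≤ N) : StrictMono (block a n N h) := by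
  intro i j hij
  rw [Fin.lt_def] at *
  simpa

lemma eta_emb_mul_emb {n m N : ℕ} (h : n + m = N) (γ : ClassFn Γ) (x : SpinWreath Γ n)
    (y : SpinWreath Γ m) :
    eta N γ (emb Γ 0 n N (by omega) x * emb Γ n m N h.le y) = eta n γ x * eta m γ y := by
  classical
  have h1 := restrictsTo_left h x y
  have h2 := restrictsTo_right h x y
  rw [eta_eq_prod, eta_eq_prod, eta_eq_prod, prod_block h]
  simp only [h1.cycleClass, h2.cycleClass, h1.isLeast (block_strictMono _ _ _ _),
    h2.isLeast (block_strictMono _ _ _ _)]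

lemma eta_cyc {k : ℕ} (hk : 0 < k) (γ : ClassFn Γ) (r : Γ) :
    eta k γ (cyc k 0 k r) = γ (ConjClasses.mk r) := by
  classical
  rw [eta_eq_prod, Finset.prod_eq_single ⟨0, hk⟩]
  · rw [if_pos (show IsLeast _ _ from fun j _ => Nat.zero_le _), (isCycleAt_cyc hk r).cycleClass]
  · intro i _ hi
    refine if_neg fun hl => hi ?_
    exact le_antisymm (hl _ (sameCycle_cyc hk r i).symm) (Nat.zero_le _)
  · simp

lemma eta_zero (γ : ClassFn Γ) (x : SpinWreath Γ 0) : eta 0 γ x = 1 := by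
  rw [eta_eq_prod]; simp

/-- The class function `x ↦ γ(x⁻¹)`. -/
def dual (γ : ClassFn Γ) : ClassFn Γ := fun c => γ (ConjClasses.mk (Quotient.out c)⁻¹)

lemma dual_mk (γ : ClassFn Γ) (g : Γ) : dual γ (ConjClasses.mk g) = γ (ConjClasses.mk g⁻¹) := by
  have h : ConjClasses.mk (Quotient.out (ConjClasses.mk g)) = ConjClasses.mk g :=
    Quotient.out_eq _
  rw [ConjClasses.mk_eq_mk_iff_isConj, isConj_iff] at h
  obtain ⟨c, hc⟩ := h
  refine congrArg γ ?_
  rw [ConjClasses.mk_eq_mk_iff_isConj, isConj_iff]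
  exact ⟨c, (by group : _ = (c * Quotient.out (ConjClasses.mk g) * c⁻¹)⁻¹).trans (by rw [hc])⟩

/-- The inverse has the same cycles, with inverse cycle products. -/
lemma eta_inv {n : ℕ} (γ : ClassFn Γ) (x : SpinWreath Γ n) :
    eta n γ x⁻¹ = eta n (dual γ) x := by
  classical
  rw [eta_eq_prod, eta_eq_prod]
  refine Finset.prod_congr rfl fun i _ => if_congr ?_ ?_ rfl
  · simp only [IsLeast, perm_inv, Equiv.Perm.sameCycle_inv]
  · have hm : Function.minimalPeriod (perm x⁻¹) i = Function.minimalPeriod (perm x) i := by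
      refine Function.minimalPeriod_eq_minimalPeriod_iff.mpr fun k => ?_
      rw [Function.IsPeriodicPt, Function.IsPeriodicPt, Function.IsFixedPt, Function.IsFixedPt,
        ← Equiv.Perm.coe_pow, ← Equiv.Perm.coe_pow, perm_inv, inv_pow, Equiv.Perm.inv_eq_iff_eq,
        eq_comm]
    rw [cycleClass_eq', cycleClass_eq', dual_mk, hm, inv_pow]
    refine congrArg γ (congrArg ConjClasses.mk ?_)
    set k := Function.minimalPeriod (perm x) i
    have hf : perm (x ^ k) i = i := by rw [perm_pow, perm_pow_fix]
    have h1 : (x ^ k * (x ^ k)⁻¹).left i = 1 := by rw [mul_inv_cancel]; rfl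
    rw [left_mul, Equiv.Perm.inv_eq_iff_eq.mpr hf.symm] at h1
    exact eq_inv_of_mul_eq_one_right h1

/-! ### The trace on the tensor product -/

/-- The matrix of the action on `V^{⊗ n}`. -/
def tensorPowMat {d : ℕ} (A : Γ →* Matrix (Fin d) (Fin d) ℂ) (n : ℕ) (x : SpinWreath Γ n) :
    Matrix (Fin n → Fin d) (Fin n → Fin d) ℂ :=
  fun p q => ∏ i, A (x.left i) (p i) (q ((perm x)⁻¹ i))

lemma tensorPowMat_mul {d : ℕ} (A : Γ →* Matrix (Fin d) (Fin d) ℂ) {n : ℕ}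
    (x y : SpinWreath Γ n) :
    tensorPowMat A n (x * y) = tensorPowMat A n x * tensorPowMat A n y := by
  ext p r
  rw [Matrix.mul_apply]
  simp only [tensorPowMat, left_mul, perm_mul, mul_inv_rev, Equiv.Perm.mul_apply, map_mul,
    Matrix.mul_apply]
  rw [Finset.prod_univ_sum, Fintype.piFinset_univ]
  -- Expanding the product of sums indexes the intermediate vector by the letter `i`, whereas the
  -- matrix product reads it at `(perm x)⁻¹ i`; the reindexing accounts for this.
  refine Fintype.sum_equiv ((perm x).arrowCongr (Equiv.refl (Fin d))).symm _ _ fun q => ?_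
  rw [Finset.prod_mul_distrib]
  congr 1
  · simp
  · refine Fintype.prod_equiv (perm x)⁻¹ _ _ fun i => ?_
    simp

lemma trace_tensorPowMat_conj {d : ℕ} (A : Γ →* Matrix (Fin d) (Fin d) ℂ) {n : ℕ}
    (x s : SpinWreath Γ n) :
    (tensorPowMat A n (s * x * s⁻¹)).trace = (tensorPowMat A n x).trace := by
  rw [tensorPowMat_mul, Matrix.trace_mul_comm, ← tensorPowMat_mul, ← mul_assoc, inv_mul_cancel,
    one_mul]

lemma trace_tensorPowMat_emb {d : ℕ} (A : Γ →* Matrix (Fin d) (Fin d) ℂ) {n m N : ℕ}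
    (h : n + m = N) (x : SpinWreath Γ n) (y : SpinWreath Γ m) :
    (tensorPowMat A N (emb Γ 0 n N (by omega) x * emb Γ n m N h.le y)).trace =
      (tensorPowMat A n x).trace * (tensorPowMat A m y).trace := by
  set w := emb Γ 0 n N (by omega) x * emb Γ n m N h.le y
  have h1 := restrictsTo_left h x y
  have h2 := restrictsTo_right h x y
  have hinv : ∀ {l : ℕ} {v : SpinWreath Γ l} {ι : Fin l → Fin N}, RestrictsTo w v ι →
      ∀ j, (perm w)⁻¹ (ι j) = ι ((perm v)⁻¹ j) ∧ w.left (ι j) = v.left j := by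
    intro l v ι hv j
    have e1 : (perm w)⁻¹ (ι j) = ι ((perm v)⁻¹ j) := by
      rw [Equiv.Perm.inv_eq_iff_eq, hv.perm_apply]; simp
    refine ⟨e1, ?_⟩
    have e2 := congrArg Prod.snd (hv.2 ((perm v)⁻¹ j) 1)
    simpa [pact, hv.perm_apply] using e2
  simp only [Matrix.trace, Matrix.diag, tensorPowMat]
  rw [Finset.sum_mul_sum, ← Finset.sum_product']
  -- A basis vector of the full tensor power is a pair of basis vectors, one for each block.
  let E : (Fin N → Fin d) → (Fin n → Fin d) × (Fin m → Fin d) :=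
    fun p => (p ∘ block 0 n N (by omega), p ∘ block n m N h.le)
  have hE : Function.Bijective E := by
    subst h
    have : E = (Fin.appendEquiv n m).symm := by
      ext p i
      · simp only [E, Fin.appendEquiv, Equiv.coe_fn_symm_mk, Function.comp_apply]
        congr 1
        congr 1
        ext; simp
      · rfl
    rw [this]
    exact Equiv.bijective _
  refine Fintype.sum_bijective E hE _ _ fun p => ?_
  rw [prod_block h]
  simp only [(hinv h1 _).1, (hinv h1 _).2, (hinv h2 _).1, (hinv h2 _).2, E, Function.comp_apply]

/-- Away from the letter 0 the group elements are 1, and the identity matrices there force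
consecutive indices on the diagonal to agree. Only constant index vectors contribute, and they sum
to the trace of `A r`. -/
lemma trace_tensorPowMat_cyc {d : ℕ} (A : Γ →* Matrix (Fin d) (Fin d) ℂ) {k : ℕ} (hk : 0 < k)
    (r : Γ) : (tensorPowMat A k (cyc k 0 k r)).trace = (A r).trace := by
  obtain ⟨k, rfl⟩ : ∃ l, k = l + 1 := ⟨k - 1, by omega⟩
  set σ := perm (cyc (k + 1) 0 (k + 1) r) with hσ
  have hσv : ∀ j, (σ j : ℕ) = _ := perm_cyc hk (by omega) r
  have h0 : σ⁻¹ 0 = Fin.last k := by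
    rw [Equiv.Perm.inv_eq_iff_eq]
    ext
    rw [hσv, if_pos (by simp)]; rfl
  have hs : ∀ i : Fin k, σ⁻¹ i.succ = i.castSucc := by
    intro i
    rw [Equiv.Perm.inv_eq_iff_eq]
    ext
    rw [hσv, if_neg (by simp; omega), if_pos (by simp)]; rfl
  have key : ∀ p : Fin (k + 1) → Fin d, tensorPowMat A (k + 1) (cyc (k + 1) 0 (k + 1) r) p p =
      A r (p 0) (p (Fin.last k)) * ∏ i : Fin k, if p i.succ = p i.castSucc then 1 else 0 := by
    intro p
    rw [tensorPowMat, Fin.prod_univ_succ]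
    simp only [← hσ, h0, hs]
    have : ∀ i : Fin k, (cyc (k + 1) 0 (k + 1) r).left i.succ = 1 := fun i =>
      if_neg (t := r) (show ¬ ((i.succ : Fin (k + 1)) : ℕ) = 0 by simp)
    simp only [this, map_one, Matrix.one_apply]
    rfl
  simp only [Matrix.trace, Matrix.diag, key]
  refine (Finset.sum_of_injOn (fun (q : Fin d) (_ : Fin (k + 1)) => q) ?_ (by simp) ?_ ?_).symm
  · intro a _ b _ hab
    exact congrFun hab 0
  · intro p _ hp
    refine mul_eq_zero_of_right _ ?_
    by_contra hne
    have hne := Finset.prod_ne_zero_iff.mp hne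
    refine hp ⟨p 0, by simp, ?_⟩
    ext i
    congr 1
    induction i using Fin.induction with
    | zero => rfl
    | succ i ih =>
      rw [ih]
      by_contra h
      exact hne i (Finset.mem_univ _) (if_neg (fun h' => h (by rw [h'])))
  · intro q _
    simp

/-- `ηₙ(γ)` is the character of the `n`-th tensor power if `γ` is the character of `V`. -/
lemma trace_tensorPowMat [Finite Γ] {d : ℕ} (A : Γ →* Matrix (Fin d) (Fin d) ℂ) (γ : ClassFn Γ)
    (hγ : ∀ g, γ (ConjClasses.mk g) = (A g).trace) (n : ℕ) (x : SpinWreath Γ n) :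
    (tensorPowMat A n x).trace = eta n γ x := by
  induction n using Nat.strong_induction_on with
  | _ n ih =>
    rcases Nat.eq_zero_or_pos n with rfl | hn
    · rw [eta_zero]
      simp [Matrix.trace, tensorPowMat]
    -- Both sides are invariant under conjugation and multiplicative over blocks, so the cycle
    -- through the letter 0 can be split off.
    · obtain ⟨r, hr⟩ := ConjClasses.exists_rep (cycleClass x ⟨0, hn⟩)
      obtain ⟨a, ha⟩ := exists_isCycleAt x _ r hr.symm
      set k := Function.minimalPeriod (perm x) ⟨0, hn⟩
      have hk := ha.pos
      obtain ⟨m, hm⟩ : ∃ m, k + m = n := ⟨n - k, by have := ha.le; omega⟩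
      obtain ⟨s, y, -, hx⟩ := exists_split hm ha
      rw [hx, trace_tensorPowMat_conj, eta_conj, cyc_eq_emb hk (by omega),
        trace_tensorPowMat_emb A hm, eta_emb_mul_emb hm, trace_tensorPowMat_cyc A hk, eta_cyc hk,
        hγ, ih m (by omega)]

lemma trace_tensorSpinMat [Finite Γ] {d : ℕ} (A : Γ →* Matrix (Fin d) (Fin d) ℂ) (γ : ClassFn Γ)
    (hγ : ∀ g, γ (ConjClasses.mk g) = (A g).trace) (n : ℕ) (x : SpinWreath Γ n) :
    (chi n γ).1 x = (tensorSpinMat A n x).trace := by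
  change eta n γ x * basicChar n x.right = _
  rw [← trace_tensorPowMat A γ hγ, basicChar]
  simp only [Matrix.trace, Matrix.diag, Finset.sum_mul_sum, ← Finset.sum_product']
  rfl

lemma eta_blockEl (γ : ClassFn Γ) {n : ℕ} (L : List (Var Γ)) (hL : lsum L = n) :
    eta n γ (blockEl n 0 L) = (L.map fun p => γ p.2).prod := by
  induction L generalizing n with
  | nil =>
    subst hL
    exact eta_zero _ _
  | cons p L ih =>
    rw [lsum_cons] at hL
    have hk : 0 < (p.1 : ℕ) := p.1.2.pos
    have h1 := eta_emb_mul_emb hL γ (cyc p.1 0 p.1 (Quotient.out p.2)) (blockEl (lsum L) 0 L)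
    rw [emb_cyc hk _ (by omega), emb_blockEl _ _ (by omega), eta_cyc hk, ih rfl] at h1
    have h2 : ConjClasses.mk (Quotient.out p.2) = p.2 := Quotient.out_eq p.2
    rw [blockEl_cons p L (by omega), List.map_cons, List.prod_cons]
    rw [h2] at h1
    simpa using h1

end EtaTrace

/-! ### The basic spin character on odd types -/

section SpinTrace

/-- An involution, up to a scalar, that anticommutes with `cliff k q` and commutes with the other
Clifford generators. -/
def twist (k q : ℕ) : Matrix (SpinIdx k) (SpinIdx k) ℂ := parityMat k * cliff k q

lemma twist_cliff_ne {k p q : ℕ} (hpq : p ≠ q) (hp : p < 2 * k) (hq : q < 2 * k) :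
    Commute (cliff k p) (twist k q) := by
  have h1 := parityMat_cliff hp
  have h2 := cliff_anti hpq hp hq
  change cliff k p * (parityMat k * cliff k q) = parityMat k * cliff k q * cliff k p
  rw [mul_assoc, h2, mul_neg, ← mul_assoc, ← mul_assoc, h1, neg_mul, neg_neg]

lemma twist_cliff_self {k q : ℕ} (hq : q < 2 * k) :
    twist k q * cliff k q = -(cliff k q * twist k q) := by
  rw [twist, mul_assoc, cliff_sq, ← mul_assoc, ← neg_eq_iff_eq_neg.mpr (parityMat_cliff hq), neg_mul,
    mul_assoc, cliff_sq]
  simp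

lemma twist_sq {k q : ℕ} (hq : q < 2 * k) : twist k q * twist k q = 1 := by
  have h : cliff k q * parityMat k = -(parityMat k * cliff k q) := by
    rw [parityMat_cliff hq, neg_neg]
  rw [twist, mul_assoc, ← mul_assoc (cliff k q), h, neg_mul, mul_assoc, cliff_sq]
  simp [parityMat_sq]

/-- Conjugation by `twist k q` preserves the trace and `M` but reverses the sign of `cliff k q`. -/
lemma trace_mul_cliff_eq_zero {k q : ℕ} (hq : q < 2 * k) {M : Matrix (SpinIdx k) (SpinIdx k) ℂ}
    (hM : Commute M (twist k q)) : (M * cliff k q).trace = 0 := by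
  have h : (M * cliff k q).trace = -(M * cliff k q).trace := by
    calc (M * cliff k q).trace = (twist k q * (twist k q * (M * cliff k q))).trace := by
          rw [← mul_assoc, twist_sq hq, one_mul]
      _ = (M * (twist k q * cliff k q) * twist k q).trace := by
          rw [Matrix.trace_mul_comm, ← mul_assoc (twist k q), ← hM.eq]
          simp only [mul_assoc]
      _ = -(M * cliff k q).trace := by
          rw [twist_cliff_self hq, mul_neg, neg_mul, Matrix.trace_neg, mul_assoc, mul_assoc,
            twist_sq hq, mul_one]
  linear_combination h / 2

/-- For `i = 0` the truncated index `i - 1` is 0 and names a wrong generator, but its coefficient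
`coefB 0` vanishes. -/
lemma coefB_smul_cliff_pred {k i : ℕ} {X : Matrix (SpinIdx k) (SpinIdx k) ℂ}
    (h : ∀ p, p < i → Commute (cliff k p) X) : Commute (coefB i • cliff k (i - 1)) X := by
  cases i with
  | zero => rw [coefB_zero, zero_smul]; exact Commute.zero_left _
  | succ i => exact (h i (by omega)).smul_left _

lemma commute_spinT_twist {k i q : ℕ} (hi : i < q) (hq : q < 2 * k) :
    Commute (spinT k i) (twist k q) :=
  ((twist_cliff_ne hi.ne (by omega) hq).smul_left _).sub_left
    (coefB_smul_cliff_pred fun p hp => twist_cliff_ne (by omega) (by omega) hq)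

/-- Only the term with `cliff k b` from both factors survives, since any other leaves an unpaired
Clifford generator. Its coefficient is `-coefA b * coefB (b + 1)`, and with the square -1 of the
generator this gives 1/2 by `coef_mul`. -/
lemma trace_mul_spinT_mul_spinT {k b : ℕ} (hb : b + 1 < 2 * k)
    {M : Matrix (SpinIdx k) (SpinIdx k) ℂ} (hM : Commute M (twist k b))
    (hM' : Commute M (twist k (b + 1))) :
    (M * spinT k b * spinT k (b + 1)).trace = (1 / 2) * M.trace := by
  have h1 : (M * spinT k b * cliff k (b + 1)).trace = 0 :=
    trace_mul_cliff_eq_zero hb (hM'.mul_left (commute_spinT_twist (by omega) hb))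
  have h2 : (M * (coefB b • cliff k (b - 1)) * cliff k b).trace = 0 :=
    trace_mul_cliff_eq_zero (by omega) (hM.mul_left
      (coefB_smul_cliff_pred fun p hp => twist_cliff_ne (by omega) (by omega) (by omega)))
  have h3 : (M * spinT k b * cliff k b).trace = -coefA b * M.trace := by
    rw [spinT, mul_sub, sub_mul, Matrix.trace_sub, h2, sub_zero, mul_smul_comm, smul_mul_assoc,
      mul_assoc, cliff_sq, Matrix.trace_smul, mul_neg, mul_one, Matrix.trace_neg]
    simp
  conv_lhs => rw [spinT.eq_1 k (b + 1)]
  rw [mul_sub, Matrix.trace_sub, mul_smul_comm, mul_smul_comm, Matrix.trace_smul, h1,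
    Matrix.trace_smul, Nat.add_sub_cancel, h3, smul_zero, zero_sub, smul_eq_mul, ← coef_mul b]
  ring

/-- The matrix of an element of `S̃ₙ` on the basic spin module. -/
abbrev spinMat (n : ℕ) (x : SpinSymm n) : Matrix (SpinIdx (n / 2)) (SpinIdx (n / 2)) ℂ :=
  (basicSpin n x : Matrix (SpinIdx (n / 2)) (SpinIdx (n / 2)) ℂ)

lemma spinMat_mul {n : ℕ} (x y : SpinSymm n) : spinMat n (x * y) = spinMat n x * spinMat n y := by
  simp [spinMat]

lemma spinMat_one {n : ℕ} : spinMat n 1 = 1 := by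
  simp [spinMat]

lemma commute_spinMat_word {n a l q : ℕ} (h : a + l ≤ q) (hq : q < 2 * (n / 2)) :
    Commute (spinMat n ((List.range l).map fun i => t n (a + i)).prod) (twist (n / 2) q) := by
  induction l with
  | zero => simp [spinMat_one]
  | succ l ih =>
    rw [List.range_succ, List.map_append, List.prod_append, spinMat_mul]
    refine (ih (by omega)).mul_left ?_
    simp only [List.map_cons, List.map_nil, List.prod_cons, List.prod_nil, mul_one]
    rw [spinMat, basicSpin_t (by omega)]
    exact commute_spinT_twist (by omega) hq

/-- The word is shortened from its end by two generators at a time, each pair contributing 1/2: the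
letters before them involve only earlier Clifford generators and so commute with the twists needed.
-/
lemma trace_mul_spinMat_word {n a l : ℕ} (h : a + 2 * l < n)
    {M : Matrix (SpinIdx (n / 2)) (SpinIdx (n / 2)) ℂ}
    (hM : ∀ q, a ≤ q → q < 2 * (n / 2) → Commute M (twist (n / 2) q)) :
    (M * spinMat n ((List.range (2 * l)).map fun i => t n (a + i)).prod).trace =
      (1 / 2) ^ l * M.trace := by
  induction l with
  | zero => simp [spinMat_one]
  | succ l ih =>
    have hr : List.range (2 * (l + 1)) = List.range (2 * l) ++ [2 * l] ++ [2 * l + 1] := by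
      rw [show 2 * (l + 1) = 2 * l + 1 + 1 by ring, List.range_succ, List.range_succ]
    rw [hr]
    simp only [List.map_append, List.map_cons, List.map_nil, List.prod_append, List.prod_cons,
      List.prod_nil, mul_one]
    have h1 : spinMat n (t n (a + 2 * l)) = spinT (n / 2) (a + 2 * l) := basicSpin_t (by omega)
    have h2 : spinMat n (t n (a + (2 * l + 1))) = spinT (n / 2) (a + 2 * l + 1) := by
      rw [spinMat, basicSpin_t (by omega), add_assoc]
    rw [spinMat_mul, spinMat_mul, h1, h2, ← mul_assoc, ← mul_assoc, trace_mul_spinT_mul_spinT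
      (by omega), ih (by omega), pow_succ]
    · ring
    · exact (hM _ (by omega) (by omega)).mul_left (commute_spinMat_word (by omega) (by omega))
    · exact (hM _ (by omega) (by omega)).mul_left (commute_spinMat_word (by omega) (by omega))

variable {Γ : Type u} [Group Γ]

/-- The power of `z` in the lift is even. -/
lemma liftCycle_odd {n a k : ℕ} (hk : Odd k) :
    liftCycle n a k = ((List.range (k - 1)).map fun i => t n (a + i)).prod := by
  obtain ⟨l, rfl⟩ := hk
  rw [liftCycle, Nat.add_sub_cancel, pow_mul, sq, z_mul_z, one_pow, one_mul]

/-- The first cycle is absorbed into `M`, which keeps commuting with the later twists. A part 2l + 1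
contributes (1/2)^l. The two side claims make the truncated subtraction and the halving exact. -/
lemma trace_mul_blockSpin {n a : ℕ} (L : List (Var Γ)) (h : a + lsum L ≤ n)
    {M : Matrix (SpinIdx (n / 2)) (SpinIdx (n / 2)) ℂ}
    (hM : ∀ q, a ≤ q → q < 2 * (n / 2) → Commute M (twist (n / 2) q)) :
    (M * spinMat n (blockSpin n a L)).trace =
      (1 / 2) ^ ((lsum L - L.length) / 2) * M.trace ∧ Even (lsum L - L.length) ∧
        L.length ≤ lsum L := by
  induction L generalizing a M with
  | nil => simp [blockSpin, spinMat_one]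
  | cons p L ih =>
    obtain ⟨⟨k, l, rfl⟩, c⟩ := p
    rw [lsum_cons] at h ⊢
    simp only at h ⊢
    have hc : liftCycle n a (2 * l + 1) = ((List.range (2 * l)).map fun i => t n (a + i)).prod :=
      liftCycle_odd ⟨l, rfl⟩
    have hb : blockSpin n a ((⟨⟨2 * l + 1, l, rfl⟩, c⟩ : Var Γ) :: L) =
      liftCycle n a (2 * l + 1) * blockSpin n (a + (2 * l + 1)) L := rfl
    obtain ⟨h1, h2, h3⟩ := ih (a := a + (2 * l + 1)) (by omega)
      (M := M * spinMat n (liftCycle n a (2 * l + 1))) (by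
        intro q hq hq'
        rw [hc]
        exact (hM q (by omega) hq').mul_left (commute_spinMat_word (by omega) hq'))
    obtain ⟨e, he⟩ := h2
    refine ⟨?_, ⟨l + e, by rw [List.length_cons]; omega⟩, by rw [List.length_cons]; omega⟩
    rw [hb, spinMat_mul, ← mul_assoc, h1, hc, trace_mul_spinMat_word (by omega) hM, ← mul_assoc,
      ← pow_add]
    congr 2
    rw [List.length_cons]
    omega

/-- The values of the basic spin character on the classes of odd type. -/
lemma basicChar_blockSpin {n : ℕ} (L : List (Var Γ)) (h : lsum L = n) :
    (Real.sqrt 2 : ℂ) ^ (n % 2) * basicChar n (blockSpin n 0 L) = (Real.sqrt 2 : ℂ) ^ L.length := by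
  obtain ⟨h1, ⟨e, h2⟩, h3⟩ := trace_mul_blockSpin (n := n) (a := 0) L (by omega) (M := 1)
    (fun _ _ _ => Commute.one_left _)
  have h4 : basicChar n (blockSpin n 0 L) = (spinMat n (blockSpin n 0 L)).trace := rfl
  rw [one_mul] at h1
  rw [h4, h1, Matrix.trace_one]
  have hs : (Real.sqrt 2 : ℂ) ^ 2 = 2 := by
    rw [← Complex.ofReal_pow, Real.sq_sqrt (by norm_num)]; norm_num
  have h5 : (lsum L - L.length) / 2 = e := by omega
  rw [h5]
  simp only [Fintype.card_fun, Fintype.card_fin, Nat.cast_pow, Nat.cast_ofNat]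
  -- The trace of the identity is 2^{⌊n/2⌋}. Both sides of this equation are `n`, and they are
  -- compared as exponents of √2.
  have h6 : n % 2 + 2 * (n / 2) = 2 * e + L.length := by omega
  have h7 : (Real.sqrt 2 : ℂ) ^ (n % 2) * 2 ^ (n / 2) = 2 ^ e * (Real.sqrt 2 : ℂ) ^ L.length := by
    calc _ = (Real.sqrt 2 : ℂ) ^ (n % 2 + 2 * (n / 2)) := by rw [pow_add, pow_mul, hs]
      _ = _ := by rw [h6, pow_add, pow_mul, hs]
  calc _ = (1 / 2) ^ e * ((Real.sqrt 2 : ℂ) ^ (n % 2) * 2 ^ (n / 2)) := by ring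
    _ = (1 / 2 * 2) ^ e * (Real.sqrt 2 : ℂ) ^ L.length := by rw [h7, mul_pow]; ring
    _ = _ := by norm_num

lemma sqrt_two_ne_zero : (Real.sqrt 2 : ℂ) ≠ 0 := by
  rw [Ne, Complex.ofReal_eq_zero]
  positivity

lemma basicChar_blockSpin_eq {n : ℕ} (L : List (Var Γ)) (h : lsum L = n) :
    basicChar n (blockSpin n 0 L) =
      (Real.sqrt 2 : ℂ) ^ L.length / (Real.sqrt 2 : ℂ) ^ (n % 2) := by
  rw [eq_div_iff (pow_ne_zero _ sqrt_two_ne_zero), mul_comm, basicChar_blockSpin L h]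

lemma basicChar_blockSpin_ne_zero {n : ℕ} (L : List (Var Γ)) (h : lsum L = n) :
    basicChar n (blockSpin n 0 L) ≠ 0 := by
  rw [basicChar_blockSpin_eq L h]
  exact div_ne_zero (pow_ne_zero _ sqrt_two_ne_zero) (pow_ne_zero _ sqrt_two_ne_zero)

lemma tensorMat_conjTranspose {k : ℕ} (M : Fin k → Matrix (Fin 2) (Fin 2) ℂ) :
    (tensorMat M).conjTranspose = tensorMat fun l => (M l).conjTranspose := by
  ext a b
  simp [tensorMat, Matrix.conjTranspose_apply]

lemma cliffFactor_conjTranspose (p l : ℕ) :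
    (cliffFactor p l).conjTranspose = cliffFactor p l := by
  unfold cliffFactor
  split_ifs <;> ext i j <;> fin_cases i <;> fin_cases j <;>
    simp [pauli1, pauli2, pauli3, Matrix.conjTranspose_apply]

lemma cliff_conjTranspose (k p : ℕ) : (cliff k p).conjTranspose = -cliff k p := by
  simp [cliff, Matrix.conjTranspose_smul, tensorMat_conjTranspose, cliffFactor_conjTranspose]

lemma spinT_conjTranspose (k i : ℕ) : (spinT k i).conjTranspose = -spinT k i := by
  simp [spinT, Matrix.conjTranspose_smul, Matrix.conjTranspose_sub, cliff_conjTranspose, coefA,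
    coefB]
  abel

/-- The representation is unitary: the generators act by anti-Hermitian matrices, and the inverse of
a generator, `z` times it, acts by its negative. It follows that the character at inverses is the
complex conjugate. -/
lemma spinMat_conjTranspose {n : ℕ} (x : SpinSymm n) :
    (spinMat n x).conjTranspose = spinMat n x⁻¹ := by
  let H : Subgroup (SpinSymm n) :=
    { carrier := {x | (spinMat n x).conjTranspose = spinMat n x⁻¹}
      one_mem' := by simp [spinMat]
      mul_mem' := by
        intro a b ha hb
        simp only [Set.mem_ofPred_eq] at ha hb ⊢
        rw [spinMat_mul, Matrix.conjTranspose_mul, ha, hb, mul_inv_rev, spinMat_mul]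
      inv_mem' := by
        intro a ha
        simp only [Set.mem_ofPred_eq] at ha ⊢
        rw [← ha, Matrix.conjTranspose_conjTranspose, inv_inv] }
  refine mem_of_gen H ?_ ?_ x
  · change (spinMat n (z n)).conjTranspose = spinMat n (z n)⁻¹
    simp [spinMat, basicSpin]
  · intro i hi
    change (spinMat n (t n i)).conjTranspose = spinMat n (t n i)⁻¹
    rw [t_inv hi, spinMat_mul]
    simp only [spinMat]
    rw [basicSpin_t hi, spinT_conjTranspose]
    simp [basicSpin]

lemma basicChar_inv {n : ℕ} (x : SpinSymm n) : basicChar n x⁻¹ = star (basicChar n x) := by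
  change (spinMat n x⁻¹).trace = star (spinMat n x).trace
  rw [← spinMat_conjTranspose, Matrix.trace_conjTranspose]

lemma basicChar_blockSpin_inv {n : ℕ} (L : List (Var Γ)) (h : lsum L = n) :
    basicChar n (blockSpin n 0 L)⁻¹ = basicChar n (blockSpin n 0 L) := by
  rw [basicChar_inv, basicChar_blockSpin_eq L h]
  simp

end SpinTrace

/-! ### Independence of the order of the blocks -/

section ClassValues
variable {Γ : Type u} [Group Γ]

lemma basicChar_right_conj {n : ℕ} (x s : SpinWreath Γ n) :
    basicChar n (s * x * s⁻¹).right = basicChar n x.right := basicChar_conj x.right s.right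

variable [Finite Γ]

lemma basicChar_right_z_mul {n : ℕ} (x : SpinWreath Γ n) :
    basicChar n (SuperGroup.z * x).right = -basicChar n x.right := basicChar_z x.right

/-- A spin class function takes the same value on all standard elements of the same type. -/
lemma RMinus.blockEl_perm {n : ℕ} (f : RMinus (SpinWreath Γ n)) {L L' : List (Var Γ)}
    (hp : L.Perm L') (hL : lsum L = n) : f.1 (blockEl n 0 L) = f.1 (blockEl n 0 L') := by
  have hL' : lsum L' = n := by rw [← hL]; exact (hp.symm.map _).sum_eq
  obtain ⟨s, h | h⟩ := ((hasType_blockEl L hL).perm hp).exists_conj hL'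
  · rw [h, RMinus.conj]
  -- If the two standard elements differed by `z`, their basic spin characters would be opposite;
  -- but they are equal and nonzero, depending only on the number of parts.
  · exfalso
    have h1 := congrArg (fun w => basicChar n w.right) h
    simp only [basicChar_right_z_mul, basicChar_right_conj] at h1
    change basicChar n (blockSpin n 0 L) = -basicChar n (blockSpin n 0 L') at h1
    rw [basicChar_blockSpin_eq L hL, basicChar_blockSpin_eq L' hL', hp.length_eq] at h1
    have h2 := basicChar_blockSpin_ne_zero L' hL'
    rw [basicChar_blockSpin_eq L' hL'] at h2
    exact h2 (by linear_combination h1 / 2)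

end ClassValues

/-! ### Partition-valued functions and their weights -/

section Combinatorics
variable {Γ : Type u} [Group Γ]

/-- The list of the parts of `ρ`. -/
abbrev OP.parts (ρ : OP Γ) : List (Var Γ) := (Finsupp.toMultiset ρ).toList

lemma OP.sum_map_parts {M : Type*} [AddCommMonoid M] (f : Var Γ → M) (ρ : OP Γ) :
    (ρ.parts.map f).sum = ρ.sum fun p m => m • f p := by
  rw [← Multiset.sum_coe, ← Multiset.map_coe, Multiset.coe_toList]
  induction ρ using Finsupp.induction_linear with
  | zero => simp
  | add ρ τ h1 h2 =>
    rw [map_add, Multiset.map_add, Multiset.sum_add, h1, h2, Finsupp.sum_add_index']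
    · simp
    · intros; rw [add_smul]
  | single p m =>
    rw [Finsupp.toMultiset_single, Multiset.map_nsmul, Multiset.sum_nsmul, Finsupp.sum_single_index]
    · simp
    · simp

lemma OP.prod_map_parts {M : Type*} [CommMonoid M] (f : Var Γ → M) (ρ : OP Γ) :
    (ρ.parts.map f).prod = ρ.prod fun p m => f p ^ m := by
  rw [← Multiset.prod_coe, ← Multiset.map_coe, Multiset.coe_toList]
  induction ρ using Finsupp.induction_linear with
  | zero => simp
  | add ρ τ h1 h2 =>
    rw [map_add, Multiset.map_add, Multiset.prod_add, h1, h2, Finsupp.prod_add_index']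
    · simp
    · intros; rw [pow_add]
  | single p m =>
    rw [Finsupp.toMultiset_single, Multiset.map_nsmul, Multiset.prod_nsmul,
      Finsupp.prod_single_index]
    · simp
    · simp

lemma OP.lsum_parts (ρ : OP Γ) : lsum ρ.parts = ρ.size := by
  rw [lsum, OP.sum_map_parts, OP.size]
  rfl

lemma OP.length_parts (ρ : OP Γ) : ρ.parts.length = ρ.len := by
  rw [Multiset.length_toList, Finsupp.card_toMultiset, OP.len]
  rfl

lemma OP.count_parts [DecidableEq (Var Γ)] (ρ : OP Γ) (p : Var Γ) : ρ.parts.count p = ρ p := by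
  rw [← Multiset.coe_count, Multiset.coe_toList, Finsupp.count_toMultiset]

lemma OP.parts_add (ρ τ : OP Γ) : (ρ + τ).parts.Perm (ρ.parts ++ τ.parts) := by
  rw [← Multiset.coe_eq_coe, ← Multiset.coe_add, Multiset.coe_toList, Multiset.coe_toList,
    Multiset.coe_toList, map_add]

lemma OP.parts_add_single (ρ : OP Γ) (p : Var Γ) :
    (ρ + Finsupp.single p 1).parts.Perm (p :: ρ.parts) := by
  rw [← Multiset.coe_eq_coe, ← Multiset.cons_coe, Multiset.coe_toList, Multiset.coe_toList,
    map_add, Finsupp.toMultiset_single, one_smul, add_comm, Multiset.singleton_add]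

@[simp] lemma OP.size_zero : (0 : OP Γ).size = 0 := Finsupp.sum_zero_index
@[simp] lemma OP.len_zero : (0 : OP Γ).len = 0 := Finsupp.sum_zero_index
@[simp] lemma OP.bigZ_zero : (0 : OP Γ).bigZ = 1 := Finsupp.prod_zero_index

lemma OP.size_add (ρ τ : OP Γ) : (ρ + τ).size = ρ.size + τ.size := by
  simp only [OP.size]
  rw [Finsupp.sum_add_index']
  · simp
  · intros; ring

lemma OP.len_add (ρ τ : OP Γ) : (ρ + τ).len = ρ.len + τ.len := by
  simp only [OP.len]
  rw [Finsupp.sum_add_index']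
  · simp
  · intros; rfl

@[simp] lemma OP.size_single (p : Var Γ) (m : ℕ) : OP.size (Finsupp.single p m) = m * p.1 := by
  rw [OP.size, Finsupp.sum_single_index]; simp

@[simp] lemma OP.len_single (p : Var Γ) (m : ℕ) : OP.len (Finsupp.single p m) = m := by
  rw [OP.len, Finsupp.sum_single_index]; rfl

lemma OP.size_eq_zero {ρ : OP Γ} (h : ρ.size = 0) : ρ = 0 := by
  ext p
  rw [OP.size, Finsupp.sum, Finset.sum_eq_zero_iff] at h
  by_contra hp
  have := h p (Finsupp.mem_support_iff.mpr hp)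
  have hk : 0 < (p.1 : ℕ) := p.1.2.pos
  rw [Nat.mul_eq_zero] at this
  simp at hp
  omega

lemma OP.bigZ_add_single (ρ : OP Γ) (p : Var Γ) :
    (ρ + Finsupp.single p 1).bigZ = ρ.bigZ * (p.1 * zeta p.2 * (ρ p + 1)) := by
  classical
  -- Both weights are written over one common index set, where they differ only in the factor at
  -- `p`.
  have key : ∀ τ : OP Γ, τ.support ⊆ insert p ρ.support →
      τ.bigZ = ∏ q ∈ insert p ρ.support,
        (q.1 : ℕ) ^ τ q * (τ q).factorial * zeta q.2 ^ τ q := fun τ hτ => by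
    rw [OP.bigZ, Finsupp.prod_of_support_subset _ hτ]
    simp
  rw [key ρ (Finset.subset_insert _ _), key (ρ + Finsupp.single p 1) (by
    intro q hq
    have := Finsupp.support_add hq
    rw [Finset.mem_union] at this
    rcases this with h | h
    · exact Finset.mem_insert_of_mem h
    · have := Finsupp.support_single_subset h
      rw [Finset.mem_singleton] at this
      rw [this]; exact Finset.mem_insert_self _ _)]
  rw [← Finset.mul_prod_erase _ _ (Finset.mem_insert_self p _),
    ← Finset.mul_prod_erase (insert p ρ.support) (fun q => (q.1 : ℕ) ^ ρ q * (ρ q).factorial *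
      zeta q.2 ^ ρ q) (Finset.mem_insert_self p _)]
  rw [Finset.prod_congr rfl (g := fun q : Var Γ => (q.1 : ℕ) ^ ρ q * (ρ q).factorial *
      zeta q.2 ^ ρ q)]
  · simp only [Finsupp.add_apply, Finsupp.single_eq_same, Nat.factorial_succ, pow_succ]
    ring
  · intro q hq
    have : q ≠ p := Finset.ne_of_mem_erase hq
    simp [this.symm]

variable [Finite Γ]

instance fintypeConjClasses : Fintype (ConjClasses Γ) := Fintype.ofFinite _

lemma zeta_pos (c : ConjClasses Γ) : 0 < zeta c := Nat.card_pos

lemma zeta_ne_zero (c : ConjClasses Γ) : (zeta c : ℂ) ≠ 0 :=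
  Nat.cast_ne_zero.mpr (zeta_pos c).ne'

lemma OP.bigZ_ne_zero (ρ : OP Γ) : (ρ.bigZ : ℂ) ≠ 0 := by
  rw [Nat.cast_ne_zero, OP.bigZ, Finsupp.prod, Finset.prod_ne_zero_iff]
  intro p _
  have hk : 0 < (p.1 : ℕ) := p.1.2.pos
  have := zeta_pos p.2
  positivity

@[simp] lemma OP.mem_ofSize {n : ℕ} {ρ : OP Γ} : ρ ∈ OP.ofSize Γ n ↔ ρ.size = n := by
  simp [OP.ofSize]

lemma OP.ofSize_zero : OP.ofSize Γ 0 = {0} := by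
  ext ρ
  rw [OP.mem_ofSize, Finset.mem_singleton]
  exact ⟨OP.size_eq_zero, fun h => by rw [h, OP.size_zero]⟩

/-- The odd numbers up to `n`. -/
abbrev oddLe (n : ℕ) : Finset {k : ℕ // Odd k} := (Finset.range (n + 1)).subtype Odd

lemma mem_oddLe {n : ℕ} {k : {k : ℕ // Odd k}} : k ∈ oddLe n ↔ (k : ℕ) ≤ n := by
  simp

lemma sum_range_odd {M : Type*} [AddCommMonoid M] (n : ℕ) (g : {k : ℕ // Odd k} → M) :
    (∑ k ∈ Finset.range (n + 1), if h : Odd k then g ⟨k, h⟩ else 0) = ∑ k ∈ oddLe n, g k := by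
  classical
  rw [← Finset.sum_subset (Finset.filter_subset Odd (Finset.range (n + 1)))]
  · rw [← Finset.sum_subtype_eq_sum_filter]
    refine Finset.sum_congr rfl fun k _ => ?_
    rw [dif_pos k.2]
  · intro k hk hk'
    refine dif_neg fun h => hk' ?_
    rw [Finset.mem_filter]
    exact ⟨hk, h⟩

/-- Counting the letters of a partition-valued function part by part. -/
lemma OP.sum_ofSize {M : Type*} [AddCommGroup M] [Module ℂ M] (n : ℕ) (a : OP Γ → M) :
    (n : ℂ) • ∑ ρ ∈ OP.ofSize Γ n, a ρ = ∑ k ∈ oddLe n, ∑ c : ConjClasses Γ,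
      ∑ ρ ∈ OP.ofSize Γ (n - k),
        ((k : ℕ) * ((ρ (k, c) : ℂ) + 1)) • a (ρ + Finsupp.single (k, c) 1) := by
  classical
  -- The scalar `n` is the sum of all parts of `ρ`. Distributing it amounts to marking a part, and
  -- removing the marked part leaves an element of smaller size.
  have h1 : ∀ ρ ∈ OP.ofSize Γ n, (n : ℂ) • a ρ =
      ∑ p ∈ oddLe n ×ˢ (Finset.univ : Finset (ConjClasses Γ)),
        ((p.1 : ℕ) * (ρ p : ℂ)) • a ρ := by
    intro ρ hρ
    rw [OP.mem_ofSize] at hρ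
    rw [← Finset.sum_smul]
    congr 1
    rw [← hρ, OP.size, Finsupp.sum]
    push_cast
    rw [Finset.sum_subset (s₂ := oddLe ρ.size ×ˢ (Finset.univ : Finset (ConjClasses Γ)))]
    · exact Finset.sum_congr rfl fun p _ => mul_comm _ _
    · intro p hp
      rw [Finset.mem_product, mem_oddLe]
      refine ⟨?_, Finset.mem_univ _⟩
      rw [OP.size]
      refine le_trans ?_ (Finset.single_le_sum (f := fun p : Var Γ => ρ p * (p.1 : ℕ))
        (fun _ _ => Nat.zero_le _) hp)
      exact Nat.le_mul_of_pos_left _ (Nat.pos_of_ne_zero (Finsupp.mem_support_iff.mp hp))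
    · intro p _ hp
      rw [Finsupp.notMem_support_iff.mp hp]
      simp
  rw [Finset.smul_sum, Finset.sum_congr rfl h1, Finset.sum_comm, Finset.sum_product]
  refine Finset.sum_congr rfl fun k hk => Finset.sum_congr rfl fun c _ => ?_
  rw [mem_oddLe] at hk
  symm
  refine Finset.sum_of_injOn (fun ρ => ρ + Finsupp.single (k, c) 1) ?_ ?_ ?_ ?_
  · exact fun a _ b _ h => add_right_cancel h
  · intro ρ hρ
    simp only [Finset.mem_coe, OP.mem_ofSize] at hρ ⊢
    rw [OP.size_add, OP.size_single, hρ]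
    simp only [one_mul]
    omega
  -- If `ρ` does not arise by adding a part (k, c), its multiplicity there is 0 and so is its
  -- weight.
  · intro ρ hρ hρ'
    have : ρ (k, c) = 0 := by
      by_contra hne
      refine hρ' ⟨ρ - Finsupp.single (k, c) 1, ?_, ?_⟩
      · have h2 : ρ - Finsupp.single (k, c) 1 + Finsupp.single (k, c) 1 = ρ :=
          tsub_add_cancel_of_le (Finsupp.single_le_iff.mpr (by omega))
        have h3 := OP.size_add (ρ - Finsupp.single (k, c) 1) (Finsupp.single (k, c) 1)
        rw [h2, OP.size_single] at h3
        simp only [Finset.mem_coe, OP.mem_ofSize] at hρ ⊢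
        simp only [one_mul] at h3
        omega
      · exact tsub_add_cancel_of_le (Finsupp.single_le_iff.mpr (by omega))
    rw [this]
    simp
  · intro ρ _
    simp

end Combinatorics

/-! ### Averages over Γ̃ₙ as sums over odd types -/

section ClassFormula
variable {Γ : Type u} [Group Γ]

lemma emb_injective [Finite Γ] {k m n : ℕ} (h : k + m = n) :
    Function.Injective (emb Γ k m n h.le) := by
  intro y y' e
  have e' : emb Γ 0 k n (by omega) 1 * emb Γ k m n h.le y =
      emb Γ 0 k n (by omega) 1 * emb Γ k m n h.le y' := by rw [e]
  rcases emb_mul_inj h e' with ⟨-, h2⟩ | ⟨h1, -⟩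
  · exact h2.symm
  · exfalso
    have h3 := congrArg SemidirectProduct.right h1
    rw [SemidirectProduct.mul_right] at h3
    exact z_ne_one k (by simpa using h3.symm)

-- The conjugators that bring a given cycle into standard position form one coset of the copy of Γ̃ₘ
-- on the remaining letters. That copy commutes with the odd cycle, so it preserves the condition.
open Classical in
lemma card_split [Finite Γ] {n k m : ℕ} (hk : Odd k) (h : k + m = n) (hn : 0 < n)
    {x : SpinWreath Γ n} {e : Fin n × Γ} {r : Γ} (he : IsCycleAt x e k r) :
    (Finset.univ.filter fun s : SpinWreath Γ n => pact s (⟨0, hn⟩, 1) = e ∧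
      ∃ y, s⁻¹ * x * s = cyc n 0 k r * emb Γ k m n h.le y).card = Nat.card (SpinWreath Γ m) := by
  obtain ⟨s, y, hs, hx⟩ := exists_split h he
  rw [Nat.card_eq_fintype_card, ← Finset.card_univ]
  symm
  refine Finset.card_bij (fun y' _ => s * emb Γ k m n h.le y') ?_ ?_ ?_
  · intro t _
    rw [Finset.mem_filter]
    refine ⟨Finset.mem_univ _, ?_, t⁻¹ * y * t, ?_⟩
    · rw [pact_mul, pact_emb_notMem, hs]
      rw [mem_range_block]
      have := hk.pos
      simp
      omega
    · have hc : (emb Γ k m n h.le t)⁻¹ * cyc n 0 k r = cyc n 0 k r * (emb Γ k m n h.le t)⁻¹ := by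
        rw [inv_mul_eq_iff_eq_mul, ← mul_assoc, ← emb_comm_cyc hk h, mul_inv_cancel_right]
      rw [hx, map_mul, map_mul, map_inv]
      calc _ = ((emb Γ k m n h.le t)⁻¹ * cyc n 0 k r) * emb Γ k m n h.le y *
            emb Γ k m n h.le t := by group
        _ = _ := by rw [hc]; group
  · intro t _ t' _ htt
    exact emb_injective h (mul_left_cancel htt)
  · intro s' hs'
    rw [Finset.mem_filter] at hs'
    obtain ⟨-, hs1, y', hy'⟩ := hs'
    set w := cyc n 0 k r * emb Γ k m n h.le y
    set w' := cyc n 0 k r * emb Γ k m n h.le y' with hw'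
    -- The quotient of two conjugators intertwines the two standard forms and fixes the starting
    -- letter, so it fixes the whole coloured orbit and lies in the second block.
    have hconj : (s⁻¹ * s') * w' = w * (s⁻¹ * s') := by
      rw [← hy', hx]; group
    have hpow : ∀ i : ℕ, (s⁻¹ * s') * w' ^ i = w ^ i * (s⁻¹ * s') := by
      intro i
      have : SemiconjBy (s⁻¹ * s') w' w := hconj
      exact (this.pow_right i).eq
    have h0 : pact (s⁻¹ * s') (⟨0, hn⟩, 1) = (⟨0, hn⟩, 1) := by
      rw [pact_mul, hs1, pact_inv_eq]
      exact hs
    obtain ⟨t, ht⟩ := exists_emb_of_fix h (s⁻¹ * s') (by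
      intro i hi
      have h1 := pact_cyc_mul_emb_pow hk.pos h r y i hi
      have h2 := pact_cyc_mul_emb_pow hk.pos h r y' i hi
      calc pact (s⁻¹ * s') (i, 1) = pact (s⁻¹ * s') (pact (w' ^ (i : ℕ)) (⟨0, hn⟩, 1)) := by
            rw [h2]
        _ = pact (w ^ (i : ℕ)) (pact (s⁻¹ * s') (⟨0, hn⟩, 1)) := by
            rw [← pact_mul, hpow, pact_mul]
        _ = (i, 1) := by rw [h0, h1])
    exact ⟨t, Finset.mem_univ _, by rw [← ht]; group⟩

lemma isCycleAt_of_split [Finite Γ] {n k m : ℕ} (hk : 0 < k) (h : k + m = n) (hn : 0 < n)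
    {x s : SpinWreath Γ n} {e : Fin n × Γ} {r : Γ} (hs : pact s (⟨0, hn⟩, 1) = e)
    {y : SpinWreath Γ m} (hy : s⁻¹ * x * s = cyc n 0 k r * emb Γ k m n h.le y) :
    IsCycleAt x e k r := by
  have h1 := (isCycleAt_cyc_mul_emb hk h r y).conj s
  rw [← hy, hs] at h1
  have h2 : s * (s⁻¹ * x * s) * s⁻¹ = x := by group
  rwa [h2] at h1

open Classical in
/-- Double counting of the splittings of the elements into a cycle and a remainder. -/
lemma sum_isCycleAt [Finite Γ] [Fintype Γ] {n k m : ℕ} (hk : Odd k) (h : k + m = n) (r : Γ)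
    (F : SpinWreath Γ n → ℂ) (hF : ∀ x s, F (s * x * s⁻¹) = F x) :
    (Nat.card (SpinWreath Γ m) : ℂ) *
        ∑ x, ∑ e : Fin n × Γ, (if IsCycleAt x e k r then F x else 0) =
      Nat.card (SpinWreath Γ n) * ∑ y, F (cyc n 0 k r * emb Γ k m n h.le y) := by
  have hn : 0 < n := by have := hk.pos; omega
  let P : SpinWreath Γ n → SpinWreath Γ n → Prop := fun s x =>
    ∃ y, s⁻¹ * x * s = cyc n 0 k r * emb Γ k m n h.le y
  -- The number of splittings is |Γ̃ₘ| whenever `e` is a cycle point of the right kind, and 0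
  -- otherwise; so each term becomes a sum over conjugators `s`.
  have h1 : ∀ x (e : Fin n × Γ), (Nat.card (SpinWreath Γ m) : ℂ) *
      (if IsCycleAt x e k r then F x else 0) =
      ∑ s, if pact s (⟨0, hn⟩, 1) = e ∧ P s x then F x else 0 := by
    intro x e
    rw [← Finset.sum_filter, Finset.sum_const, nsmul_eq_mul]
    split_ifs with he
    · rw [card_split hk h hn he]
    · rw [Finset.filter_eq_empty_iff.mpr]
      · simp
      · rintro s _ ⟨hs, y, hy⟩
        exact he (isCycleAt_of_split hk.pos h hn hs hy)
  have h2 : ∀ x s, (∑ e : Fin n × Γ, if pact s (⟨0, hn⟩, 1) = e ∧ P s x then F x else 0) =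
      if P s x then F x else 0 := by
    intro x s
    rw [Finset.sum_eq_single (pact s (⟨0, hn⟩, 1))]
    · simp
    · intro e _ he
      exact if_neg fun hh => he hh.1.symm
    · simp
  -- Since `F` is a class function, the sum for `s` equals the one for 1, which runs over the
  -- products of the standard cycle with elements of Γ̃ₘ.
  have h3 : ∀ s, (∑ x, if P s x then F x else 0) =
      ∑ y, F (cyc n 0 k r * emb Γ k m n h.le y) := by
    intro s
    have h4 : (∑ x, if P s x then F x else 0) = ∑ x, if P 1 x then F x else 0 := by
      refine Fintype.sum_equiv (MulAut.conj s⁻¹).toEquiv _ _ fun x => ?_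
      have : (MulAut.conj s⁻¹).toEquiv x = s⁻¹ * x * s⁻¹⁻¹ := rfl
      rw [this, hF]
      simp [P]
    rw [h4, ← Finset.sum_filter]
    symm
    refine Finset.sum_bij (fun y _ => cyc n 0 k r * emb Γ k m n h.le y) ?_ ?_ ?_ ?_
    · intro y _
      rw [Finset.mem_filter]
      exact ⟨Finset.mem_univ _, y, by simp⟩
    · intro y _ y' _ hyy
      exact emb_injective h (mul_left_cancel hyy)
    · intro x hx
      rw [Finset.mem_filter] at hx
      obtain ⟨-, y, hy⟩ := hx
      exact ⟨y, Finset.mem_univ _, by rw [← hy]; simp⟩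
    · intros; rfl
  simp only [Finset.mul_sum, h1]
  rw [Finset.sum_congr rfl fun x _ => Finset.sum_comm, Finset.sum_comm]
  simp only [h2, h3, Finset.sum_const, nsmul_eq_mul, Finset.card_univ, ← Nat.card_eq_fintype_card]
  rw [Finset.mul_sum]

/-- Orbit-stabilizer for conjugation. -/
lemma card_class_mul_zeta [Finite Γ] (c : ConjClasses Γ) :
    Nat.card {g : Γ // ConjClasses.mk g = c} * zeta c = Nat.card Γ := by
  have h1 : ConjClasses.mk (Quotient.out c) = c := Quotient.out_eq c
  rw [zeta, Subgroup.nat_card_centralizer_nat_card_stabilizer]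
  have h2 := MulAction.index_stabilizer (ConjAct Γ) (Quotient.out c : Γ)
  have h3 := Subgroup.card_mul_index (MulAction.stabilizer (ConjAct Γ) (Quotient.out c : Γ))
  rw [h2, ConjAct.orbit_eq_carrier_conjClasses, h1] at h3
  have h4 : Nat.card {g : Γ // ConjClasses.mk g = c} = c.carrier.ncard := by
    rw [← Nat.card_coe_set_eq]
    exact Nat.card_congr (Equiv.subtypeEquivRight fun g => ConjClasses.mem_carrier_iff_mk_eq.symm)
  rw [h4, mul_comm]
  exact h3

lemma sum_mk [Finite Γ] [Fintype Γ] (g : ConjClasses Γ → ℂ) :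
    ∑ r : Γ, g (ConjClasses.mk r) = Nat.card Γ * ∑ c, (zeta c : ℂ)⁻¹ * g c := by
  classical
  rw [← Finset.sum_fiberwise (s := Finset.univ) (g := ConjClasses.mk (α := Γ)), Finset.mul_sum]
  refine Finset.sum_congr rfl fun c _ => ?_
  rw [Finset.sum_congr rfl (g := fun _ => g c), Finset.sum_const, nsmul_eq_mul, ← mul_assoc]
  · congr 1
    rw [eq_mul_inv_iff_mul_eq₀ (zeta_ne_zero c), ← card_class_mul_zeta c, Nat.cast_mul,
      Nat.card_eq_fintype_card, Fintype.card_subtype]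
  · intro r hr
    rw [(Finset.mem_filter.mp hr).2]

lemma classRep_eq (n : ℕ) (ρ : OP Γ) : classRep n ρ = blockEl n 0 ρ.parts := rfl

lemma IsCycleAt.eq_right {n : ℕ} {x : SpinWreath Γ n} {e : Fin n × Γ} {k k' : ℕ} {r r' : Γ}
    (h : IsCycleAt x e k r) (h' : IsCycleAt x e k' r') : k = k' ∧ r = r' := by
  have hk : k = k' := h.1.symm.trans h'.1
  subst hk
  refine ⟨rfl, ?_⟩
  have := congrArg Prod.snd (h.2.symm.trans h'.2)
  exact mul_left_cancel this

/-- The class formula for functions supported on the elements all of whose cycles are odd. -/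
lemma avg_eq_sum_classRep [Finite Γ] {n : ℕ} (F : SpinWreath Γ n → ℂ)
    (hF : ∀ x s, F (s * x * s⁻¹) = F x) (hz : ∀ x, F (SuperGroup.z * x) = F x)
    (he : ∀ x i, Even (Function.minimalPeriod (perm x) i) → F x = 0) :
    (Nat.card (SpinWreath Γ n) : ℂ)⁻¹ * ∑ x, F x =
      ∑ ρ ∈ OP.ofSize Γ n, (ρ.bigZ : ℂ)⁻¹ * F (classRep n ρ) := by
  classical
  obtain ⟨_⟩ := nonempty_fintype Γ
  have hcard : ∀ l, (Nat.card (SpinWreath Γ l) : ℂ) ≠ 0 := fun l =>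
    Nat.cast_ne_zero.mpr Nat.card_pos.ne'
  induction n using Nat.strong_induction_on with
  | _ n ih =>
  have htype : ∀ x y : SpinWreath Γ n, ∀ L : List (Var Γ), HasType x L → lsum L = n →
      HasType y L → F x = F y := by
    have hb : ∀ x : SpinWreath Γ n, ∀ L : List (Var Γ), HasType x L → lsum L = n →
        F x = F (blockEl n 0 L) := by
      intro x L hx hL
      obtain ⟨s, h | h⟩ := hx.exists_conj hL
      · rw [h, hF]
      · rw [h, hz, hF]
    intro x y L hx hL hy
    rw [hb x L hx hL, hb y L hy hL]
  rcases Nat.eq_zero_or_pos n with rfl | hn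
  · rw [OP.ofSize_zero, Finset.sum_singleton, OP.bigZ_zero]
    have : ∀ x : SpinWreath Γ 0, F x = F (classRep 0 0) := by
      intro x
      refine htype _ _ [] ?_ rfl ?_ <;> intro k c <;> simp [cnt, lcount]
    simp only [this]
    rw [Finset.sum_const, nsmul_eq_mul, Finset.card_univ, ← Nat.card_eq_fintype_card, ← mul_assoc,
      inv_mul_cancel₀ (hcard 0)]
    simp
  -- The inductive hypothesis is applied to `F` after multiplication by a standard cycle. This
  -- function inherits the three assumptions on `F`; invariance under conjugation uses that the
  -- cycle is odd.
  have step : ∀ (k : {k : ℕ // Odd k}) (r : Γ), k ∈ oddLe n →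
      ∑ x, ∑ e : Fin n × Γ, (if IsCycleAt x e k r then F x else 0) =
      Nat.card (SpinWreath Γ n) * ∑ ρ ∈ OP.ofSize Γ (n - k), (ρ.bigZ : ℂ)⁻¹ *
        F (classRep n (ρ + Finsupp.single (k, ConjClasses.mk r) 1)) := by
    intro k r hk
    rw [mem_oddLe] at hk
    have hk0 := k.2.pos
    have hm : (k : ℕ) + (n - k) = n := by omega
    have h1 := sum_isCycleAt k.2 hm r F hF
    have h2 := ih (n - k) (by omega) (fun y => F (cyc n 0 k r * emb Γ k (n - k) n hm.le y))
      (by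
        intro y s
        rw [map_mul, map_mul, map_inv, ← mul_assoc, ← mul_assoc, emb_comm_cyc k.2 hm,
          mul_assoc (emb Γ k (n - k) n hm.le s), hF])
      (by
        intro y
        rw [map_mul, emb_z, ← mul_assoc, ← SuperGroup.z_comm, mul_assoc, hz])
      (by
        intro y i hi
        refine he _ (block k (n - k) n hm.le i) ?_
        have h3 := restrictsTo_right hm (cyc k 0 k r) y
        rw [← cyc_eq_emb hk0 (by omega)] at h3
        rw [h3.minimalPeriod]
        exact hi)
    rw [inv_mul_eq_iff_eq_mul₀ (hcard _)] at h2
    rw [h2, mul_left_comm] at h1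
    rw [mul_left_cancel₀ (hcard _) h1]
    congr 1
    refine Finset.sum_congr rfl fun ρ hρ => ?_
    congr 1
    rw [OP.mem_ofSize] at hρ
    have h4 := HasType.emb_mul_emb hm (hasType_cyc k.2 r)
      (hasType_blockEl ρ.parts (by rw [OP.lsum_parts, hρ]))
    rw [← cyc_eq_emb hk0 (by omega)] at h4
    have h5 : lsum (ρ + Finsupp.single (k, ConjClasses.mk r) 1).parts = n := by
      rw [OP.lsum_parts, OP.size_add, hρ, OP.size_single, one_mul]
      exact Nat.sub_add_cancel hk
    refine htype _ _ _ (h4.perm (OP.parts_add_single ρ (k, ConjClasses.mk r)).symm) h5 ?_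
    exact hasType_blockEl _ h5
  -- Every coloured letter of `x` has exactly one cycle length and one factor `r`. If that length is
  -- even, `F x` is 0, so odd lengths suffice.
  have total : (n : ℂ) * Nat.card Γ * ∑ x, F x = ∑ k ∈ oddLe n, ∑ r : Γ,
      ∑ x, ∑ e : Fin n × Γ, (if IsCycleAt x e k r then F x else 0) := by
    have h1 : ∀ x (e : Fin n × Γ),
        ∑ k ∈ oddLe n, ∑ r : Γ, (if IsCycleAt x e k r then F x else 0) = F x := by
      intro x e
      rcases Nat.even_or_odd (Function.minimalPeriod (perm x) e.1) with hev | hodd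
      · rw [he x e.1 hev]
        simp
      · obtain ⟨r, hr⟩ : ∃ r, IsCycleAt x e (Function.minimalPeriod (perm x) e.1) r :=
          ⟨e.2⁻¹ * ((x ^ Function.minimalPeriod (perm x) e.1).left e.1 * e.2),
            (isCycleAt_iff _ _ _ _).mpr ⟨rfl, by simp⟩⟩
        rw [Finset.sum_eq_single ⟨_, hodd⟩, Finset.sum_eq_single r, if_pos hr]
        · exact fun r' _ hne => if_neg fun h' => hne (h'.eq_right hr).2
        · simp
        · exact fun k' _ hne => Finset.sum_eq_zero fun r' _ =>
            if_neg fun h' => hne (Subtype.ext (h'.eq_right hr).1)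
        · intro hmem
          exact absurd (mem_oddLe.mpr (minimalPeriod_le (perm x) e.1)) hmem
    calc (n : ℂ) * Nat.card Γ * ∑ x, F x = ∑ x, ∑ e : Fin n × Γ, F x := by
          simp only [Finset.sum_const, nsmul_eq_mul, ← Finset.mul_sum, Finset.card_univ,
            Fintype.card_prod, Fintype.card_fin, Nat.card_eq_fintype_card, Nat.cast_mul]
      _ = ∑ x, ∑ e : Fin n × Γ,
            ∑ k ∈ oddLe n, ∑ r : Γ, (if IsCycleAt x e k r then F x else 0) := by
          simp only [h1]
      _ = _ := by
          rw [Finset.sum_congr rfl fun x _ => Finset.sum_comm, Finset.sum_comm]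
          refine Finset.sum_congr rfl fun k _ => ?_
          rw [Finset.sum_congr rfl fun x _ => Finset.sum_comm, Finset.sum_comm]
  have hΓ : (Nat.card Γ : ℂ) ≠ 0 := Nat.cast_ne_zero.mpr Nat.card_pos.ne'
  have hn' : (n : ℂ) ≠ 0 := Nat.cast_ne_zero.mpr hn.ne'
  have h2 := OP.sum_ofSize n fun ρ : OP Γ => (ρ.bigZ : ℂ)⁻¹ * F (classRep n ρ)
  rw [Finset.sum_congr rfl fun k hk => Finset.sum_congr rfl fun r _ => step k r hk] at total
  simp only [← Finset.mul_sum] at total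
  -- Summing over `r` by classes brings in |Γ| / ζ_c; adding the part (k, c) multiplies Z_ρ by k ζ_c
  -- (m + 1), which yields the weights of `OP.sum_ofSize`.
  have h3 : ∀ k : {k : ℕ // Odd k}, (∑ r : Γ, ∑ ρ ∈ OP.ofSize Γ (n - k), (ρ.bigZ : ℂ)⁻¹ *
        F (classRep n (ρ + Finsupp.single (k, ConjClasses.mk r) 1))) = Nat.card Γ *
      ∑ c : ConjClasses Γ, ∑ ρ ∈ OP.ofSize Γ (n - k), ((k : ℕ) * ((ρ (k, c) : ℂ) + 1)) •
        (((ρ + Finsupp.single (k, c) 1).bigZ : ℂ)⁻¹ *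
          F (classRep n (ρ + Finsupp.single (k, c) 1))) := by
    intro k
    rw [sum_mk fun c => ∑ ρ ∈ OP.ofSize Γ (n - k), (ρ.bigZ : ℂ)⁻¹ *
        F (classRep n (ρ + Finsupp.single (k, c) 1))]
    congr 1
    refine Finset.sum_congr rfl fun c _ => ?_
    rw [Finset.mul_sum]
    refine Finset.sum_congr rfl fun ρ _ => ?_
    have e1 := OP.bigZ_ne_zero ρ
    have e2 := zeta_ne_zero c
    have e3 : ((k : ℕ) : ℂ) ≠ 0 := Nat.cast_ne_zero.mpr k.2.pos.ne'
    have e4 : (ρ (k, c) : ℂ) + 1 ≠ 0 := Nat.cast_add_one_ne_zero _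
    rw [OP.bigZ_add_single, smul_eq_mul]
    push_cast
    field_simp
  simp only [h3, ← Finset.mul_sum] at total
  rw [← h2, smul_eq_mul] at total
  rw [inv_mul_eq_iff_eq_mul₀ (hcard n)]
  refine mul_left_cancel₀ (mul_ne_zero hn' hΓ) ?_
  rw [total]
  ring

end ClassFormula

/-! ### The characteristic map: bijectivity and multiplicativity -/

section Characteristic
variable {Γ : Type u} [Group Γ]

lemma classRep_right (n : ℕ) (ρ : OP Γ) : (classRep n ρ).right = blockSpin n 0 ρ.parts := rfl

lemma basicChar_classRep (ρ : OP Γ) {n : ℕ} (h : ρ.size = n) :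
    (Real.sqrt 2 : ℂ) ^ (n % 2) * basicChar n (classRep n ρ).right =
      (Real.sqrt 2 : ℂ) ^ ρ.len := by
  rw [classRep_right, basicChar_blockSpin _ (by rw [OP.lsum_parts, h]), OP.length_parts]

lemma basicChar_classRep_ne_zero (ρ : OP Γ) {n : ℕ} (h : ρ.size = n) :
    basicChar n (classRep n ρ).right ≠ 0 :=
  basicChar_blockSpin_ne_zero _ (by rw [OP.lsum_parts, h])

lemma hasType_classRep (ρ : OP Γ) {n : ℕ} (h : ρ.size = n) : HasType (classRep n ρ) ρ.parts :=
  hasType_blockEl _ (by rw [OP.lsum_parts, h])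

lemma hasType_classRep_iff (ρ τ : OP Γ) {n : ℕ} (h : τ.size = n) :
    HasType (classRep n τ) ρ.parts ↔ τ = ρ := by
  classical
  constructor
  · intro h1
    ext p
    have h2 := (hasType_classRep τ h p.1 p.2).symm.trans (h1 p.1 p.2)
    rw [lcount_eq, lcount_eq] at h2
    have h3 := Nat.eq_of_mul_eq_mul_left p.1.2.pos h2
    have e1 := OP.count_parts ρ p
    have e2 := OP.count_parts τ p
    rw [← e1, ← e2]
    convert h3
  · rintro rfl
    exact hasType_classRep τ h

variable [Finite Γ]

lemma card_wreath_ne_zero (n : ℕ) : (Nat.card (SpinWreath Γ n) : ℂ) ≠ 0 :=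
  Nat.cast_ne_zero.mpr Nat.card_pos.ne'

/-- The basic spin character vanishes on odd elements but not here. -/
lemma d_classRep (ρ : OP Γ) {n : ℕ} (h : ρ.size = n) : SuperGroup.d (classRep n ρ) = 1 := by
  rcases Int.units_eq_one_or (SuperGroup.d (classRep n ρ)) with hd | hd
  · exact hd
  · exact absurd (basicChar_odd hd) (basicChar_classRep_ne_zero ρ h)

open Classical in
/-- The restriction of the basic spin character to the elements of a given type. -/
def typeChar (n : ℕ) (ρ : OP Γ) : RMinus (SpinWreath Γ n) :=
  ⟨fun x => if HasType x ρ.parts then basicChar n x.right else 0, by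
    refine ⟨fun x y => ?_, fun x => ?_, fun x hx => ?_⟩
    · refine if_congr ⟨fun h => ?_, fun h => h.conj y⟩ (basicChar_right_conj x y) rfl
      have h2 : x = y⁻¹ * (y * x * y⁻¹) * y⁻¹⁻¹ := by group
      rw [h2]
      exact h.conj y⁻¹
    · change ite _ _ _ = - ite _ _ _
      rw [apply_ite Neg.neg, neg_zero]
      refine if_congr ⟨fun h => ?_, fun h => h.z_mul⟩ (basicChar_right_z_mul x) rfl
      have h2 : x = SuperGroup.z * (SuperGroup.z * x) := by
        rw [← mul_assoc, SuperGroup.z_sq, one_mul]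
      rw [h2]
      exact h.z_mul
    · change ite _ _ _ = _
      split_ifs
      · exact basicChar_odd hx
      · rfl⟩

lemma typeChar_classRep (ρ τ : OP Γ) {n : ℕ} (h : τ.size = n) [Decidable (τ = ρ)] :
    (typeChar n ρ).1 (classRep n τ) = if τ = ρ then basicChar n (classRep n ρ).right else 0 := by
  classical
  have : (typeChar n ρ).1 (classRep n τ) =
    if HasType (classRep n τ) ρ.parts then basicChar n (classRep n τ).right else 0 := rfl
  rw [this]
  split_ifs with h1 h2 h2
  · rw [h2]
  · exact absurd ((hasType_classRep_iff ρ τ h).mp h1) h2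
  · exact absurd ((hasType_classRep_iff ρ τ h).mpr h2) h1
  · rfl

/-- A spin class function is determined by its values on the classes of odd type. -/
lemma RMinus.eq_zero {n : ℕ} (f : RMinus (SpinWreath Γ n))
    (h : ∀ ρ : OP Γ, ρ.size = n → f.1 (classRep n ρ) = 0) : f = 0 := by
  -- The class formula for |f|² makes a sum of nonnegative numbers vanish. The function satisfies
  -- its assumptions: the two signs under `z` cancel, and it vanishes at even cycles.
  have h1 := avg_eq_sum_classRep (fun x => f.1 x * star (f.1 x))
    (fun x s => by rw [RMinus.conj]) (fun x => by rw [RMinus.spin]; simp)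
    (fun x i hi => by rw [RMinus.eq_zero_of_even f x i hi, zero_mul])
  rw [Finset.sum_eq_zero (s := OP.ofSize Γ n)] at h1
  · replace h1 := (mul_eq_zero.mp h1).resolve_left (inv_ne_zero (card_wreath_ne_zero n))
    have h2 : ∑ x, ‖f.1 x‖ ^ 2 = (0 : ℝ) := by
      have h3 : ((∑ x, ‖f.1 x‖ ^ 2 : ℝ) : ℂ) = 0 := by
        rw [← h1]
        push_cast
        refine Finset.sum_congr rfl fun x _ => ?_
        exact (Complex.mul_conj' (f.1 x)).symm
      exact_mod_cast h3
    rw [Finset.sum_eq_zero_iff_of_nonneg (fun x _ => by positivity)] at h2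
    ext x
    simpa using h2 x (Finset.mem_univ x)
  · intro ρ hρ
    rw [h ρ (OP.mem_ofSize.mp hρ)]
    simp

open Classical in
lemma coeff_chN {n : ℕ} (f : RMinus (SpinWreath Γ n)) (ρ : OP Γ) :
    MvPolynomial.coeff ρ (chN n f) = if ρ.size = n then
      (Real.sqrt 2 : ℂ) ^ ρ.len / (ρ.bigZ : ℂ) * f.1 (classRep n ρ) else 0 := by
  have h : chN n f = ∑ ρ ∈ OP.ofSize Γ n,
    ((Real.sqrt 2 : ℂ) ^ ρ.len / (ρ.bigZ : ℂ) * f.1 (classRep n ρ)) • ρ.mono := rfl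
  rw [h, MvPolynomial.coeff_sum]
  simp only [MvPolynomial.coeff_smul, OP.mono, MvPolynomial.coeff_monomial, smul_eq_mul, mul_ite,
    mul_one, mul_zero]
  rw [Finset.sum_ite_eq']
  simp

lemma ch_lof {n : ℕ} (f : RMinus (SpinWreath Γ n)) :
    ch Γ (DirectSum.lof ℂ ℕ (fun k => RMinus (SpinWreath Γ k)) n f) = chN n f := by
  rw [ch, DirectSum.toModule_lof]

lemma coeff_ch (f : RGamma Γ) (ρ : OP Γ) :
    MvPolynomial.coeff ρ (ch Γ f) =
      (Real.sqrt 2 : ℂ) ^ ρ.len / (ρ.bigZ : ℂ) * (f ρ.size).1 (classRep ρ.size ρ) := by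
  classical
  induction f using DirectSum.induction_on with
  | zero => simp
  | of n f =>
    have := ch_lof f
    rw [DirectSum.lof_eq_of] at this
    rw [this, coeff_chN]
    split_ifs with h
    · subst h
      rw [DirectSum.of_eq_same]
    · rw [DirectSum.of_eq_of_ne _ _ _ h]
      simp
  | add f g hf hg =>
    rw [map_add, MvPolynomial.coeff_add, hf, hg, DirectSum.add_apply, Submodule.coe_add,
      Pi.add_apply, mul_add]

lemma chCoeff_ne_zero (ρ : OP Γ) : (Real.sqrt 2 : ℂ) ^ ρ.len / (ρ.bigZ : ℂ) ≠ 0 :=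
  div_ne_zero (pow_ne_zero _ sqrt_two_ne_zero) ρ.bigZ_ne_zero

lemma ch_injective : Function.Injective (ch Γ) := by
  intro f g hfg
  refine DFinsupp.ext fun n => ?_
  refine sub_eq_zero.mp (RMinus.eq_zero (f n - g n) fun ρ hρ => ?_)
  subst hρ
  have h := coeff_ch f ρ
  rw [hfg, coeff_ch g ρ] at h
  exact sub_eq_zero.mpr (mul_left_cancel₀ (chCoeff_ne_zero ρ) h).symm

open Classical in
lemma ch_typeChar (ρ : OP Γ) :
    ch Γ (DirectSum.lof ℂ ℕ (fun k => RMinus (SpinWreath Γ k)) ρ.size (typeChar ρ.size ρ)) =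
      ((Real.sqrt 2 : ℂ) ^ ρ.len / (ρ.bigZ : ℂ) * basicChar ρ.size (classRep ρ.size ρ).right) •
        MvPolynomial.monomial ρ 1 := by
  refine MvPolynomial.ext _ _ fun (τ : OP Γ) => ?_
  rw [ch_lof, coeff_chN, MvPolynomial.coeff_smul, MvPolynomial.coeff_monomial]
  split_ifs with h1 h2 h2
  · subst h2
    rw [typeChar_classRep _ _ rfl, if_pos rfl, smul_eq_mul, mul_one]
  · rw [typeChar_classRep _ _ h1, if_neg fun h => h2 h.symm]
    simp
  · exact absurd (by rw [h2]) h1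
  · simp

/-- By `ch_typeChar` every monomial is, up to a nonzero scalar, the image of a basic spin character
restricted to one type. -/
lemma ch_surjective : Function.Surjective (ch Γ) := by
  rw [← LinearMap.range_eq_top, eq_top_iff]
  intro q _
  rw [MvPolynomial.as_sum q]
  refine Submodule.sum_mem _ fun (ρ : OP Γ) _ => ?_
  rw [← mul_one (MvPolynomial.coeff ρ q), ← smul_eq_mul, ← MvPolynomial.smul_monomial]
  refine Submodule.smul_mem _ _ ?_
  have hne := mul_ne_zero (chCoeff_ne_zero ρ) (basicChar_classRep_ne_zero ρ rfl)
  refine ⟨((Real.sqrt 2 : ℂ) ^ ρ.len / (ρ.bigZ : ℂ) *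
    basicChar ρ.size (classRep ρ.size ρ).right)⁻¹ • DirectSum.lof ℂ ℕ
      (fun k => RMinus (SpinWreath Γ k)) ρ.size (typeChar ρ.size ρ), ?_⟩
  rw [map_smul, ch_typeChar, smul_smul, inv_mul_cancel₀ hne, one_smul]

/-- The characteristic map as a linear equivalence. -/
def chEquiv (Γ : Type u) [Group Γ] [Finite Γ] : RGamma Γ ≃ₗ[ℂ] Fock Γ :=
  LinearEquiv.ofBijective (ch Γ) ⟨ch_injective, ch_surjective⟩

lemma chEquiv_apply (f : RGamma Γ) : chEquiv Γ f = ch Γ f := rfl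

/-! ### Sums over products of blocks -/

lemma RMinus.classRep_add {n m N : ℕ} (h : n + m = N) (φ : RMinus (SpinWreath Γ N)) {ρ τ : OP Γ}
    (hρ : ρ.size = n) (hτ : τ.size = m) :
    φ.1 (emb Γ 0 n N (by omega) (classRep n ρ) * emb Γ n m N h.le (classRep m τ)) =
      φ.1 (classRep N (ρ + τ)) := by
  rw [classRep_eq, classRep_eq, emb_mul_emb_blockEl h _ _ (by rw [OP.lsum_parts, hρ])
    (by rw [OP.lsum_parts, hτ]), classRep_eq]
  refine RMinus.blockEl_perm φ (OP.parts_add ρ τ).symm ?_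
  rw [lsum_append, OP.lsum_parts, OP.lsum_parts, hρ, hτ, h]

lemma emb_comm_of_even {n m N : ℕ} (h : n + m = N) (x : SpinWreath Γ n) (y : SpinWreath Γ m)
    (hd : SuperGroup.d x = 1 ∨ SuperGroup.d y = 1) :
    emb Γ 0 n N (by omega) x * emb Γ n m N h.le y =
      emb Γ n m N h.le y * emb Γ 0 n N (by omega) x := by
  rw [emb_comm h, wsign, if_pos hd, one_mul]

/-- The class formula applies in the first block because an even `y` commutes with it, so
conjugation there extends to the whole product; the signs of `f` and `φ` under `z` cancel. -/
lemma avg_left {n m N : ℕ} (h : n + m = N) (f : RMinus (SpinWreath Γ n))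
    (φ : RMinus (SpinWreath Γ N)) (y : SpinWreath Γ m) (hy : SuperGroup.d y = 1) :
    (Nat.card (SpinWreath Γ n) : ℂ)⁻¹ *
        ∑ x, f.1 x * φ.1 (emb Γ 0 n N (by omega) x * emb Γ n m N h.le y) =
      ∑ ρ ∈ OP.ofSize Γ n, (ρ.bigZ : ℂ)⁻¹ * (f.1 (classRep n ρ) *
        φ.1 (emb Γ 0 n N (by omega) (classRep n ρ) * emb Γ n m N h.le y)) := by
  have h0 : 0 + n ≤ N := by omega
  refine avg_eq_sum_classRep
    (fun x => f.1 x * φ.1 (emb Γ 0 n N h0 x * emb Γ n m N h.le y)) ?_ ?_ ?_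
  · intro x s
    have e : emb Γ 0 n N h0 (s * x * s⁻¹) * emb Γ n m N h.le y =
        emb Γ 0 n N h0 s * (emb Γ 0 n N h0 x * emb Γ n m N h.le y) * (emb Γ 0 n N h0 s)⁻¹ := by
      rw [← map_inv, mul_assoc, mul_assoc, mul_assoc, ← emb_comm_of_even h s⁻¹ y (Or.inr hy)]
      simp only [map_mul, mul_assoc]
    rw [RMinus.conj, e, RMinus.conj φ]
  · intro x
    rw [RMinus.spin, map_mul, emb_z, mul_assoc, RMinus.spin, neg_mul_neg]
  · intro x i hi
    rw [RMinus.eq_zero_of_even f x i hi, zero_mul]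

lemma avg_right {n m N : ℕ} (h : n + m = N) (g : RMinus (SpinWreath Γ m))
    (φ : RMinus (SpinWreath Γ N)) (x : SpinWreath Γ n) (hx : SuperGroup.d x = 1) :
    (Nat.card (SpinWreath Γ m) : ℂ)⁻¹ *
        ∑ y, g.1 y * φ.1 (emb Γ 0 n N (by omega) x * emb Γ n m N h.le y) =
      ∑ τ ∈ OP.ofSize Γ m, (τ.bigZ : ℂ)⁻¹ * (g.1 (classRep m τ) *
        φ.1 (emb Γ 0 n N (by omega) x * emb Γ n m N h.le (classRep m τ))) := by
  have h0 : 0 + n ≤ N := by omega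
  refine avg_eq_sum_classRep
    (fun y => g.1 y * φ.1 (emb Γ 0 n N h0 x * emb Γ n m N h.le y)) ?_ ?_ ?_
  · intro y s
    have e : emb Γ 0 n N h0 x * emb Γ n m N h.le (s * y * s⁻¹) =
        emb Γ n m N h.le s * (emb Γ 0 n N h0 x * emb Γ n m N h.le y) * (emb Γ n m N h.le s)⁻¹ := by
      rw [← map_inv, ← mul_assoc, ← emb_comm_of_even h x s (Or.inl hx)]
      simp only [map_mul, mul_assoc]
    rw [RMinus.conj, e, RMinus.conj φ]
  · intro y
    rw [RMinus.spin, map_mul, emb_z, ← mul_assoc, ← SuperGroup.z_comm, mul_assoc, RMinus.spin,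
      neg_mul_neg]
  · intro x i hi
    rw [RMinus.eq_zero_of_even g x i hi, zero_mul]

lemma avg_avg {n m N : ℕ} (h : n + m = N) (f : RMinus (SpinWreath Γ n))
    (g : RMinus (SpinWreath Γ m)) (φ : RMinus (SpinWreath Γ N)) :
    (Nat.card (SpinWreath Γ n) : ℂ)⁻¹ * (Nat.card (SpinWreath Γ m) : ℂ)⁻¹ *
        ∑ x, ∑ y, f.1 x * g.1 y * φ.1 (emb Γ 0 n N (by omega) x * emb Γ n m N h.le y) =
      ∑ ρ ∈ OP.ofSize Γ n, ∑ τ ∈ OP.ofSize Γ m, (ρ.bigZ : ℂ)⁻¹ * (τ.bigZ : ℂ)⁻¹ *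
        (f.1 (classRep n ρ) * g.1 (classRep m τ) * φ.1 (classRep N (ρ + τ))) := by
  have h0 : 0 + n ≤ N := by omega
  have h1 : ∀ y, g.1 y * ((Nat.card (SpinWreath Γ n) : ℂ)⁻¹ *
      ∑ x, f.1 x * φ.1 (emb Γ 0 n N h0 x * emb Γ n m N h.le y)) =
      g.1 y * ∑ ρ ∈ OP.ofSize Γ n, (ρ.bigZ : ℂ)⁻¹ * (f.1 (classRep n ρ) *
        φ.1 (emb Γ 0 n N h0 (classRep n ρ) * emb Γ n m N h.le y)) := by
    intro y
    -- For odd `y` the block formula is not available, but `g` vanishes there.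
    rcases Int.units_eq_one_or (SuperGroup.d y) with hy | hy
    · rw [avg_left h f φ y hy]
    · rw [RMinus.odd g hy, zero_mul, zero_mul]
  calc _ = (Nat.card (SpinWreath Γ m) : ℂ)⁻¹ * ∑ y, g.1 y * ((Nat.card (SpinWreath Γ n) : ℂ)⁻¹ *
      ∑ x, f.1 x * φ.1 (emb Γ 0 n N h0 x * emb Γ n m N h.le y)) := by
        rw [Finset.sum_comm]
        simp only [Finset.mul_sum]
        refine Finset.sum_congr rfl fun y _ => Finset.sum_congr rfl fun x _ => ?_
        ring
    _ = ∑ ρ ∈ OP.ofSize Γ n, (ρ.bigZ : ℂ)⁻¹ * f.1 (classRep n ρ) *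
          ((Nat.card (SpinWreath Γ m) : ℂ)⁻¹ * ∑ y, g.1 y *
            φ.1 (emb Γ 0 n N h0 (classRep n ρ) * emb Γ n m N h.le y)) := by
        rw [Finset.sum_congr rfl fun y _ => h1 y]
        simp only [Finset.mul_sum]
        rw [Finset.sum_comm]
        refine Finset.sum_congr rfl fun y _ => Finset.sum_congr rfl fun x _ => ?_
        ring
    _ = _ := by
        refine Finset.sum_congr rfl fun ρ hρ => ?_
        rw [OP.mem_ofSize] at hρ
        rw [avg_right h g φ _ (d_classRep ρ hρ), Finset.mul_sum]
        refine Finset.sum_congr rfl fun τ hτ => ?_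
        rw [OP.mem_ofSize] at hτ
        rw [RMinus.classRep_add h φ hρ hτ]
        ring

/-! ### Induction products -/

/-- Frobenius reciprocity: conjugating the summation variable by `s` makes all terms of the
induction formula equal. -/
lemma sum_indFun_mul {G : Type*} [Group G] [SuperGroup G] (H : Subgroup G)
    [Fact (SuperGroup.z ∈ H)] (F : H → ℂ) (φ : G → ℂ) (hφ : ∀ x s, φ (s * x * s⁻¹) = φ x) :
    ∑ w, indFun H F w * φ w =
      Nat.card G * ((Nat.card H : ℂ)⁻¹ * ∑ h : H, F h * φ h) := by
  have h1 : ∀ s : G, ∑ w, zeroExt H F (s⁻¹ * w * s) * φ w = ∑ h : H, F h * φ h := by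
    intro s
    have h2 : ∑ w, zeroExt H F (s⁻¹ * w * s) * φ w = ∑ w, zeroExt H F w * φ w := by
      refine Fintype.sum_equiv (MulAut.conj s⁻¹).toEquiv _ _ fun w => ?_
      have : (MulAut.conj s⁻¹).toEquiv w = s⁻¹ * w * s⁻¹⁻¹ := rfl
      rw [this, hφ, inv_inv]
    rw [h2]
    symm
    refine Finset.sum_of_injOn (fun h : H => (h : G)) (fun a _ b _ h => Subtype.ext h) (by simp) ?_ ?_
    · intro w _ hw
      rw [zeroExt, dif_neg, zero_mul]
      exact fun h => hw ⟨⟨w, h⟩, by simp, rfl⟩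
    · intro h _
      rw [zeroExt, dif_pos h.2]
  calc ∑ w, indFun H F w * φ w
      = (Nat.card H : ℂ)⁻¹ * ∑ w, ∑ s : G, zeroExt H F (s⁻¹ * w * s) * φ w := by
        rw [Finset.mul_sum]
        refine Finset.sum_congr rfl fun w _ => ?_
        rw [indFun, mul_assoc, Finset.sum_mul]
    _ = (Nat.card H : ℂ)⁻¹ * ∑ s : G, ∑ h : H, F h * φ h := by
        rw [Finset.sum_comm, Finset.sum_congr rfl fun s _ => h1 s]
    _ = _ := by
        rw [Finset.sum_const, nsmul_eq_mul, Finset.card_univ, ← Nat.card_eq_fintype_card]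
        ring

/-- Multiplication of the two blocks is two-to-one by `emb_mul_inj`; the fibre of xy is {(x, y),
(zx, zy)}. -/
lemma sum_spinProd {n m N : ℕ} (h : n + m = N) (Ψ : spinProd Γ n m N h → ℂ) :
    ∑ x, ∑ y, Ψ ⟨_, mul_mem_spinProd h x y⟩ = 2 * ∑ w, Ψ w := by
  have : DecidableEq (spinProd Γ n m N h) := Classical.decEq _
  have : DecidableEq (SpinWreath Γ n × SpinWreath Γ m) := Classical.decEq _
  have h0 : ∑ x, ∑ y, Ψ ⟨_, mul_mem_spinProd h x y⟩ =
      ∑ w, ∑ p ∈ (Finset.univ ×ˢ Finset.univ).filter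
        (fun p : SpinWreath Γ n × SpinWreath Γ m =>
          (⟨_, mul_mem_spinProd h p.1 p.2⟩ : spinProd Γ n m N h) = w),
        Ψ ⟨_, mul_mem_spinProd h p.1 p.2⟩ := by
    rw [← Finset.sum_product', Finset.sum_fiberwise]
  rw [h0, Finset.mul_sum]
  refine Finset.sum_congr rfl fun w _ => ?_
  rw [Finset.sum_congr rfl (g := fun _ => Ψ w) (fun p hp => by
    rw [← (Finset.mem_filter.mp hp).2]), Finset.sum_const, nsmul_eq_mul]
  congr 1
  obtain ⟨w, x, y, rfl⟩ := w
  have hz : x ≠ SuperGroup.z * x := by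
    intro hx
    have h3 := congrArg SemidirectProduct.right hx
    rw [SemidirectProduct.mul_right] at h3
    exact z_ne_one n (by simpa using h3)
  have : (Finset.univ ×ˢ Finset.univ).filter (fun p : SpinWreath Γ n × SpinWreath Γ m =>
        (⟨_, mul_mem_spinProd h p.1 p.2⟩ : spinProd Γ n m N h) =
          ⟨_, mul_mem_spinProd h x y⟩) =
      {(x, y), (SuperGroup.z * x, SuperGroup.z * y)} := by
    ext p
    simp only [Finset.mem_filter, Finset.mem_product, Finset.mem_univ, true_and,
      Finset.mem_insert, Finset.mem_singleton]
    constructor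
    · intro hp
      rcases emb_mul_inj h (congrArg Subtype.val hp).symm with ⟨h1, h2⟩ | ⟨h1, h2⟩
      · exact Or.inl (Prod.ext h1 h2)
      · exact Or.inr (Prod.ext h1 h2)
    · rintro (rfl | rfl)
      · rfl
      · refine Subtype.ext ?_
        simp only [map_mul, emb_z]
        rw [mul_assoc, ← mul_assoc _ SuperGroup.z, ← SuperGroup.z_comm, ← mul_assoc, ← mul_assoc,
          SuperGroup.z_sq, one_mul]
  refine (congrArg (fun s : Finset _ => (s.card : ℂ)) this).trans ?_
  rw [Finset.card_pair]
  · norm_num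
  · exact fun h => hz (congrArg Prod.fst h)

lemma card_spinProd {n m N : ℕ} (h : n + m = N) :
    (Nat.card (SpinWreath Γ n) : ℂ) * Nat.card (SpinWreath Γ m) =
      2 * Nat.card (spinProd Γ n m N h) := by
  have := sum_spinProd (Γ := Γ) h fun _ => 1
  simpa [Nat.card_eq_fintype_card] using this

/-- Frobenius reciprocity followed by the class formula in both blocks. The factor 2 of
`sum_spinProd` cancels against the order of the spin product. -/
lemma sum_ind_outer {n m N : ℕ} (h : n + m = N) (f : RMinus (SpinWreath Γ n))
    (g : RMinus (SpinWreath Γ m)) (φ : RMinus (SpinWreath Γ N)) :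
    (Nat.card (SpinWreath Γ N) : ℂ)⁻¹ * ∑ w, (ind (spinProd Γ n m N h) (outer h f g)).1 w * φ.1 w =
      ∑ ρ ∈ OP.ofSize Γ n, ∑ τ ∈ OP.ofSize Γ m, (ρ.bigZ : ℂ)⁻¹ * (τ.bigZ : ℂ)⁻¹ *
        (f.1 (classRep n ρ) * g.1 (classRep m τ) * φ.1 (classRep N (ρ + τ))) := by
  rw [← avg_avg h]
  have h1 := sum_indFun_mul (spinProd Γ n m N h) (outer h f g).1 φ.1 (fun x s => RMinus.conj φ x s)
  have h2 : ∑ w, (ind (spinProd Γ n m N h) (outer h f g)).1 w * φ.1 w =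
    ∑ w, indFun (spinProd Γ n m N h) (outer h f g).1 w * φ.1 w := rfl
  have h3 := sum_spinProd h fun w => (outer h f g).1 w * φ.1 w
  have h4 : ∀ x y, (outer h f g).1 ⟨_, mul_mem_spinProd h x y⟩ = f.1 x * g.1 y := fun x y =>
    outerFun_mul h f g x y _ rfl
  simp only [h4] at h3
  rw [h2, h1, ← mul_assoc, inv_mul_cancel₀ (card_wreath_ne_zero N), one_mul, h3, ← mul_inv,
    card_spinProd h]
  rw [mul_inv]
  ring

/-- The characteristic map sends induction products to products. -/
lemma chN_ind_outer {n m N : ℕ} (h : n + m = N) (f : RMinus (SpinWreath Γ n))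
    (g : RMinus (SpinWreath Γ m)) :
    chN N (ind (spinProd Γ n m N h) (outer h f g)) = chN n f * chN m g := by
  classical
  set F := ind (spinProd Γ n m N h) (outer h f g)
  -- Pairing with `typeChar N σ` isolates the type σ on both sides, and the nonzero character value
  -- is cancelled.
  have key : ∀ σ : OP Γ, σ.size = N → (σ.bigZ : ℂ)⁻¹ * F.1 (classRep N σ) =
      ∑ ρ ∈ OP.ofSize Γ n, ∑ τ ∈ OP.ofSize Γ m, (ρ.bigZ : ℂ)⁻¹ * (τ.bigZ : ℂ)⁻¹ *
        (f.1 (classRep n ρ) * g.1 (classRep m τ) * if ρ + τ = σ then 1 else 0) := by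
    intro σ hσ
    have h1 := sum_ind_outer h f g (typeChar N σ)
    rw [avg_eq_sum_classRep (fun w => F.1 w * (typeChar N σ).1 w)
      (fun x s => by rw [RMinus.conj, RMinus.conj])
      (fun x => by rw [RMinus.spin, RMinus.spin, neg_mul_neg])
      (fun x i hi => by rw [RMinus.eq_zero_of_even F x i hi, zero_mul]),
      Finset.sum_eq_single σ] at h1
    · rw [typeChar_classRep σ σ hσ, if_pos rfl] at h1
      refine mul_right_cancel₀ (basicChar_classRep_ne_zero σ hσ) ?_
      rw [mul_assoc, h1, Finset.sum_mul]
      refine Finset.sum_congr rfl fun ρ hρ => ?_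
      rw [Finset.sum_mul]
      refine Finset.sum_congr rfl fun τ hτ => ?_
      rw [OP.mem_ofSize] at hρ hτ
      rw [typeChar_classRep σ (ρ + τ) (by rw [OP.size_add, hρ, hτ, h])]
      split_ifs <;> ring
    · intro τ hτ hne
      rw [typeChar_classRep σ τ (OP.mem_ofSize.mp hτ), if_neg hne]
      simp
    · intro hmem
      exact absurd (OP.mem_ofSize.mpr hσ) hmem
  have e1 : chN N F = ∑ σ ∈ OP.ofSize Γ N,
    ((Real.sqrt 2 : ℂ) ^ σ.len / (σ.bigZ : ℂ) * F.1 (classRep N σ)) • σ.mono := rfl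
  have e2 : chN n f = ∑ σ ∈ OP.ofSize Γ n,
    ((Real.sqrt 2 : ℂ) ^ σ.len / (σ.bigZ : ℂ) * f.1 (classRep n σ)) • σ.mono := rfl
  have e3 : chN m g = ∑ σ ∈ OP.ofSize Γ m,
    ((Real.sqrt 2 : ℂ) ^ σ.len / (σ.bigZ : ℂ) * g.1 (classRep m σ)) • σ.mono := rfl
  rw [e1, e2, e3, Finset.sum_mul_sum]
  have e4 : ∀ σ ∈ OP.ofSize Γ N,
      ((Real.sqrt 2 : ℂ) ^ σ.len / (σ.bigZ : ℂ) * F.1 (classRep N σ)) • σ.mono =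
      ∑ ρ ∈ OP.ofSize Γ n, ∑ τ ∈ OP.ofSize Γ m, if ρ + τ = σ then
        ((Real.sqrt 2 : ℂ) ^ ρ.len / (ρ.bigZ : ℂ) * f.1 (classRep n ρ)) • ρ.mono *
        ((Real.sqrt 2 : ℂ) ^ τ.len / (τ.bigZ : ℂ) * g.1 (classRep m τ)) • τ.mono else 0 := by
    intro σ hσ
    rw [div_eq_mul_inv, mul_assoc, key σ (OP.mem_ofSize.mp hσ), Finset.mul_sum, Finset.sum_smul]
    refine Finset.sum_congr rfl fun ρ _ => ?_
    rw [Finset.mul_sum, Finset.sum_smul]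
    refine Finset.sum_congr rfl fun τ _ => ?_
    split_ifs with h1
    · have h2 : σ.mono = ρ.mono * τ.mono := by
        rw [OP.mono, OP.mono, OP.mono, MvPolynomial.monomial_mul, h1, one_mul]
      -- The number of parts is additive, so the normalization 2^{l/2} is multiplicative.
      rw [h2, smul_mul_smul_comm, ← h1, OP.len_add, pow_add]
      congr 1
      ring
    · simp
  rw [Finset.sum_congr rfl e4, Finset.sum_comm]
  refine Finset.sum_congr rfl fun ρ hρ => ?_
  rw [Finset.sum_comm]
  refine Finset.sum_congr rfl fun τ hτ => ?_
  rw [OP.mem_ofSize] at hρ hτ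
  rw [Finset.sum_ite_eq, if_pos (by rw [OP.mem_ofSize, OP.size_add, hρ, hτ, h])]

lemma ch_Hup (γ : ClassFn Γ) (n : ℕ) (q : RGamma Γ) :
    ch Γ (Hup γ n q) = chN n (chiNorm n γ) * ch Γ q := by
  induction q using DirectSum.induction_on with
  | zero => simp
  | of m f =>
    have h1 := ch_lof f
    rw [DirectSum.lof_eq_of] at h1
    rw [h1, ← chN_ind_outer rfl, ← ch_lof, Hup, ← DirectSum.lof_eq_of ℂ, DirectSum.toModule_lof]
    rfl
  | add f g hf hg => rw [map_add, map_add, map_add, hf, hg, mul_add]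

end Characteristic

/-! ### Values of χₙ(γ), and the operators H_n(γ) in the monomial basis -/

section Contraction
variable {Γ : Type u} [Group Γ]

lemma eta_mul {n : ℕ} (α γ : ClassFn Γ) (x : SpinWreath Γ n) :
    eta n α x * eta n γ x = eta n (α * γ) x := by
  classical
  rw [eta_eq_prod, eta_eq_prod, eta_eq_prod, ← Finset.prod_mul_distrib]
  refine Finset.prod_congr rfl fun i _ => ?_
  split_ifs
  · rfl
  · rw [one_mul]

lemma eta_classRep (γ : ClassFn Γ) (ρ : OP Γ) {n : ℕ} (h : ρ.size = n) :
    eta n γ (classRep n ρ) = ρ.prod fun p m => γ p.2 ^ m := by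
  rw [classRep_eq, eta_blockEl _ _ (by rw [OP.lsum_parts, h])]
  exact OP.prod_map_parts (fun p => γ p.2) ρ

lemma classElt_self (c : ConjClasses Γ) : classElt c c = (zeta c : ℂ) := by
  classical exact Pi.single_eq_same _ _

lemma classElt_of_ne {b c : ConjClasses Γ} (h : b ≠ c) : classElt c b = 0 := by
  classical exact Pi.single_eq_of_ne h _

variable [Finite Γ]

lemma chiNorm_apply (n : ℕ) (γ : ClassFn Γ) (x : SpinWreath Γ n) :
    (chiNorm n γ).1 x = (Real.sqrt 2 : ℂ) ^ (n % 2) * (eta n γ x * basicChar n x.right) := rfl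

lemma chiNorm_classRep (γ : ClassFn Γ) (ρ : OP Γ) {n : ℕ} (h : ρ.size = n) :
    (chiNorm n γ).1 (classRep n ρ) =
      (Real.sqrt 2 : ℂ) ^ ρ.len * ρ.prod fun p m => γ p.2 ^ m := by
  rw [chiNorm_apply, mul_left_comm, basicChar_classRep ρ h, eta_classRep γ ρ h, mul_comm]

/-- The weight ξ in the pairing can thus be absorbed by replacing γ with ξγ. -/
lemma eta_mul_chiNorm {n : ℕ} (α γ : ClassFn Γ) (x : SpinWreath Γ n) :
    eta n α x * (chiNorm n γ).1 x = (chiNorm n (α * γ)).1 x := by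
  rw [chiNorm_apply, chiNorm_apply, ← eta_mul]
  ring

/-- The function `x ↦ f(x⁻¹)`. -/
def RMinus.inv {G : Type*} [Group G] [SuperGroup G] (f : RMinus G) : RMinus G :=
  ⟨fun x => f.1 x⁻¹, by
    refine ⟨fun x y => ?_, fun x => ?_, fun x hx => ?_⟩
    · change f.1 (y * x * y⁻¹)⁻¹ = f.1 x⁻¹
      rw [← RMinus.conj f x⁻¹ y]
      group
    · change f.1 (SuperGroup.z * x)⁻¹ = -f.1 x⁻¹
      rw [← RMinus.spin f, mul_inv_rev, inv_eq_of_mul_eq_one_right (a := SuperGroup.z) SuperGroup.z_sq,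
        SuperGroup.z_comm]
    · exact RMinus.odd f (by rw [map_inv, hx]; rfl)⟩

lemma RMinus.inv_apply {G : Type*} [Group G] [SuperGroup G] (f : RMinus G) (x : G) :
    (RMinus.inv f).1 x = f.1 x⁻¹ := rfl

lemma chiNorm_inv_classRep (γ : ClassFn Γ) (ρ : OP Γ) {n : ℕ} (h : ρ.size = n) :
    (RMinus.inv (chiNorm n γ)).1 (classRep n ρ) =
      (Real.sqrt 2 : ℂ) ^ ρ.len * ρ.prod fun p m => dual γ p.2 ^ m := by
  have hr : (classRep n ρ)⁻¹.right = (blockSpin n 0 ρ.parts)⁻¹ := rfl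
  rw [RMinus.inv_apply, chiNorm_apply, mul_left_comm, hr,
    basicChar_blockSpin_inv _ (by rw [OP.lsum_parts, h]), ← classRep_right, basicChar_classRep ρ h,
    eta_inv, eta_classRep _ ρ h, mul_comm]

/-- Substituting the inverse of `x` gives an average of the form in `avg_left`, and replaces ξγ by
its dual because the basic spin character is real on odd types. The restriction to even `x` drops
out, since the character vanishes on odd elements. -/
lemma contract_res {n m N : ℕ} (h : n + m = N) (ξ γ : ClassFn Γ) (φ : RMinus (SpinWreath Γ N))
    (y : SpinWreath Γ m) (hy : SuperGroup.d y = 1) :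
    (contract h (fun x => eta n ξ x * (chiNorm n γ).1 x) (res (spinProd Γ n m N h) φ)).1 y =
      ∑ ρ ∈ OP.ofSize Γ n, (ρ.bigZ : ℂ)⁻¹ * ((Real.sqrt 2 : ℂ) ^ ρ.len *
        (ρ.prod fun p m => dual (ξ * γ) p.2 ^ m) *
          φ.1 (emb Γ 0 n N (by omega) (classRep n ρ) * emb Γ n m N h.le y)) := by
  have h0 : 0 + n ≤ N := by omega
  have e : (contract h (fun x => eta n ξ x * (chiNorm n γ).1 x) (res (spinProd Γ n m N h) φ)).1 y =
    (Nat.card (SpinWreath Γ n) : ℂ)⁻¹ * ∑ x : SpinWreath Γ n with SuperGroup.d x = 1,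
      eta n ξ x * (chiNorm n γ).1 x * φ.1 (emb Γ 0 n N h0 x⁻¹ * emb Γ n m N h.le y) := rfl
  have e1 : ∑ x : SpinWreath Γ n with SuperGroup.d x = 1,
      eta n ξ x * (chiNorm n γ).1 x * φ.1 (emb Γ 0 n N h0 x⁻¹ * emb Γ n m N h.le y) =
      ∑ x : SpinWreath Γ n, (RMinus.inv (chiNorm n (ξ * γ))).1 x *
        φ.1 (emb Γ 0 n N h0 x * emb Γ n m N h.le y) := by
    rw [Finset.sum_filter]
    refine Fintype.sum_equiv (Equiv.inv _) _ _ fun x => ?_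
    rw [RMinus.inv_apply, Equiv.inv_apply, inv_inv, ← eta_mul_chiNorm]
    split_ifs with hd
    · rfl
    · rw [RMinus.odd (chiNorm n γ) ((Int.units_eq_one_or _).resolve_left hd), mul_zero, zero_mul]
  rw [e, e1, avg_left h _ φ y hy]
  refine Finset.sum_congr rfl fun ρ hρ => ?_
  rw [chiNorm_inv_classRep _ ρ (OP.mem_ofSize.mp hρ)]

lemma Hdown_lof (ξ γ : ClassFn Γ) {n m : ℕ} (h : n ≤ m) (f : RMinus (SpinWreath Γ m)) :
    Hdown ξ γ n (DirectSum.lof ℂ ℕ (fun k => RMinus (SpinWreath Γ k)) m f) =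
      DirectSum.lof ℂ ℕ (fun k => RMinus (SpinWreath Γ k)) (m - n)
        (contract (Nat.add_sub_cancel' h) (fun x => eta n ξ x * (chiNorm n γ).1 x)
          (res (spinProd Γ n (m - n) m (Nat.add_sub_cancel' h)) f)) := by
  rw [Hdown, DirectSum.toModule_lof, dif_pos h]
  rfl

lemma Hdown_lof_of_lt (ξ γ : ClassFn Γ) {n m : ℕ} (h : m < n) (f : RMinus (SpinWreath Γ m)) :
    Hdown ξ γ n (DirectSum.lof ℂ ℕ (fun k => RMinus (SpinWreath Γ k)) m f) = 0 := by
  rw [Hdown, DirectSum.toModule_lof, dif_neg (by omega)]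
  rfl

/-- The operator `H_n(γ)` in the monomial basis of the Fock space. -/
lemma coeff_ch_Hdown (ξ γ : ClassFn Γ) (n : ℕ) (q : RGamma Γ) (τ : OP Γ) :
    MvPolynomial.coeff τ (ch Γ (Hdown ξ γ n q)) =
      ∑ ρ ∈ OP.ofSize Γ n, (((ρ + τ).bigZ : ℂ) / (ρ.bigZ * τ.bigZ)) *
        (ρ.prod fun p m => dual (ξ * γ) p.2 ^ m) * MvPolynomial.coeff (ρ + τ) (ch Γ q) := by
  classical
  induction q using DirectSum.induction_on with
  | zero => simp
  | of m f =>
    rw [← DirectSum.lof_eq_of ℂ, ch_lof]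
    rcases lt_or_ge m n with h | h
    · rw [Hdown_lof_of_lt ξ γ h, map_zero, MvPolynomial.coeff_zero, Finset.sum_eq_zero]
      intro ρ hρ
      rw [OP.mem_ofSize] at hρ
      rw [coeff_chN, if_neg (by rw [OP.size_add]; omega), mul_zero]
    · rw [Hdown_lof ξ γ h, ch_lof, coeff_chN]
      split_ifs with hτ
      · rw [contract_res _ _ _ _ _ (d_classRep τ hτ), Finset.mul_sum]
        refine Finset.sum_congr rfl fun ρ hρ => ?_
        rw [OP.mem_ofSize] at hρ
        -- The value of `f` at the type ρ + τ is rewritten as a coefficient of ch(f). The powers of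
        -- √2 cancel and only the weights Z remain.
        rw [RMinus.classRep_add (Nat.add_sub_cancel' h) f hρ hτ, coeff_chN, if_pos (by rw [OP.size_add]; omega),
          OP.len_add, pow_add]
        have h1 := ρ.bigZ_ne_zero
        have h2 := τ.bigZ_ne_zero
        have h3 := (ρ + τ).bigZ_ne_zero
        field_simp
      · rw [Finset.sum_eq_zero]
        intro ρ hρ
        rw [OP.mem_ofSize] at hρ
        rw [coeff_chN, if_neg (by rw [OP.size_add]; omega), mul_zero]
  | add f g hf hg =>
    rw [map_add, map_add, map_add, MvPolynomial.coeff_add, hf, hg, ← Finset.sum_add_distrib]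
    refine Finset.sum_congr rfl fun ρ _ => ?_
    rw [MvPolynomial.coeff_add, mul_add]

lemma finite_Hdown_ne_zero (ξ γ : ClassFn Γ) (v : RGamma Γ) :
    {n : ℕ | Hdown ξ γ n v ≠ 0}.Finite := by
  induction v using DirectSum.induction_on with
  | zero => simp
  | of m f =>
    refine (Set.finite_Iic m).subset fun n hn => ?_
    by_contra hlt
    refine hn ?_
    rw [← DirectSum.lof_eq_of ℂ]
    exact Hdown_lof_of_lt ξ γ (not_le.mp hlt) f
  | add f g hf hg =>
    refine (hf.union hg).subset fun n hn => ?_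
    by_contra h
    rw [Set.mem_union, not_or] at h
    simp only [Set.mem_ofPred_eq, not_not] at h
    exact hn (by rw [map_add, h.1, h.2, add_zero])

/-- The characteristic of `χₙ(γ)`. -/
lemma chN_chiNorm (n : ℕ) (γ : ClassFn Γ) :
    chN n (chiNorm n γ) = ∑ ρ ∈ OP.ofSize Γ n,
      ((2 : ℂ) ^ ρ.len / ρ.bigZ * ρ.prod fun p m => γ p.2 ^ m) • ρ.mono := by
  have h : chN n (chiNorm n γ) = ∑ ρ ∈ OP.ofSize Γ n, ((Real.sqrt 2 : ℂ) ^ ρ.len / (ρ.bigZ : ℂ) *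
    (chiNorm n γ).1 (classRep n ρ)) • ρ.mono := rfl
  rw [h]
  refine Finset.sum_congr rfl fun ρ hρ => ?_
  rw [chiNorm_classRep γ ρ (OP.mem_ofSize.mp hρ)]
  -- One factor √2 for each part comes from ch, the other from the character value.
  have h2 : (2 : ℂ) = (Real.sqrt 2 : ℂ) * Real.sqrt 2 := by
    rw [← Complex.ofReal_mul, Real.mul_self_sqrt (by norm_num)]
    simp
  rw [h2, mul_pow]
  congr 1
  ring

/-- After inverting the summation variable the sum is concentrated on `c`, and the value ζ_c of
`classElt c` cancels the weight ζ_c⁻¹ of the class. -/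
lemma form_classElt (ξ γ : ClassFn Γ) (c : ConjClasses Γ) :
    form ξ γ (classElt c) = dual (ξ * γ) c := by
  obtain ⟨_⟩ := nonempty_fintype Γ
  have h1 : ∑ᶠ x : Γ, ξ (ConjClasses.mk x) * γ (ConjClasses.mk x) * classElt c (ConjClasses.mk x⁻¹)
      = ∑ x : Γ, dual (ξ * γ) (ConjClasses.mk x) * classElt c (ConjClasses.mk x) := by
    rw [finsum_eq_sum_of_fintype]
    refine Fintype.sum_equiv (Equiv.inv _) _ _ fun x => ?_
    rw [dual_mk, Equiv.inv_apply, inv_inv]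
    rfl
  rw [form, h1, sum_mk fun c' => dual (ξ * γ) c' * classElt c c', ← mul_assoc,
    inv_mul_cancel₀ (Nat.cast_ne_zero.mpr Nat.card_pos.ne'), one_mul, Finset.sum_eq_single c]
  · rw [classElt_self]
    have := zeta_ne_zero c
    field_simp
  · intro b _ hb
    rw [classElt_of_ne hb, mul_zero, mul_zero]
  · simp

end Contraction

/-! ### Exponentials of operator series through a differential equation -/

section Exponential
variable {R : Type*} [Ring R]

lemma coeff_pow_of_lt {A : PowerSeries R} (h0 : PowerSeries.coeff 0 A = 0) {n k : ℕ} (h : n < k) :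
    PowerSeries.coeff n (A ^ k) = 0 := by
  induction k generalizing n with
  | zero => omega
  | succ k ih =>
    rw [pow_succ', PowerSeries.coeff_mul, Finset.sum_eq_zero]
    intro p hp
    rw [Finset.HasAntidiagonal.mem_antidiagonal] at hp
    rcases Nat.eq_zero_or_pos p.1 with h1 | h1
    · rw [h1, h0, zero_mul]
    · rw [ih (by omega), mul_zero]

variable [Algebra ℂ R]

/-- The Euler operator `w d/dw`. -/
def euler (A : PowerSeries R) : PowerSeries R :=
  PowerSeries.mk fun n => (n : ℂ) • PowerSeries.coeff n A

@[simp] lemma coeff_euler (A : PowerSeries R) (n : ℕ) :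
    PowerSeries.coeff n (euler A) = (n : ℂ) • PowerSeries.coeff n A := PowerSeries.coeff_mk _ _

lemma euler_mul (A B : PowerSeries R) : euler (A * B) = euler A * B + A * euler B := by
  ext n
  rw [coeff_euler, map_add, PowerSeries.coeff_mul, PowerSeries.coeff_mul, PowerSeries.coeff_mul,
    Finset.smul_sum, ← Finset.sum_add_distrib]
  refine Finset.sum_congr rfl fun p hp => ?_
  rw [coeff_euler, coeff_euler, smul_mul_assoc, mul_smul_comm, ← add_smul,
    ← Finset.HasAntidiagonal.mem_antidiagonal.mp hp, Nat.cast_add]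

lemma commute_euler {A : PowerSeries R}
    (hc : ∀ i j, Commute (PowerSeries.coeff i A) (PowerSeries.coeff j A)) :
    Commute A (euler A) := by
  ext n
  rw [PowerSeries.coeff_mul, PowerSeries.coeff_mul, ← Finset.Nat.sum_antidiagonal_swap]
  refine Finset.sum_congr rfl fun p _ => ?_
  rw [coeff_euler, coeff_euler, smul_mul_assoc, mul_smul_comm]
  exact congrArg _ (hc _ _)

lemma euler_pow {A : PowerSeries R}
    (hc : ∀ i j, Commute (PowerSeries.coeff i A) (PowerSeries.coeff j A)) (j : ℕ) :
    euler (A ^ (j + 1)) = ((j : ℂ) + 1) • (euler A * A ^ j) := by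
  induction j with
  | zero => simp
  | succ j ih =>
    rw [pow_succ' A (j + 1), euler_mul, ih, mul_smul_comm, ← mul_assoc, (commute_euler hc).eq,
      mul_assoc, ← pow_succ' A j]
    push_cast
    module

/-- Higher powers of `A` do not reach degree `n`, so one truncation `M` can serve all coefficients
of a convolution. -/
lemma coeff_opExp {A : PowerSeries R} (h0 : PowerSeries.coeff 0 A = 0) {n M : ℕ} (h : n < M) :
    PowerSeries.coeff n (opExp A) =
      ∑ k ∈ Finset.range M, ((k.factorial : ℂ)⁻¹) • PowerSeries.coeff n (A ^ k) := by
  rw [opExp, PowerSeries.coeff_mk]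
  refine Finset.sum_subset (Finset.range_subset_range.mpr h) fun k _ hk => ?_
  rw [Finset.mem_range] at hk
  rw [coeff_pow_of_lt h0 (by omega), smul_zero]

lemma coeff_zero_opExp (A : PowerSeries R) : PowerSeries.coeff 0 (opExp A) = 1 := by
  simp [opExp]

/-- The differential equation of the exponential. -/
lemma smul_coeff_opExp {A : PowerSeries R} (h0 : PowerSeries.coeff 0 A = 0)
    (hc : ∀ i j, Commute (PowerSeries.coeff i A) (PowerSeries.coeff j A)) (n : ℕ) :
    (n : ℂ) • PowerSeries.coeff n (opExp A) = ∑ p ∈ Finset.HasAntidiagonal.antidiagonal n,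
      ((p.1 : ℂ) • PowerSeries.coeff p.1 A) * PowerSeries.coeff p.2 (opExp A) := by
  have h1 : ∀ k : ℕ, (((k + 1).factorial : ℂ)⁻¹) • (n : ℂ) • PowerSeries.coeff n (A ^ (k + 1)) =
      ∑ p ∈ Finset.HasAntidiagonal.antidiagonal n, ((p.1 : ℂ) • PowerSeries.coeff p.1 A) *
        ((k.factorial : ℂ)⁻¹ • PowerSeries.coeff p.2 (A ^ k)) := by
    intro k
    rw [← coeff_euler, euler_pow hc, PowerSeries.coeff_smul, smul_smul, PowerSeries.coeff_mul,
      Finset.smul_sum]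
    refine Finset.sum_congr rfl fun p _ => ?_
    rw [coeff_euler, mul_smul_comm]
    congr 1
    rw [Nat.factorial_succ]
    push_cast
    have : (k : ℂ) + 1 ≠ 0 := Nat.cast_add_one_ne_zero k
    field_simp
  rw [coeff_opExp h0 (show n < n + 2 by omega), Finset.smul_sum, Finset.sum_range_succ']
  have h2 : (n : ℂ) • ((Nat.factorial 0 : ℂ)⁻¹) • PowerSeries.coeff n (A ^ 0) = 0 := by
    rcases Nat.eq_zero_or_pos n with h | h
    · rw [h]; simp
    · rw [pow_zero, PowerSeries.coeff_one, if_neg h.ne', smul_zero, smul_zero]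
  rw [h2, add_zero, Finset.sum_congr rfl fun k _ => (smul_comm _ _ _).trans (h1 k),
    Finset.sum_comm]
  refine Finset.sum_congr rfl fun p hp => ?_
  rw [Finset.HasAntidiagonal.mem_antidiagonal] at hp
  rw [coeff_opExp h0 (show p.2 < n + 1 by omega), Finset.mul_sum]

/-- The differential equation characterizes the exponential. -/
lemma eq_opExp {A u : PowerSeries R} (h0 : PowerSeries.coeff 0 A = 0)
    (hc : ∀ i j, Commute (PowerSeries.coeff i A) (PowerSeries.coeff j A))
    (hu0 : PowerSeries.coeff 0 u = 1)
    (hu : ∀ n : ℕ, (n : ℂ) • PowerSeries.coeff n u = ∑ p ∈ Finset.HasAntidiagonal.antidiagonal n,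
      ((p.1 : ℂ) • PowerSeries.coeff p.1 A) * PowerSeries.coeff p.2 u) : u = opExp A := by
  ext n
  induction n using Nat.strong_induction_on with
  | _ n ih =>
    rcases Nat.eq_zero_or_pos n with h | h
    · rw [h, hu0, coeff_zero_opExp]
    · have hn : (n : ℂ) ≠ 0 := Nat.cast_ne_zero.mpr h.ne'
      refine smul_right_injective R hn ?_
      change (n : ℂ) • _ = (n : ℂ) • _
      rw [hu, smul_coeff_opExp h0 hc]
      refine Finset.sum_congr rfl fun p hp => ?_
      rw [Finset.HasAntidiagonal.mem_antidiagonal] at hp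
      -- The term with `p.1 = 0` vanishes, so the equation determines the coefficient of degree `n`
      -- from lower ones.
      rcases Nat.eq_zero_or_pos p.1 with h1 | h1
      · rw [h1, h0, smul_zero, zero_mul, zero_mul]
      · rw [ih p.2 (by omega)]

/-- For an odd series, A(-w) = -A(w). The proof checks that the left side solves the differential
equation of the exponential of -A. -/
lemma negArg_opExp {A : PowerSeries R}
    (hodd : ∀ n, ¬ Odd n → PowerSeries.coeff n A = 0)
    (hc : ∀ i j, Commute (PowerSeries.coeff i A) (PowerSeries.coeff j A)) :
    negArg (opExp A) = opExp (-A) := by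
  have h0 : PowerSeries.coeff 0 A = 0 := hodd 0 (by decide)
  have hn : ∀ n, PowerSeries.coeff n (negArg (opExp A)) =
    ((-1 : ℂ) ^ n) • PowerSeries.coeff n (opExp A) := fun n => PowerSeries.coeff_mk _ _
  refine eq_opExp ?_ (fun i j => ?_) ?_ fun n => ?_
  · rw [map_neg, h0, neg_zero]
  · rw [map_neg, map_neg]
    exact ((hc i j).neg_left).neg_right
  · rw [hn, coeff_zero_opExp, pow_zero, one_smul]
  · rw [hn, smul_comm, smul_coeff_opExp h0 hc, Finset.smul_sum]
    refine Finset.sum_congr rfl fun p hp => ?_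
    rw [hn, ← Finset.HasAntidiagonal.mem_antidiagonal.mp hp, map_neg]
    by_cases h : Odd p.1
    · rw [pow_add, h.neg_one_pow, mul_smul_comm, neg_one_mul, neg_smul, smul_neg, neg_mul,
        smul_neg]
    · rw [hodd _ h]
      simp

/-- The exponential of `∑_{k odd} (2/k) B_k w^k`. -/
lemma eq_opExp_odd (B : {k : ℕ // Odd k} → R) (hc : ∀ i j, Commute (B i) (B j))
    {A u : PowerSeries R}
    (hA : A = PowerSeries.mk fun n => if h : Odd n then (2 / n : ℂ) • B ⟨n, h⟩ else 0)
    (hu0 : PowerSeries.coeff 0 u = 1)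
    (hu : ∀ n : ℕ, (n : ℂ) • PowerSeries.coeff n u =
      ∑ k ∈ oddLe n, (2 : ℂ) • (B k * PowerSeries.coeff (n - k) u)) : u = opExp A := by
  have hA' : ∀ n, PowerSeries.coeff n A = if h : Odd n then (2 / n : ℂ) • B ⟨n, h⟩ else 0 :=
    fun n => by rw [hA, PowerSeries.coeff_mk]
  refine eq_opExp (by rw [hA', dif_neg (by decide)]) (fun i j => ?_) hu0 fun n => ?_
  · rw [hA', hA']
    split_ifs
    · exact ((hc _ _).smul_left _).smul_right _
    · exact Commute.zero_right _
    · exact Commute.zero_left _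
    · exact Commute.zero_left _
  · rw [hu, ← sum_range_odd n fun k => (2 : ℂ) • (B k * PowerSeries.coeff (n - k) u),
      Finset.Nat.sum_antidiagonal_eq_sum_range_succ fun i j =>
        ((i : ℂ) • PowerSeries.coeff i A) * PowerSeries.coeff j u]
    refine Finset.sum_congr rfl fun k _ => ?_
    rw [hA']
    split_ifs with h
    · have hk : (k : ℂ) ≠ 0 := Nat.cast_ne_zero.mpr h.pos.ne'
      rw [smul_smul, mul_div_cancel₀ _ hk, smul_mul_assoc]
    · rw [smul_zero, zero_mul]

end Exponential

/-! ### The series H₊ and H₋ on the Fock space -/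

section Series
variable {Γ : Type u} [Group Γ]

lemma prod_pow_add_single (d : ConjClasses Γ → ℂ) (ρ : OP Γ) (p : Var Γ) :
    ((ρ + Finsupp.single p 1).prod fun q m => d q.2 ^ m) =
      (ρ.prod fun q m => d q.2 ^ m) * d p.2 := by
  classical
  rw [Finsupp.prod_add_index', Finsupp.prod_single_index, pow_one]
  · simp
  · simp
  · intros; rw [pow_add]

lemma bigZ_add_single_cast (ρ : OP Γ) (p : Var Γ) :
    ((ρ + Finsupp.single p 1).bigZ : ℂ) =
      ρ.bigZ * ((p.1 : ℕ) * zeta p.2 * ((ρ p : ℂ) + 1)) := by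
  rw [OP.bigZ_add_single]
  push_cast
  rfl

/-- Both are derivations sending generators to constants, so their commutator is a derivation that
kills the generators. -/
lemma commute_aPos (ξ γ : ClassFn Γ) (i j : {k : ℕ // Odd k}) :
    Commute (aPos ξ i γ) (aPos ξ j γ) := by
  classical
  have key : ∀ D₁ D₂ : Derivation ℂ (Fock Γ) (Fock Γ),
      (∀ p, ∃ a, D₁ (MvPolynomial.X p) = MvPolynomial.C a) →
      (∀ p, ∃ a, D₂ (MvPolynomial.X p) = MvPolynomial.C a) →
      Commute (D₁.toLinearMap : Module.End ℂ (Fock Γ)) D₂.toLinearMap := by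
    intro D₁ D₂ h₁ h₂
    have h : ⁅D₁, D₂⁆ = 0 := by
      refine MvPolynomial.derivation_ext fun p => ?_
      obtain ⟨a, ha⟩ := h₁ p
      obtain ⟨b, hb⟩ := h₂ p
      rw [Derivation.commutator_apply, ha, hb, MvPolynomial.derivation_C,
        MvPolynomial.derivation_C, sub_zero, Derivation.zero_apply]
    refine LinearMap.ext fun q => ?_
    have hq := DFunLike.congr_fun h q
    rw [Derivation.commutator_apply] at hq
    exact sub_eq_zero.mp hq
  refine key _ _ (fun p => ?_) fun p => ?_
  all_goals
    rw [MvPolynomial.mkDerivation_X]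
    split_ifs
    · exact ⟨_, rfl⟩
    · exact ⟨0, (map_zero _).symm⟩

lemma derivation_sum_apply {ι : Type*} (s : Finset ι)
    (D : ι → Derivation ℂ (Fock Γ) (Fock Γ)) (q : Fock Γ) : (∑ i ∈ s, D i) q = ∑ i ∈ s, D i q := by
  have h := congrFun (map_sum Derivation.coeFnAddMonoidHom D s) q
  rwa [Finset.sum_apply] at h

lemma commute_coeff_posSeries (ξ γ : ClassFn Γ) (i j : ℕ) :
    Commute (PowerSeries.coeff i (posSeries ξ γ)) (PowerSeries.coeff j (posSeries ξ γ)) := by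
  rw [posSeries, PowerSeries.coeff_mk, PowerSeries.coeff_mk]
  split_ifs
  · exact ((commute_aPos ξ γ _ _).smul_left _).smul_right _
  · exact Commute.zero_right _
  · exact Commute.zero_left _
  · exact Commute.zero_left _

variable [Finite Γ]

lemma aNeg_eq_sum (k : {k : ℕ // Odd k}) (γ : ClassFn Γ) :
    aNeg k γ = ∑ c, ((zeta c : ℂ)⁻¹ * γ c) • (MvPolynomial.X (k, c) : Fock Γ) :=
  finsum_eq_sum_of_fintype _

lemma odd_cast_ne_zero (k : {k : ℕ // Odd k}) : ((k : ℕ) : ℂ) ≠ 0 :=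
  Nat.cast_ne_zero.mpr k.2.pos.ne'

/-- Adding a part (k, c) to ρ multiplies the coefficient 2^{l} γ^ρ / Z_ρ by 2 γ(c) / (k ζ_c (m +
1)). The weight k (m + 1) from `OP.sum_ofSize` cancels all but 2 γ(c) / ζ_c, which is twice the
coefficient in a_{-k}(γ). -/
lemma smul_chN_chiNorm (n : ℕ) (γ : ClassFn Γ) :
    (n : ℂ) • chN n (chiNorm n γ) =
      ∑ k ∈ oddLe n, (2 : ℂ) • (aNeg k γ * chN (n - k) (chiNorm (n - k) γ)) := by
  rw [chN_chiNorm, OP.sum_ofSize]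
  refine Finset.sum_congr rfl fun k _ => ?_
  rw [aNeg_eq_sum, Finset.sum_mul, Finset.smul_sum]
  refine Finset.sum_congr rfl fun c _ => ?_
  rw [chN_chiNorm, Finset.mul_sum, Finset.smul_sum]
  refine Finset.sum_congr rfl fun ρ _ => ?_
  have h1 : (ρ + Finsupp.single (k, c) 1 : OP Γ).mono =
      (MvPolynomial.X (k, c) : Fock Γ) * ρ.mono := by
    rw [OP.mono, OP.mono, MvPolynomial.X, MvPolynomial.monomial_mul, add_comm, one_mul]
  rw [h1, bigZ_add_single_cast, prod_pow_add_single, OP.len_add, OP.len_single, smul_mul_smul_comm,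
    smul_smul, smul_smul, pow_succ]
  congr 1
  have h2 := odd_cast_ne_zero k
  have h3 := zeta_ne_zero c
  have h4 := ρ.bigZ_ne_zero
  have h5 : (ρ (k, c) : ℂ) + 1 ≠ 0 := Nat.cast_add_one_ne_zero _
  field_simp

lemma conjRingEquiv_chEquiv_apply (T : Module.End ℂ (RGamma Γ)) (q : Fock Γ) :
    (chEquiv Γ).conjRingEquiv T q = ch Γ (T ((chEquiv Γ).symm q)) := rfl

lemma ch_chEquiv_symm (q : Fock Γ) : ch Γ ((chEquiv Γ).symm q) = q :=
  (chEquiv Γ).apply_symm_apply q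

lemma coeff_map_Hplus (γ : ClassFn Γ) (n : ℕ) :
    PowerSeries.coeff n (PowerSeries.map
      ((chEquiv Γ).conjRingEquiv : _ →+* Module.End ℂ (Fock Γ)) (Hplus γ)) =
      LinearMap.mulLeft ℂ (chN n (chiNorm n γ)) := by
  refine LinearMap.ext fun q => ?_
  rw [PowerSeries.coeff_map, Hplus, PowerSeries.coeff_mk]
  refine (conjRingEquiv_chEquiv_apply _ _).trans ?_
  rw [ch_Hup, ch_chEquiv_symm, LinearMap.mulLeft_apply]

/-- The coefficients are multiplication operators, and the recursion `smul_chN_chiNorm` is the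
equation of the exponential. -/
theorem map_Hplus (γ : ClassFn Γ) :
    PowerSeries.map ((chEquiv Γ).conjRingEquiv : _ →+* Module.End ℂ (Fock Γ)) (Hplus γ) =
      opExp (negSeries γ) := by
  refine eq_opExp_odd (fun k => LinearMap.mulLeft ℂ (aNeg k γ)) (fun i j => ?_) rfl ?_ fun n => ?_
  · refine LinearMap.ext fun q => ?_
    exact mul_left_comm _ _ _
  · rw [coeff_map_Hplus, chN_chiNorm, OP.ofSize_zero, Finset.sum_singleton]
    refine LinearMap.ext fun q => ?_
    rw [LinearMap.mulLeft_apply, OP.len_zero, OP.bigZ_zero, OP.mono]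
    simp
  · rw [coeff_map_Hplus]
    refine LinearMap.ext fun q => ?_
    rw [LinearMap.smul_apply, LinearMap.mulLeft_apply, ← smul_mul_assoc, smul_chN_chiNorm,
      LinearMap.sum_apply, Finset.sum_mul]
    refine Finset.sum_congr rfl fun k _ => ?_
    rw [coeff_map_Hplus, LinearMap.smul_apply, Module.End.mul_apply, LinearMap.mulLeft_apply,
      LinearMap.mulLeft_apply, smul_mul_assoc, mul_assoc]

/-- The derivation underlying `a_n(γ)`. -/
lemma aPos_apply (ξ γ : ClassFn Γ) (k : {k : ℕ // Odd k}) (q : Fock Γ) :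
    aPos ξ k γ q = ∑ c, ((k : ℕ) / 2 * dual (ξ * γ) c : ℂ) • MvPolynomial.pderiv (k, c) q := by
  classical
  have h : (MvPolynomial.mkDerivation ℂ (A := Fock Γ) fun p : Var Γ =>
      if p.1 = k then MvPolynomial.C (((k : ℕ) : ℂ) / 2 * form ξ γ (classElt p.2)) else 0) =
      ∑ c, ((k : ℕ) / 2 * dual (ξ * γ) c : ℂ) • MvPolynomial.pderiv (k, c) := by
    refine MvPolynomial.derivation_ext fun p => ?_
    rw [MvPolynomial.mkDerivation_X, derivation_sum_apply]
    simp only [Derivation.smul_apply, MvPolynomial.pderiv_X, Pi.single_apply]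
    rw [form_classElt]
    obtain ⟨l, c⟩ := p
    split_ifs with hl
    · change l = k at hl
      subst hl
      rw [Finset.sum_eq_single c]
      · simp [MvPolynomial.smul_eq_C_mul]
      · intro b _ hb
        rw [if_neg (fun h => hb (congrArg Prod.snd h).symm), smul_zero]
      · simp
    · symm
      refine Finset.sum_eq_zero fun b _ => ?_
      rw [if_neg (fun h => hl (congrArg Prod.fst h)), smul_zero]
  have h1 := DFunLike.congr_fun h q
  rw [derivation_sum_apply] at h1
  refine Eq.trans ?_ h1
  rw [aPos]
  rfl

lemma coeff_coeff_map_Hminus (ξ γ : ClassFn Γ) (n : ℕ) (q : Fock Γ) (τ : OP Γ) :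
    MvPolynomial.coeff τ (PowerSeries.coeff n (PowerSeries.map
      ((chEquiv Γ).conjRingEquiv : _ →+* Module.End ℂ (Fock Γ)) (Hminus ξ γ)) q) =
      ∑ ρ ∈ OP.ofSize Γ n, (((ρ + τ).bigZ : ℂ) / (ρ.bigZ * τ.bigZ)) *
        (ρ.prod fun p m => dual (ξ * γ) p.2 ^ m) * MvPolynomial.coeff (ρ + τ) q := by
  rw [PowerSeries.coeff_map, Hminus, PowerSeries.coeff_mk]
  refine (congrArg _ (conjRingEquiv_chEquiv_apply _ _)).trans ?_
  rw [coeff_ch_Hdown, ch_chEquiv_symm]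

/-- The same recursion as for H₊, now checked on the coefficient of each monomial τ, with
derivatives in place of multiplications. -/
theorem map_Hminus (ξ γ : ClassFn Γ) :
    PowerSeries.map ((chEquiv Γ).conjRingEquiv : _ →+* Module.End ℂ (Fock Γ)) (Hminus ξ γ) =
      opExp (posSeries ξ γ) := by
  refine eq_opExp_odd (fun k => aPos ξ k γ) (commute_aPos ξ γ) rfl ?_ fun n => ?_
  · refine LinearMap.ext fun q => MvPolynomial.ext _ _ fun (τ : OP Γ) => ?_
    rw [coeff_coeff_map_Hminus, OP.ofSize_zero, Finset.sum_singleton, OP.bigZ_zero, zero_add,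
      Nat.cast_one, one_mul, div_self τ.bigZ_ne_zero]
    simp
  · refine LinearMap.ext fun q => MvPolynomial.ext _ _ fun (τ : OP Γ) => ?_
    rw [LinearMap.smul_apply, MvPolynomial.coeff_smul, coeff_coeff_map_Hminus, OP.sum_ofSize,
      LinearMap.sum_apply, MvPolynomial.coeff_sum]
    refine Finset.sum_congr rfl fun k _ => ?_
    rw [LinearMap.smul_apply, Module.End.mul_apply, aPos_apply, MvPolynomial.coeff_smul,
      MvPolynomial.coeff_sum, Finset.smul_sum]
    refine Finset.sum_congr rfl fun c _ => ?_
    have h0 := coeff_coeff_map_Hminus ξ γ (n - k) q (τ + Finsupp.single (k, c) 1)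
    rw [MvPolynomial.coeff_smul, MvPolynomial.coeff_pderiv, h0, Finset.sum_mul, Finset.smul_sum,
      Finset.smul_sum]
    refine Finset.sum_congr rfl fun ρ _ => ?_
    -- On the left the part (k, c) is added to ρ, on the right the partial derivative adds it to τ.
    -- In both cases the multiplicity factor cancels against the change of Z, leaving Z of the total
    -- divided by Z_ρ Z_τ ζ_c.
    rw [show ρ + Finsupp.single (k, c) 1 + τ = ρ + (τ + Finsupp.single (k, c) 1) by abel,
      bigZ_add_single_cast τ, bigZ_add_single_cast ρ, prod_pow_add_single]
    simp only [smul_eq_mul]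
    have h2 := odd_cast_ne_zero k
    have h3 := zeta_ne_zero c
    have h4 := ρ.bigZ_ne_zero
    have h5 : (ρ (k, c) : ℂ) + 1 ≠ 0 := Nat.cast_add_one_ne_zero _
    have h6 := τ.bigZ_ne_zero
    have h7 : (τ (k, c) : ℂ) + 1 ≠ 0 := Nat.cast_add_one_ne_zero _
    field_simp

end Series

/-! ### Transport of vertex operators along a linear isomorphism -/

section Modes
variable {V V' : Type*} [AddCommMonoid V] [Module ℂ V] [AddCommMonoid V'] [Module ℂ V']

lemma rTensor_conjRingEquiv {W : Type*} [AddCommMonoid W] [Module ℂ W] (e : V ≃ₗ[ℂ] V')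
    (T : Module.End ℂ V) (v : TensorProduct ℂ V W) :
    e.toLinearMap.rTensor W (T.rTensor W v) =
      (e.conjRingEquiv T).rTensor W (e.toLinearMap.rTensor W v) := by
  rw [← LinearMap.rTensor_comp_apply, ← LinearMap.rTensor_comp_apply]
  congr 2
  refine LinearMap.ext fun x => ?_
  change e (T x) = e (T (e.symm (e x)))
  rw [e.symm_apply_apply]

/-- Transport of the modes of a vertex operator along a linear isomorphism. -/
lemma rTensor_vertexMode {W : Type*} [AddCommMonoid W] [Module ℂ W] (e : V ≃ₗ[ℂ] V')
    (P M : PowerSeries (Module.End ℂ V)) (T : Module.End ℂ W) (n : ℤ) (v : TensorProduct ℂ V W) :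
    e.toLinearMap.rTensor W (vertexMode P M T n v) =
      vertexMode (PowerSeries.map (e.conjRingEquiv : _ →+* Module.End ℂ V') P)
        (PowerSeries.map (e.conjRingEquiv : _ →+* Module.End ℂ V') M) T n
        (e.toLinearMap.rTensor W v) := by
  -- An additive equivalence preserves supports, so it commutes with `finsum` even without a
  -- finiteness argument.
  have h := (e.rTensor W).toAddEquiv.map_finsum fun p : ℕ × ℕ => if (p.2 : ℤ) - p.1 = n then
    (PowerSeries.coeff p.1 P).rTensor W ((PowerSeries.coeff p.2 M).rTensor W (T.lTensor V v)) else 0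
  refine h.trans (finsum_congr fun p => ?_)
  change e.toLinearMap.rTensor W _ = _
  split_ifs
  · rw [rTensor_conjRingEquiv, rTensor_conjRingEquiv, PowerSeries.coeff_map, PowerSeries.coeff_map]
    congr 2
    -- The isomorphism and `T` act on different tensor factors and therefore commute.
    exact DFunLike.congr_fun (LinearMap.rTensor_comp_lTensor (f := e.toLinearMap) (g := T)) v |>.trans
      (DFunLike.congr_fun (LinearMap.lTensor_comp_rTensor (f := e.toLinearMap) (g := T)) v).symm
  · exact map_zero _

lemma map_negArg (e : V ≃ₗ[ℂ] V') (A : PowerSeries (Module.End ℂ V)) :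
    PowerSeries.map (e.conjRingEquiv : _ →+* Module.End ℂ V') (negArg A) =
      negArg (PowerSeries.map (e.conjRingEquiv : _ →+* Module.End ℂ V') A) := by
  ext n : 1
  rw [PowerSeries.coeff_map, negArg, negArg, PowerSeries.coeff_mk, PowerSeries.coeff_mk,
    PowerSeries.coeff_map]
  refine LinearMap.ext fun x => ?_
  exact map_smul e _ _

end Modes

end SpinWr

end

/-! ### The theorem -/

theorem mainTheorem7 {Γ : Type*} [Group Γ] [Finite Γ] (ξ : SpinWr.ClassFn Γ)
    (hξ : SpinWr.SelfDual ξ) :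
    (∀ (m : ℕ) (A : Γ →* Matrix (Fin m) (Fin m) ℂ) (γ : SpinWr.ClassFn Γ),
      (∀ g, γ (ConjClasses.mk g) = (A g).trace) →
        ∀ (n : ℕ) (x : SpinWr.SpinWreath Γ n),
          (SpinWr.chi n γ).1 x = (SpinWr.tensorSpinMat A n x).trace) ∧
    ∃ Ch : SpinWr.RGamma Γ ≃ₗ[ℂ] SpinWr.Fock Γ, (∀ f, Ch f = SpinWr.ch Γ f) ∧
      (∀ γ : SpinWr.ClassFn Γ,
        PowerSeries.map (Ch.conjRingEquiv : _ →+* Module.End ℂ (SpinWr.Fock Γ)) (SpinWr.Hplus γ) =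
          SpinWr.opExp (SpinWr.negSeries γ) ∧
        PowerSeries.map (Ch.conjRingEquiv : _ →+* Module.End ℂ (SpinWr.Fock Γ))
            (SpinWr.Hminus ξ γ) =
          SpinWr.opExp (SpinWr.posSeries ξ γ) ∧
        ∀ v, {n : ℕ | PowerSeries.coeff n (SpinWr.Hminus ξ γ) v ≠ 0}.Finite) ∧
      (ξ ∈ SpinWr.RZ Γ → ∀ (D : SpinWr.VertexData ξ) (γ : SpinWr.RZ Γ) (n : ℤ)
        (v : TensorProduct ℂ (SpinWr.RGamma Γ) (AddMonoidAlgebra ℂ (SpinWr.RZ Γ ⧸ D.Φ))),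
          Ch.toLinearMap.rTensor _ (SpinWr.groupX D γ n v) =
            SpinWr.usualX D γ n (Ch.toLinearMap.rTensor _ v)) := by
  refine ⟨fun m A γ hγ n x => SpinWr.trace_tensorSpinMat A γ hγ n x, SpinWr.chEquiv Γ,
    SpinWr.chEquiv_apply, fun γ => ⟨SpinWr.map_Hplus γ, SpinWr.map_Hminus ξ γ, fun v => ?_⟩,
    fun _ D γ n v => ?_⟩
  · exact (SpinWr.finite_Hdown_ne_zero ξ γ v).subset fun n hn => by
      rwa [SpinWr.Hminus, Set.mem_ofPred_eq, PowerSeries.coeff_mk] at hn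
  -- Oddness of the exponent turns the argument -z of H₋ into the minus sign in the usual vertex
  -- operator.
  · have hodd : ∀ n, ¬ Odd n → PowerSeries.coeff n (SpinWr.posSeries ξ γ.1) = 0 := fun n hn => by
      rw [SpinWr.posSeries, PowerSeries.coeff_mk, dif_neg hn]
    rw [SpinWr.groupX, SpinWr.usualX, SpinWr.rTensor_vertexMode, SpinWr.map_negArg,
      SpinWr.map_Hplus, SpinWr.map_Hminus,
      SpinWr.negArg_opExp hodd (SpinWr.commute_coeff_posSeries ξ γ.1)]
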